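/- Let $p_0>2$ and $c\in\mathbb R$. There is a constant $C>0$, depending only on $p_0$ and $c$, with the following property. Let $M$ be a smooth $4$-manifold (Hausdorff, $\sigma$-compact, without boundary), $T>0$, and let $g(t)$, $0\le t<T$, be a smooth one-parameter family of smooth Riemannian metrics on $M$. Let $x\in M$, $r>0$, and let $B=B_r(x)$ be the open geodesic ball of the metric $g(0)$. Assume that $(M,g(0))$ is complete or, more generally, that for every $s<r$ each $g(0)$-Cauchy sequence of points at $g(0)$-distance at most $s$ from $x$ converges in $M$. Assume that $\tfrac12 g(0)\le g(t)\le 2g(0)$ on $B$ for all $t\in[0,T)$, and that $A>0$ is a constant with $$\Big(\int_B\varphi^4\,dV_{g(t)}\Big)^{1/2}\le A\int_B|\nabla\varphi|_{g(t)}^2\,dV_{g(t)}\qquad\text{for all }\varphi\in C_0^\infty(B),\ t\in[0,T).$$ Let $f,u\ge 0$ be functions on $B\times(0,T)$, with $f$ of class $C^{2,1}$ (that is, $f$, $\partial_tf$ and the first and second space derivatives of $f$ exist and are continuous) and $u(\cdot,t)$ measurable for each $t$. Let $\mu\ge0$, and suppose that for all $t\in(0,T)$ $$\frac{\partial f}{\partial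 t}\le\Delta_{g(t)}f+uf\ \text{ on }B,\qquad \frac{\partial}{\partial t}dV_{g(t)}\le c\,u\,dV_{g(t)}\ \text{ on }B,\qquad \Big(\int_Bu^3\,dV_{g(t)}\Big)^{1/3}\le\mu\,t^{-1/3}.$$ Then for every $t\in(0,T)$ $$|f(x,t)|\le C\,A^{2/p_0}\Big((1+A^2\mu^3)\,t^{-1}+\frac1{r^2}\Big)^{3/p_0}\Big(\int_0^T\!\!\int_Bf^{p_0}\,dV_{g(s)}\,ds\Big)^{1/p_0},$$ where the right-hand side is $+\infty$ if the integral diverges. -/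

import Mathlib

open Set Filter Topology MeasureTheory
open scoped Manifold ContDiff ENNReal Bundle

noncomputable section

namespace RiemannianHeat

/-- A smooth Riemannian metric on the smooth `n`-manifold `M`. -/
abbrev Metric (n : ℕ) (M : Type*) [TopologicalSpace M] [ChartedSpace (EuclideanSpace ℝ (Fin n)) M]
    [IsManifold (𝓡 n) ∞ M] :=
  Bundle.ContMDiffRiemannianMetric (𝓡 n) ∞ (EuclideanSpace ℝ (Fin n))
    (fun y : M => TangentSpace (𝓡 n) y)

section

variable {n : ℕ} {M : Type*} [TopologicalSpace M] [ChartedSpace (EuclideanSpace ℝ (Fin n)) M]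
  [IsManifold (𝓡 n) ∞ M]

/-- The `i`-th coordinate vector field `∂_i` of the chart around `z`, at the point with
coordinates `p`. -/
def coordVec (z : M) (p : EuclideanSpace ℝ (Fin n)) (i : Fin n) :
    TangentSpace (𝓡 n) ((extChartAt (𝓡 n) z).symm p) :=
  mfderiv 𝓘(ℝ, EuclideanSpace ℝ (Fin n)) (𝓡 n) (extChartAt (𝓡 n) z).symm p
    (EuclideanSpace.single i (1 : ℝ))

/-- The matrix `g_{ij} = g(∂_i, ∂_j)` in the chart around `z`, at the point with coordinates `p`. -/
def metricMatrix (g : Metric n M) (z : M) (p : EuclideanSpace ℝ (Fin n)) :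
    Matrix (Fin n) (Fin n) ℝ :=
  Matrix.of fun i j =>
    g.inner ((extChartAt (𝓡 n) z).symm p) (coordVec z p i) (coordVec z p j)

/-- The density `√det(g_{ij})` of the Riemannian volume in the chart around `z`. -/
def volDensity (g : Metric n M) (z : M) (p : EuclideanSpace ℝ (Fin n)) : ℝ :=
  √((metricMatrix g z p).det)

/-- The `i`-th partial derivative of a function of the coordinates. -/
def partialD (i : Fin n) (F : EuclideanSpace ℝ (Fin n) → ℝ) (p : EuclideanSpace ℝ (Fin n)) : ℝ :=
  fderiv ℝ F p (EuclideanSpace.single i (1 : ℝ))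

/-- `|∇φ|² = ∑ g^{ij} ∂_i φ ∂_j φ` at `y`, computed in the chart around `y`. -/
def gradNormSq (g : Metric n M) (φ : M → ℝ) (y : M) : ℝ :=
  ∑ i, ∑ j, (metricMatrix g y (extChartAt (𝓡 n) y y))⁻¹ i j *
    partialD i (φ ∘ (extChartAt (𝓡 n) y).symm) (extChartAt (𝓡 n) y y) *
    partialD j (φ ∘ (extChartAt (𝓡 n) y).symm) (extChartAt (𝓡 n) y y)

/-- The Laplace–Beltrami operator
`Δφ = (√det g)⁻¹ ∑ ∂_i (√det g ∑ g^{ij} ∂_j φ)` at `y`, computed in the chart around `y`. -/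
def laplacian (g : Metric n M) (φ : M → ℝ) (y : M) : ℝ :=
  (volDensity g y (extChartAt (𝓡 n) y y))⁻¹ *
    ∑ i, partialD i (fun p => volDensity g y p *
      ∑ j, (metricMatrix g y p)⁻¹ i j * partialD j (φ ∘ (extChartAt (𝓡 n) y).symm) p)
      (extChartAt (𝓡 n) y y)

/-- The Riemannian distance: the infimum of the `g`-lengths of `C¹` curves. -/
def riemDist (g : Metric n M) (x y : M) : ℝ≥0∞ :=
  letI : Bundle.RiemannianBundle (fun y : M => TangentSpace (𝓡 n) y) := ⟨g.toRiemannianMetric⟩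
  Manifold.riemannianEDist (𝓡 n) x y

/-- The open geodesic ball `B_r(x)` of the metric `g`. -/
def geodesicBall (g : Metric n M) (x : M) (r : ℝ) : Set M :=
  {y | riemDist g x y < ENNReal.ofReal r}

/-- Every Cauchy sequence of the metric `g` that stays in a concentric ball of radius `s < r`
converges. This holds for all balls if `g` is complete, and for a given ball `B_r(x)` if the smaller
closed concentric balls are compact. -/
def CompleteInside (g : Metric n M) (x : M) (r : ℝ) : Prop :=
  ∀ s < r, ∀ y : ℕ → M, (∀ k, riemDist g x (y k) ≤ ENNReal.ofReal s) →
    (∀ ε > 0, ∃ N, ∀ k ≥ N, ∀ l ≥ N, riemDist g (y k) (y l) < ε) →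
    ∃ z, Tendsto y atTop (𝓝 z)

/-- The family `g(t)`, `t ∈ J`, is smooth: its components in the charts are smooth functions of
time and of the coordinates. -/
def SmoothFamilyOn (g : ℝ → Metric n M) (J : Set ℝ) : Prop :=
  ∀ (z : M) (i j : Fin n), ContDiffOn ℝ ∞
    (fun q : ℝ × EuclideanSpace ℝ (Fin n) => metricMatrix (g q.1) z q.2 i j)
    (J ×ˢ (extChartAt (𝓡 n) z).target)

/-- `f` is of class `C^{2,1}` on `U × J`: it is twice differentiable in space and once in time,
and `f`, `∂_t f` and the first and second space derivatives are jointly continuous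
(in every chart). -/
structure ClassC21On (f : ℝ → M → ℝ) (J : Set ℝ) (U : Set M) : Prop where
  time_diff : ∀ y ∈ U, ∀ t ∈ J, DifferentiableAt ℝ (fun s => f s y) t
  space_diff : ∀ z : M, ∀ t ∈ J, ContDiffOn ℝ 2 (f t ∘ (extChartAt (𝓡 n) z).symm)
    ((extChartAt (𝓡 n) z).target ∩ (extChartAt (𝓡 n) z).symm ⁻¹' U)
  cont : ∀ z : M, ContinuousOn
    (fun q : ℝ × EuclideanSpace ℝ (Fin n) => f q.1 ((extChartAt (𝓡 n) z).symm q.2))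
    (J ×ˢ ((extChartAt (𝓡 n) z).target ∩ (extChartAt (𝓡 n) z).symm ⁻¹' U))
  time_cont : ∀ z : M, ContinuousOn
    (fun q : ℝ × EuclideanSpace ℝ (Fin n) =>
      deriv (fun s => f s ((extChartAt (𝓡 n) z).symm q.2)) q.1)
    (J ×ˢ ((extChartAt (𝓡 n) z).target ∩ (extChartAt (𝓡 n) z).symm ⁻¹' U))
  space_cont : ∀ (z : M) (i : Fin n), ContinuousOn
    (fun q : ℝ × EuclideanSpace ℝ (Fin n) =>
      partialD i (f q.1 ∘ (extChartAt (𝓡 n) z).symm) q.2)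
    (J ×ˢ ((extChartAt (𝓡 n) z).target ∩ (extChartAt (𝓡 n) z).symm ⁻¹' U))
  space_cont₂ : ∀ (z : M) (i j : Fin n), ContinuousOn
    (fun q : ℝ × EuclideanSpace ℝ (Fin n) =>
      partialD i (partialD j (f q.1 ∘ (extChartAt (𝓡 n) z).symm)) q.2)
    (J ×ˢ ((extChartAt (𝓡 n) z).target ∩ (extChartAt (𝓡 n) z).symm ⁻¹' U))

end

section

variable {n : ℕ} {M : Type*} [TopologicalSpace M] [ChartedSpace (EuclideanSpace ℝ (Fin n)) M]
  [IsManifold (𝓡 n) ∞ M] [MeasurableSpace M] [BorelSpace M]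

/-- The Riemannian volume on the domain of the chart around `z`: the image of
`√det(g_{ij}) dp` under the inverse of the chart. -/
def chartVol (g : Metric n M) (z : M) : Measure M :=
  ((volume.restrict (extChartAt (𝓡 n) z).target).withDensity
    (fun p => ENNReal.ofReal (volDensity g z p))).map (extChartAt (𝓡 n) z).symm

variable (n M) in
/-- A smooth partition of unity subordinate to the chart domains. -/
def chartPartition [T2Space M] [SigmaCompactSpace M] :
    SmoothPartitionOfUnity M (𝓡 n) M univ :=
  (SmoothPartitionOfUnity.exists_isSubordinate_chartAt_source (𝓡 n) M).choose

/-- The Riemannian volume measure `dV_g`, glued from the charts by a partition of unity. -/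
def vol [T2Space M] [SigmaCompactSpace M] (g : Metric n M) : Measure M :=
  Measure.sum fun z : M =>
    (chartVol g z).withDensity (fun y => ENNReal.ofReal (chartPartition n M z y))

/-- The Sobolev inequality `(∫_B φ⁴ dV)^{1/2} ≤ A ∫_B |∇φ|² dV` for all `φ ∈ C_0^∞(B)`. -/
def SobolevOn [T2Space M] [SigmaCompactSpace M] (g : Metric n M) (B : Set M) (A : ℝ) : Prop :=
  ∀ φ : M → ℝ, ContMDiff (𝓡 n) 𝓘(ℝ, ℝ) ∞ φ → HasCompactSupport φ → tsupport φ ⊆ B →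
    (∫ y in B, φ y ^ 4 ∂(vol g)) ^ (1 / 2 : ℝ) ≤ A * ∫ y in B, gradNormSq g φ y ∂(vol g)

end

end RiemannianHeat

end

/-! The estimate is a parabolic mean value inequality, proved by Moser iteration. Let φ be a cutoff
function in B, q > 2 and h = φ f^{q/2}. Testing the differential inequality with q φ² f^{q-1} and
using the bound on ∂_t dV gives d/dt ∫ h² + 2 ∫ |∇h|² ≤ 2 ∫ f^q |∇φ|² + (q + max c 0) ∫ u h². The
potential term is subcritical. By Hölder and Cauchy–Schwarz, ∫ u h² ≤ ‖u‖₃ (∫ h²)^{1/3} (∫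
h⁴)^{1/3}, and Young's inequality (`mul_le_add_of_le_rpow`) splits this, including its factor P = q
+ max c 0, into (∫ h⁴)^{1/2}/A plus P³ ‖u‖₃³ A² ∫ h². The Sobolev inequality bounds each of the two
copies of ∫ |∇h|² below by (∫ h⁴)^{1/2}/A: one copy absorbs the Young term, the other stays on the
left (`integral_laplacian_add_le`, `IsSubsolution.exists_hasDerivAt`). Since ‖u‖₃³ ≤ μ³/t, the
coefficient of ∫ h² is at most of order q³ A² μ³/t on [t/2, t], which is where 1 + A² μ³ comes from.

Integrating in time bounds both sup ∫ h² and ∫ (∫ h⁴)^{1/2} dt. As ∫ h³ ≤ (∫ h²)^{1/2} (∫ h⁴)^{1/2},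
a space-time bound with exponent q becomes one with exponent 3q/2 (`moser_step`). With shrinking
cutoffs and time intervals and q_k = p₀ (3/2)^k, this reads Y_{k+1} ≤ A (D 4^k Y_k)^{3/2}, with D a
multiple of (1 + A² μ³)/t + 1/r². The recursion is solved exactly in `moser_iterate`. If 0 < L <
f(x,t), continuity gives Y_k ≥ m L^{q_k} with m > 0 independent of k, so letting k → ∞ yields L^{p₀}
≤ 64² A² D³ Y_0 (`rpow_le_of_moser`). The p₀-th root has the claimed powers A^{2/p₀} and D^{3/p₀}.

The rest supplies the Riemannian analysis in charts: independence of the chart for gradient, volume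
and Laplacian; Green's formula; the Sobolev inequality for C¹ functions, needed because f^{q/2} need
not be smooth at zeros of f; differentiation of integrals against a moving volume; and smooth
cutoffs in the geodesic ball (`exists_cutoffs`), built from a mollified distance function and
compactness of smaller balls by Hopf–Rinow. -/

noncomputable section

set_option linter.unusedSectionVars false

namespace RiemannianHeat

local notation "𝔼" n => EuclideanSpace ℝ (Fin n)

/-! ### Transition maps and the transformation of the metric. -/

section ChartCalculus

variable {n : ℕ} {M : Type*} [TopologicalSpace M] [ChartedSpace (EuclideanSpace ℝ (Fin n)) M]
  [IsManifold (𝓡 n) ∞ M]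

/-- The transition map from the coordinates around `z` to the coordinates around `z'`. -/
def trans (n : ℕ) {M : Type*} [TopologicalSpace M] [ChartedSpace (EuclideanSpace ℝ (Fin n)) M]
    (z z' : M) : (𝔼 n) → 𝔼 n :=
  extChartAt (𝓡 n) z' ∘ (extChartAt (𝓡 n) z).symm

/-- The domain of the transition map. -/
def overlap (n : ℕ) {M : Type*} [TopologicalSpace M] [ChartedSpace (EuclideanSpace ℝ (Fin n)) M]
    (z z' : M) : Set (𝔼 n) :=
  (extChartAt (𝓡 n) z).target ∩ (extChartAt (𝓡 n) z).symm ⁻¹' (extChartAt (𝓡 n) z').source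

theorem isOpen_chart_inter_preimage (z : M) {U : Set M} (hU : IsOpen U) :
    IsOpen ((extChartAt (𝓡 n) z).target ∩ (extChartAt (𝓡 n) z).symm ⁻¹' U) :=
  (continuousOn_extChartAt_symm z).isOpen_inter_preimage (isOpen_extChartAt_target z) hU

theorem isOpen_overlap (z z' : M) : IsOpen (overlap n z z') :=
  isOpen_chart_inter_preimage z (isOpen_extChartAt_source z')

theorem contDiffOn_trans (z z' : M) : ContDiffOn ℝ ∞ (trans n z z') (overlap n z z') := by
  have h1 : ContMDiffOn 𝓘(ℝ, 𝔼 n) (𝓡 n) ∞ (extChartAt (𝓡 n) z).symm (extChartAt (𝓡 n) z).target :=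
    contMDiffOn_extChartAt_symm z
  have h2 : ContMDiffOn (𝓡 n) 𝓘(ℝ, 𝔼 n) ∞ (extChartAt (𝓡 n) z') (chartAt (𝔼 n) z').source :=
    contMDiffOn_extChartAt
  have := h2.comp (h1.mono (inter_subset_left (t := (extChartAt (𝓡 n) z).symm ⁻¹'
    (extChartAt (𝓡 n) z').source))) (fun p hp => by
      have := hp.2
      rwa [mem_preimage, extChartAt_source] at this)
  exact contMDiffOn_iff_contDiffOn.1 this

theorem differentiableAt_trans {z z' : M} {p : 𝔼 n} (hp : p ∈ overlap n z z') :
    DifferentiableAt ℝ (trans n z z') p :=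
  ((contDiffOn_trans z z').contDiffAt ((isOpen_overlap z z').mem_nhds hp)).differentiableAt
    (by simp)

theorem symm_trans {z z' : M} {p : 𝔼 n} (hp : p ∈ overlap n z z') :
    (extChartAt (𝓡 n) z').symm (trans n z z' p) = (extChartAt (𝓡 n) z).symm p :=
  (extChartAt (𝓡 n) z').left_inv hp.2

theorem trans_mem {z z' : M} {p : 𝔼 n} (hp : p ∈ overlap n z z') :
    trans n z z' p ∈ overlap n z' z := by
  refine ⟨(extChartAt (𝓡 n) z').map_source hp.2, ?_⟩
  rw [mem_preimage, symm_trans hp]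
  exact (extChartAt (𝓡 n) z).map_target hp.1

theorem trans_trans {z z' : M} {p : 𝔼 n} (hp : p ∈ overlap n z z') :
    trans n z' z (trans n z z' p) = p := by
  rw [trans, Function.comp_apply, symm_trans hp, (extChartAt (𝓡 n) z).right_inv hp.1]

/-- The derivative of the inverse chart. -/
def symmD (z : M) (p : 𝔼 n) : (𝔼 n) →L[ℝ] (𝔼 n) :=
  mfderiv 𝓘(ℝ, 𝔼 n) (𝓡 n) (extChartAt (𝓡 n) z).symm p

/-- The metric as a bilinear form on the model space. -/
def form (g : Metric n M) (y : M) : (𝔼 n) →L[ℝ] (𝔼 n) →L[ℝ] ℝ := g.inner y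

theorem metricMatrix_eq (g : Metric n M) (z : M) (p : 𝔼 n) (i j : Fin n) :
    metricMatrix g z p i j = form g ((extChartAt (𝓡 n) z).symm p)
      (symmD z p (EuclideanSpace.single i 1)) (symmD z p (EuclideanSpace.single j 1)) := rfl

theorem mdifferentiableAt_symm (z : M) {p : 𝔼 n} (hp : p ∈ (extChartAt (𝓡 n) z).target) :
    MDifferentiableAt 𝓘(ℝ, 𝔼 n) (𝓡 n) (extChartAt (𝓡 n) z).symm p := by
  have : ContMDiffOn 𝓘(ℝ, 𝔼 n) (𝓡 n) ∞ (extChartAt (𝓡 n) z).symm (extChartAt (𝓡 n) z).target :=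
    contMDiffOn_extChartAt_symm z
  exact (this.contMDiffAt ((isOpen_extChartAt_target z).mem_nhds hp)).mdifferentiableAt (by simp)

theorem symmD_trans {z z' : M} {p : 𝔼 n} (hp : p ∈ overlap n z z') :
    symmD z p = (symmD z' (trans n z z' p)).comp (fderiv ℝ (trans n z z') p) := by
  have h1 : MDifferentiableAt 𝓘(ℝ, 𝔼 n) (𝓡 n) (extChartAt (𝓡 n) z').symm (trans n z z' p) :=
    mdifferentiableAt_symm z' (trans_mem hp).1
  have h2 : MDifferentiableAt 𝓘(ℝ, 𝔼 n) 𝓘(ℝ, 𝔼 n) (trans n z z') p :=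
    (differentiableAt_trans hp).mdifferentiableAt
  have h3 := mfderiv_comp p h1 h2
  have h4 : (extChartAt (𝓡 n) z).symm =ᶠ[𝓝 p] (extChartAt (𝓡 n) z').symm ∘ trans n z z' := by
    filter_upwards [(isOpen_overlap z z').mem_nhds hp] with q hq
    exact (symm_trans hq).symm
  have h5 := h4.mfderiv_eq (I := 𝓘(ℝ, 𝔼 n)) (I' := 𝓡 n)
  rw [mfderiv_eq_fderiv] at h3
  exact h5.trans h3

theorem symmD_injective {z : M} {p : 𝔼 n} (hp : p ∈ (extChartAt (𝓡 n) z).target) :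
    Function.Injective (symmD z p) := by
  have h := isInvertible_mfderivWithin_extChartAt_symm (I := 𝓡 n) hp
  rw [modelWithCornersSelf_coe, range_id, mfderivWithin_univ] at h
  obtain ⟨e, he⟩ := h
  have h' : Function.Injective
      (mfderiv 𝓘(ℝ, 𝔼 n) (𝓡 n) (extChartAt (𝓡 n) z).symm p) := by
    rw [← he]; exact e.injective
  exact h'

theorem form_symm (g : Metric n M) (y : M) (v w : 𝔼 n) : form g y v w = form g y w v :=
  g.symm y v w

theorem form_pos (g : Metric n M) (y : M) {v : 𝔼 n} (hv : v ≠ 0) : 0 < form g y v v :=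
  g.pos y v hv

theorem euclidean_sum_single (v : 𝔼 n) : v = ∑ i, v i • EuclideanSpace.single i (1 : ℝ) := by
  ext j
  simp [Finset.sum_apply, Pi.single_apply]

open Matrix in
theorem dotProduct_metricMatrix (g : Metric n M) (z : M) (p v w : 𝔼 n) :
    (v : Fin n → ℝ) ⬝ᵥ (metricMatrix g z p *ᵥ w) =
      form g ((extChartAt (𝓡 n) z).symm p) (symmD z p v) (symmD z p w) := by
  conv_rhs => rw [euclidean_sum_single v, euclidean_sum_single w]
  simp only [map_sum, map_smul, _root_.sum_apply, _root_.smul_apply,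
    dotProduct, mulVec, metricMatrix_eq, smul_eq_mul, Finset.mul_sum]
  rw [Finset.sum_comm]
  refine Finset.sum_congr rfl fun i _ => Finset.sum_congr rfl fun j _ => ?_
  ring

open Matrix in
theorem posDef_metricMatrix (g : Metric n M) {z : M} {p : 𝔼 n}
    (hp : p ∈ (extChartAt (𝓡 n) z).target) : (metricMatrix g z p).PosDef := by
  refine Matrix.PosDef.of_dotProduct_mulVec_pos ?_ ?_
  · ext i j
    simp only [conjTranspose_apply, star_trivial, metricMatrix_eq]
    exact form_symm _ _ _ _
  · intro v hv
    have := dotProduct_metricMatrix g z p (WithLp.toLp 2 v) (WithLp.toLp 2 v)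
    simp only [star_trivial]
    refine lt_of_lt_of_eq (form_pos g _ ?_) this.symm
    intro h
    apply hv
    have h2 := symmD_injective hp (h.trans (map_zero _).symm)
    simpa using congrArg (WithLp.ofLp) h2

/-- The Jacobian matrix of the transition map. -/
def jac (z z' : M) (p : 𝔼 n) : Matrix (Fin n) (Fin n) ℝ :=
  Matrix.of fun k i => fderiv ℝ (trans n z z') p (EuclideanSpace.single i 1) k

open Matrix in
theorem metricMatrix_trans (g : Metric n M) {z z' : M} {p : 𝔼 n} (hp : p ∈ overlap n z z') :
    metricMatrix g z p =
      (jac z z' p)ᵀ * metricMatrix g z' (trans n z z' p) * jac z z' p := by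
  ext i j
  have := dotProduct_metricMatrix g z' (trans n z z' p)
    (fderiv ℝ (trans n z z') p (EuclideanSpace.single i 1))
    (fderiv ℝ (trans n z z') p (EuclideanSpace.single j 1))
  rw [metricMatrix_eq, symmD_trans hp, ← symm_trans hp]
  refine this.symm.trans ?_
  rw [Matrix.mul_assoc, Matrix.mul_apply]
  rfl

theorem det_metricMatrix_pos (g : Metric n M) {z : M} {p : 𝔼 n}
    (hp : p ∈ (extChartAt (𝓡 n) z).target) : 0 < (metricMatrix g z p).det :=
  (posDef_metricMatrix g hp).det_pos

theorem volDensity_pos (g : Metric n M) {z : M} {p : 𝔼 n}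
    (hp : p ∈ (extChartAt (𝓡 n) z).target) : 0 < volDensity g z p :=
  Real.sqrt_pos.2 (det_metricMatrix_pos g hp)

theorem volDensity_trans (g : Metric n M) {z z' : M} {p : 𝔼 n} (hp : p ∈ overlap n z z') :
    volDensity g z p = |(jac z z' p).det| * volDensity g z' (trans n z z' p) := by
  rw [volDensity, metricMatrix_trans g hp, Matrix.det_mul, Matrix.det_mul, Matrix.det_transpose,
    volDensity, ← Real.sqrt_sq_eq_abs, ← Real.sqrt_mul (sq_nonneg _)]
  congr 1; ring

theorem det_fderiv_trans (z z' : M) (p : 𝔼 n) :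
    (fderiv ℝ (trans n z z') p).det = (jac z z' p).det := by
  rw [ContinuousLinearMap.det, ← LinearMap.det_toMatrix (EuclideanSpace.basisFun (Fin n) ℝ).toBasis]
  congr 1

/-- The metric is only a device: its densities in the two charts are positive and differ by the
factor |det J|. -/
theorem det_jac_ne_zero {z z' : M} [hM : Nonempty (Metric n M)] {p : 𝔼 n}
    (hp : p ∈ overlap n z z') : (jac z z' p).det ≠ 0 := by
  obtain ⟨g⟩ := hM
  have h := volDensity_pos g hp.1
  rw [volDensity_trans g hp] at h
  intro h0
  simp [h0] at h

end ChartCalculus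

/-! ### Quadratic forms of positive definite matrices; the gradient and its invariance. -/

section Gradient

open Matrix

theorem contDiffOn_matrix_det {X : Type*} [NormedAddCommGroup X] [NormedSpace ℝ X] {m : ℕ}
    {k : WithTop ℕ∞} {s : Set X} {G : X → Matrix (Fin m) (Fin m) ℝ}
    (hG : ∀ i j, ContDiffOn ℝ k (fun q => G q i j) s) :
    ContDiffOn ℝ k (fun q => (G q).det) s := by
  simp only [Matrix.det_apply']
  refine ContDiffOn.sum fun σ _ => contDiffOn_const.mul ?_
  exact contDiffOn_prod fun i _ => hG _ _

/-- By Cramer's rule the entries of the inverse are quotients of polynomials in the entries. -/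
theorem contDiffOn_matrix_inv {X : Type*} [NormedAddCommGroup X] [NormedSpace ℝ X] {m : ℕ}
    {k : WithTop ℕ∞} {s : Set X} {G : X → Matrix (Fin m) (Fin m) ℝ}
    (hG : ∀ i j, ContDiffOn ℝ k (fun q => G q i j) s) (h0 : ∀ q ∈ s, (G q).det ≠ 0)
    (i j : Fin m) : ContDiffOn ℝ k (fun q => (G q)⁻¹ i j) s := by
  have h1 : (fun q => (G q)⁻¹ i j) =
      fun q => ((G q).det)⁻¹ * ((G q).updateRow j (Pi.single i 1)).det := by
    funext q
    rw [Matrix.inv_def, Matrix.smul_apply, Ring.inverse_eq_inv', Matrix.adjugate_apply, smul_eq_mul]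
  rw [h1]
  refine ((contDiffOn_matrix_det hG).inv h0).mul (contDiffOn_matrix_det fun a b => ?_)
  by_cases h : a = j
  · subst h; simp only [Matrix.updateRow_self]; exact contDiffOn_const
  · simp only [Matrix.updateRow_ne h]; exact hG a b

/-- With b = G⁻¹a one has a·v = b·Gv and a·G⁻¹a = b·Gb, so this is the Cauchy–Schwarz inequality of
G. -/
theorem posDef_sq_dotProduct_le {m : ℕ} {G : Matrix (Fin m) (Fin m) ℝ} (hG : G.PosDef)
    (a v : Fin m → ℝ) : (a ⬝ᵥ v) ^ 2 ≤ (a ⬝ᵥ (G⁻¹ *ᵥ a)) * (v ⬝ᵥ (G *ᵥ v)) := by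
  have hdet : IsUnit G.det := hG.det_pos.ne'.isUnit
  have hsymm : Gᵀ = G := by simpa using hG.isHermitian.eq
  set b := G⁻¹ *ᵥ a with hb
  have hGb : G *ᵥ b = a := by
    rw [hb, mulVec_mulVec, Matrix.mul_nonsing_inv _ hdet, one_mulVec]
  have hsw : ∀ x y : Fin m → ℝ, x ⬝ᵥ (G *ᵥ y) = y ⬝ᵥ (G *ᵥ x) := by
    intro x y
    rw [dotProduct_mulVec, ← mulVec_transpose, hsymm, dotProduct_comm]
  have hnn : ∀ x : Fin m → ℝ, 0 ≤ x ⬝ᵥ (G *ᵥ x) := fun x => by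
    simpa using hG.posSemidef.dotProduct_mulVec_nonneg x
  have hab : a ⬝ᵥ b = b ⬝ᵥ (G *ᵥ b) := by rw [hGb, dotProduct_comm]
  have hav : a ⬝ᵥ v = b ⬝ᵥ (G *ᵥ v) := by rw [hsw b v, hGb, dotProduct_comm]
  rw [hab, hav]
  have key : ∀ s : ℝ, 0 ≤ (b ⬝ᵥ (G *ᵥ b)) * (s * s) + (2 * (b ⬝ᵥ (G *ᵥ v))) * s +
      (v ⬝ᵥ (G *ᵥ v)) := by
    intro s
    have := hnn (s • b + v)
    simp only [mulVec_add, mulVec_smul, add_dotProduct, dotProduct_add, smul_dotProduct,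
      dotProduct_smul, smul_eq_mul, hsw v b] at this
    linarith
  have := discrim_le_zero key
  rw [discrim] at this
  nlinarith

/-- The hypothesis is tested on v = G⁻¹a. Together with `posDef_sq_dotProduct_le` this is the
duality that turns bounds on directional derivatives, or comparisons of metrics, into bounds on
|∇φ|². -/
theorem posDef_inv_quadratic_le {m : ℕ} {G : Matrix (Fin m) (Fin m) ℝ} (hG : G.PosDef)
    {a : Fin m → ℝ} {k : ℝ} (hk : 0 ≤ k) (h : ∀ v : Fin m → ℝ, (a ⬝ᵥ v) ^ 2 ≤ k * (v ⬝ᵥ (G *ᵥ v))) :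
    a ⬝ᵥ (G⁻¹ *ᵥ a) ≤ k := by
  have hdet : IsUnit G.det := hG.det_pos.ne'.isUnit
  have h1 := h (G⁻¹ *ᵥ a)
  rw [mulVec_mulVec, Matrix.mul_nonsing_inv _ hdet, one_mulVec, dotProduct_comm _ a] at h1
  by_contra hlt
  push Not at hlt
  nlinarith

theorem posDef_inv_quadratic_nonneg {m : ℕ} {G : Matrix (Fin m) (Fin m) ℝ} (hG : G.PosDef)
    (a : Fin m → ℝ) : 0 ≤ a ⬝ᵥ (G⁻¹ *ᵥ a) := by
  simpa using hG.inv.posSemidef.dotProduct_mulVec_nonneg a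

variable {n : ℕ} {M : Type*} [TopologicalSpace M] [ChartedSpace (EuclideanSpace ℝ (Fin n)) M]
  [IsManifold (𝓡 n) ∞ M]

/-- The inner product of two covectors given by their coordinates in the chart around `z`. -/
def coinner (g : Metric n M) (z : M) (p : 𝔼 n) (a b : Fin n → ℝ) : ℝ :=
  a ⬝ᵥ ((metricMatrix g z p)⁻¹ *ᵥ b)

/-- The coordinates of the differential of `φ` in the chart around `z`. -/
def dcoord (z : M) (φ : M → ℝ) (p : 𝔼 n) : Fin n → ℝ :=
  fun i => partialD i (φ ∘ (extChartAt (𝓡 n) z).symm) p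

/-- The inner product of the gradients of `φ` and `ψ`, computed in the chart around `z`. -/
def gradInnerIn (g : Metric n M) (z : M) (φ ψ : M → ℝ) (y : M) : ℝ :=
  coinner g z (extChartAt (𝓡 n) z y) (dcoord z φ (extChartAt (𝓡 n) z y))
    (dcoord z ψ (extChartAt (𝓡 n) z y))

/-- The inner product of the gradients of `φ` and `ψ`. -/
def gradInner (g : Metric n M) (φ ψ : M → ℝ) (y : M) : ℝ := gradInnerIn g y φ ψ y

theorem coinner_eq_sum (g : Metric n M) (z : M) (p : 𝔼 n) (a b : Fin n → ℝ) :
    coinner g z p a b = ∑ i, ∑ j, (metricMatrix g z p)⁻¹ i j * a i * b j := by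
  simp only [coinner, dotProduct, mulVec, Finset.mul_sum]
  exact Finset.sum_congr rfl fun i _ => Finset.sum_congr rfl fun j _ => by ring

theorem gradNormSq_eq (g : Metric n M) (φ : M → ℝ) (y : M) :
    gradNormSq g φ y = gradInner g φ φ y :=
  (coinner_eq_sum _ _ _ _ _).symm

theorem differentiableAt_comp_symm {φ : M → ℝ} {z y : M} (hy : y ∈ (extChartAt (𝓡 n) z).source)
    (hφ : MDifferentiableAt (𝓡 n) 𝓘(ℝ, ℝ) φ y) :
    DifferentiableAt ℝ (φ ∘ (extChartAt (𝓡 n) z).symm) (extChartAt (𝓡 n) z y) := by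
  have h1 := mdifferentiableAt_symm (n := n) z ((extChartAt (𝓡 n) z).map_source hy)
  have h2 : MDifferentiableAt (𝓡 n) 𝓘(ℝ, ℝ) φ
      ((extChartAt (𝓡 n) z).symm (extChartAt (𝓡 n) z y)) := by
    rwa [(extChartAt (𝓡 n) z).left_inv hy]
  exact (h2.comp _ h1).differentiableAt

theorem mem_overlap {z z' y : M} (hz : y ∈ (extChartAt (𝓡 n) z).source)
    (hz' : y ∈ (extChartAt (𝓡 n) z').source) : extChartAt (𝓡 n) z y ∈ overlap n z z' :=
  ⟨(extChartAt (𝓡 n) z).map_source hz, by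
    rw [mem_preimage, (extChartAt (𝓡 n) z).left_inv hz]; exact hz'⟩

theorem trans_chart {z z' y : M} (hz : y ∈ (extChartAt (𝓡 n) z).source) :
    trans n z z' (extChartAt (𝓡 n) z y) = extChartAt (𝓡 n) z' y := by
  rw [trans, Function.comp_apply, (extChartAt (𝓡 n) z).left_inv hz]

theorem dcoord_trans {φ : M → ℝ} {z z' y : M} (hz : y ∈ (extChartAt (𝓡 n) z).source)
    (hz' : y ∈ (extChartAt (𝓡 n) z').source) (hφ : MDifferentiableAt (𝓡 n) 𝓘(ℝ, ℝ) φ y) :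
    dcoord z φ (extChartAt (𝓡 n) z y) =
      (jac z z' (extChartAt (𝓡 n) z y))ᵀ *ᵥ dcoord z' φ (extChartAt (𝓡 n) z' y) := by
  have hp := mem_overlap hz hz'
  have h1 : φ ∘ (extChartAt (𝓡 n) z).symm =ᶠ[𝓝 (extChartAt (𝓡 n) z y)]
      (φ ∘ (extChartAt (𝓡 n) z').symm) ∘ trans n z z' := by
    filter_upwards [(isOpen_overlap z z').mem_nhds hp] with q hq
    simp only [Function.comp_apply, symm_trans hq]
  have h2 : DifferentiableAt ℝ (φ ∘ (extChartAt (𝓡 n) z').symm)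
      (trans n z z' (extChartAt (𝓡 n) z y)) := by
    rw [trans_chart hz]; exact differentiableAt_comp_symm hz' hφ
  funext i
  rw [dcoord, partialD, h1.fderiv_eq, fderiv_comp _ h2 (differentiableAt_trans hp),
    ContinuousLinearMap.comp_apply,
    euclidean_sum_single (fderiv ℝ (trans n z z') (extChartAt (𝓡 n) z y) _), map_sum,
    trans_chart hz]
  simp only [map_smul, smul_eq_mul, mulVec, dotProduct, transpose_apply]
  rfl

/-- Differentials transform by Jᵀ and the metric by Jᵀ G J, so the Jacobians cancel in a·G⁻¹b. -/
theorem gradInnerIn_eq (g : Metric n M) {φ ψ : M → ℝ} {z z' y : M}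
    (hz : y ∈ (extChartAt (𝓡 n) z).source) (hz' : y ∈ (extChartAt (𝓡 n) z').source)
    (hφ : MDifferentiableAt (𝓡 n) 𝓘(ℝ, ℝ) φ y) (hψ : MDifferentiableAt (𝓡 n) 𝓘(ℝ, ℝ) ψ y) :
    gradInnerIn g z φ ψ y = gradInnerIn g z' φ ψ y := by
  have hp := mem_overlap hz hz'
  have : Nonempty (Metric n M) := ⟨g⟩
  have hJ : IsUnit (jac z z' (extChartAt (𝓡 n) z y)).det := (det_jac_ne_zero hp).isUnit
  have hJt : IsUnit (jac z z' (extChartAt (𝓡 n) z y))ᵀ.det := by rwa [det_transpose]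
  rw [gradInnerIn, gradInnerIn, coinner, coinner, dcoord_trans hz hz' hφ, dcoord_trans hz hz' hψ,
    metricMatrix_trans g hp, trans_chart hz, Matrix.mul_inv_rev, Matrix.mul_inv_rev, mulVec_mulVec,
    Matrix.mul_assoc, Matrix.mul_assoc, Matrix.nonsing_inv_mul _ hJt, Matrix.mul_one,
    mulVec_transpose, ← dotProduct_mulVec, mulVec_mulVec, ← Matrix.mul_assoc,
    Matrix.mul_nonsing_inv _ hJ, Matrix.one_mul]

theorem gradInner_eq_in (g : Metric n M) {φ ψ : M → ℝ} {z y : M}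
    (hz : y ∈ (extChartAt (𝓡 n) z).source)
    (hφ : MDifferentiableAt (𝓡 n) 𝓘(ℝ, ℝ) φ y) (hψ : MDifferentiableAt (𝓡 n) 𝓘(ℝ, ℝ) ψ y) :
    gradInner g φ ψ y = gradInnerIn g z φ ψ y :=
  gradInnerIn_eq g (mem_extChartAt_source y) hz hφ hψ

theorem coinner_comm (g : Metric n M) {z : M} {p : 𝔼 n} (hp : p ∈ (extChartAt (𝓡 n) z).target)
    (a b : Fin n → ℝ) : coinner g z p a b = coinner g z p b a := by
  have hs : ((metricMatrix g z p)⁻¹)ᵀ = (metricMatrix g z p)⁻¹ := by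
    simpa using (posDef_metricMatrix g hp).inv.isHermitian.eq
  rw [coinner, coinner, dotProduct_mulVec, ← mulVec_transpose, hs, dotProduct_comm]

theorem coinner_self_nonneg (g : Metric n M) {z : M} {p : 𝔼 n}
    (hp : p ∈ (extChartAt (𝓡 n) z).target) (a : Fin n → ℝ) : 0 ≤ coinner g z p a a :=
  posDef_inv_quadratic_nonneg (posDef_metricMatrix g hp) a

theorem coinner_add_left (g : Metric n M) (z : M) (p : 𝔼 n) (a a' b : Fin n → ℝ) :
    coinner g z p (a + a') b = coinner g z p a b + coinner g z p a' b := add_dotProduct _ _ _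

theorem coinner_add_right (g : Metric n M) (z : M) (p : 𝔼 n) (a b b' : Fin n → ℝ) :
    coinner g z p a (b + b') = coinner g z p a b + coinner g z p a b' := by
  rw [coinner, mulVec_add, dotProduct_add]; rfl

theorem coinner_smul_left (g : Metric n M) (z : M) (p : 𝔼 n) (k : ℝ) (a b : Fin n → ℝ) :
    coinner g z p (k • a) b = k * coinner g z p a b := smul_dotProduct _ _ _

theorem coinner_smul_right (g : Metric n M) (z : M) (p : 𝔼 n) (k : ℝ) (a b : Fin n → ℝ) :
    coinner g z p a (k • b) = k * coinner g z p a b := by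
  rw [coinner, mulVec_smul, dotProduct_smul]; rfl

theorem coinner_add_self_le (g : Metric n M) {z : M} {p : 𝔼 n}
    (hp : p ∈ (extChartAt (𝓡 n) z).target) (a b : Fin n → ℝ) :
    coinner g z p (a + b) (a + b) ≤ 2 * coinner g z p a a + 2 * coinner g z p b b := by
  have h := coinner_self_nonneg g hp (a + (-1 : ℝ) • b)
  simp only [coinner_add_left, coinner_add_right, coinner_smul_left, coinner_smul_right,
    coinner_comm g hp b a] at h ⊢
  linarith

theorem gradNormSq_nonneg (g : Metric n M) (φ : M → ℝ) (y : M) : 0 ≤ gradNormSq g φ y := by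
  rw [gradNormSq_eq]
  exact coinner_self_nonneg g (mem_extChartAt_target y) _

theorem dcoord_add {φ ψ : M → ℝ} {z y : M} (hz : y ∈ (extChartAt (𝓡 n) z).source)
    (hφ : MDifferentiableAt (𝓡 n) 𝓘(ℝ, ℝ) φ y) (hψ : MDifferentiableAt (𝓡 n) 𝓘(ℝ, ℝ) ψ y) :
    dcoord z (fun y => φ y + ψ y) (extChartAt (𝓡 n) z y) =
      dcoord z φ (extChartAt (𝓡 n) z y) + dcoord z ψ (extChartAt (𝓡 n) z y) := by
  funext i
  exact congrArg (fun L => L (EuclideanSpace.single i (1 : ℝ)))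
    (fderiv_add (differentiableAt_comp_symm hz hφ) (differentiableAt_comp_symm hz hψ))

theorem dcoord_mul {φ ψ : M → ℝ} {z y : M} (hz : y ∈ (extChartAt (𝓡 n) z).source)
    (hφ : MDifferentiableAt (𝓡 n) 𝓘(ℝ, ℝ) φ y) (hψ : MDifferentiableAt (𝓡 n) 𝓘(ℝ, ℝ) ψ y) :
    dcoord z (fun y => φ y * ψ y) (extChartAt (𝓡 n) z y) =
      φ y • dcoord z ψ (extChartAt (𝓡 n) z y) + ψ y • dcoord z φ (extChartAt (𝓡 n) z y) := by
  funext i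
  have := congrArg (fun L => L (EuclideanSpace.single i (1 : ℝ)))
    (fderiv_mul (differentiableAt_comp_symm hz hφ) (differentiableAt_comp_symm hz hψ))
  refine this.trans ?_
  simp only [_root_.add_apply, _root_.smul_apply, Function.comp_apply,
    (extChartAt (𝓡 n) z).left_inv hz]
  rfl

theorem dcoord_comp {φ : M → ℝ} {θ : ℝ → ℝ} {θ' : ℝ} {z y : M}
    (hz : y ∈ (extChartAt (𝓡 n) z).source)
    (hφ : MDifferentiableAt (𝓡 n) 𝓘(ℝ, ℝ) φ y) (hθ : HasDerivAt θ θ' (φ y)) :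
    dcoord z (fun y => θ (φ y)) (extChartAt (𝓡 n) z y) =
      θ' • dcoord z φ (extChartAt (𝓡 n) z y) := by
  funext i
  have hφ' := (differentiableAt_comp_symm hz hφ).hasFDerivAt
  have hθ' : HasDerivAt θ θ' ((φ ∘ (extChartAt (𝓡 n) z).symm) (extChartAt (𝓡 n) z y)) := by
    rwa [Function.comp_apply, (extChartAt (𝓡 n) z).left_inv hz]
  exact congrArg (fun L => L (EuclideanSpace.single i (1 : ℝ)))
    (hθ'.comp_hasFDerivAt _ hφ').fderiv

theorem dcoord_congr {φ ψ : M → ℝ} {z y : M} (hz : y ∈ (extChartAt (𝓡 n) z).source)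
    (h : φ =ᶠ[𝓝 y] ψ) :
    dcoord z φ (extChartAt (𝓡 n) z y) = dcoord z ψ (extChartAt (𝓡 n) z y) := by
  have hc : Tendsto (extChartAt (𝓡 n) z).symm (𝓝 (extChartAt (𝓡 n) z y)) (𝓝 y) := by
    have := continuousAt_extChartAt_symm' (I := 𝓡 n) hz
    rwa [ContinuousAt, (extChartAt (𝓡 n) z).left_inv hz] at this
  have h1 : φ ∘ (extChartAt (𝓡 n) z).symm =ᶠ[𝓝 (extChartAt (𝓡 n) z y)]
      ψ ∘ (extChartAt (𝓡 n) z).symm := hc.eventually h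
  funext i
  rw [dcoord, dcoord, partialD, partialD, h1.fderiv_eq]

theorem dcoord_eq_zero_of_notMem_tsupport {φ : M → ℝ} {z y : M}
    (hz : y ∈ (extChartAt (𝓡 n) z).source) (h : y ∉ tsupport φ) :
    dcoord z φ (extChartAt (𝓡 n) z y) = 0 := by
  rw [dcoord_congr hz (notMem_tsupport_iff_eventuallyEq.1 h)]
  funext i
  simp only [dcoord, partialD]
  have : (0 : M → ℝ) ∘ (extChartAt (𝓡 n) z).symm = fun _ => (0 : ℝ) := rfl
  rw [this]; simp

theorem gradInner_eq_zero_left (g : Metric n M) {φ ψ : M → ℝ} {y : M} (h : y ∉ tsupport φ) :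
    gradInner g φ ψ y = 0 := by
  rw [gradInner, gradInnerIn, dcoord_eq_zero_of_notMem_tsupport (mem_extChartAt_source y) h,
    coinner, zero_dotProduct]

theorem gradNormSq_eq_zero (g : Metric n M) {φ : M → ℝ} {y : M} (h : y ∉ tsupport φ) :
    gradNormSq g φ y = 0 := by
  rw [gradNormSq_eq, gradInner_eq_zero_left g h]

/-- Comparison of gradients for two comparable metrics. -/
theorem gradNormSq_le_of_form_le (g g' : Metric n M) {k : ℝ} (hk : 0 ≤ k) (φ : M → ℝ) {y : M}
    (h : ∀ v : TangentSpace (𝓡 n) y, g'.inner y v v ≤ k * g.inner y v v) :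
    gradNormSq g φ y ≤ k * gradNormSq g' φ y := by
  have hy := mem_extChartAt_target (I := 𝓡 n) y
  rw [gradNormSq_eq, gradNormSq_eq]
  refine posDef_inv_quadratic_le (posDef_metricMatrix g hy)
    (mul_nonneg hk (coinner_self_nonneg g' hy _)) fun v => ?_
  refine (posDef_sq_dotProduct_le (posDef_metricMatrix g' hy) _ v).trans ?_
  have h1 := dotProduct_metricMatrix g y (extChartAt (𝓡 n) y y) (WithLp.toLp 2 v) (WithLp.toLp 2 v)
  have h2 := dotProduct_metricMatrix g' y (extChartAt (𝓡 n) y y) (WithLp.toLp 2 v) (WithLp.toLp 2 v)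
  have h3 : ∀ w : 𝔼 n, form g' ((extChartAt (𝓡 n) y).symm (extChartAt (𝓡 n) y y)) w w ≤
      k * form g ((extChartAt (𝓡 n) y).symm (extChartAt (𝓡 n) y y)) w w := by
    rw [extChartAt_to_inv]; exact h
  have h4 := h3 (symmD y (extChartAt (𝓡 n) y y) (WithLp.toLp 2 v))
  rw [← h1, ← h2] at h4
  rw [mul_comm k, mul_assoc]
  exact mul_le_mul_of_nonneg_left h4 (coinner_self_nonneg g' hy _)

/-- The gradient bound from a bound for the directional derivatives in a chart. -/
theorem gradInnerIn_self_le (g : Metric n M) {φ : M → ℝ} {z y : M} {k : ℝ} (hk : 0 ≤ k)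
    (hz : y ∈ (extChartAt (𝓡 n) z).source)
    (h : ∀ v : 𝔼 n, (fderiv ℝ (φ ∘ (extChartAt (𝓡 n) z).symm) (extChartAt (𝓡 n) z y) v) ^ 2 ≤
      k * ((v : Fin n → ℝ) ⬝ᵥ (metricMatrix g z (extChartAt (𝓡 n) z y) *ᵥ v))) :
    gradInnerIn g z φ φ y ≤ k := by
  refine posDef_inv_quadratic_le (posDef_metricMatrix g ((extChartAt (𝓡 n) z).map_source hz)) hk
    fun v => ?_
  refine le_of_eq_of_le ?_ (h (WithLp.toLp 2 v))
  congr 1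
  conv_rhs => rw [euclidean_sum_single (WithLp.toLp 2 v)]
  simp only [map_sum, map_smul, smul_eq_mul, dotProduct, dcoord, partialD]
  exact Finset.sum_congr rfl fun i _ => mul_comm _ _

end Gradient

/-! ### Smoothness of the metric coefficients and ratios of volume densities. -/

section RegularMetric

variable {n : ℕ} {M : Type*} [TopologicalSpace M] [ChartedSpace (EuclideanSpace ℝ (Fin n)) M]
  [IsManifold (𝓡 n) ∞ M]

/-- The components of the metric in the charts are smooth functions of the coordinates. -/
def IsRegular (g : Metric n M) : Prop :=
  ∀ (z : M) (i j : Fin n), ContDiffOn ℝ ∞ (fun p => metricMatrix g z p i j)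
    (extChartAt (𝓡 n) z).target

theorem SmoothFamilyOn.isRegular {g : ℝ → Metric n M} {J : Set ℝ} (hg : SmoothFamilyOn g J)
    {t : ℝ} (ht : t ∈ J) : IsRegular (g t) := by
  intro z i j
  have h1 : ContDiffOn ℝ ∞ (fun p : 𝔼 n => (t, p)) (extChartAt (𝓡 n) z).target :=
    (contDiff_const.prodMk contDiff_id).contDiffOn
  exact (hg z i j).comp h1 fun p hp => ⟨ht, hp⟩

theorem IsRegular.contDiffOn_volDensity {g : Metric n M} (hg : IsRegular g) (z : M) :
    ContDiffOn ℝ ∞ (volDensity g z) (extChartAt (𝓡 n) z).target :=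
  (contDiffOn_matrix_det (hg z)).sqrt fun _ hp => (det_metricMatrix_pos g hp).ne'

theorem IsRegular.contDiffOn_inv {g : Metric n M} (hg : IsRegular g) (z : M) (i j : Fin n) :
    ContDiffOn ℝ ∞ (fun p => (metricMatrix g z p)⁻¹ i j) (extChartAt (𝓡 n) z).target :=
  contDiffOn_matrix_inv (hg z) (fun _ hp => (det_metricMatrix_pos g hp).ne') i j

theorem continuousOn_of_chart {X : Type*} [TopologicalSpace X] {F : M → X} {U : Set M}
    (hU : IsOpen U)
    (h : ∀ z : M, ContinuousOn (F ∘ (extChartAt (𝓡 n) z).symm)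
      ((extChartAt (𝓡 n) z).target ∩ (extChartAt (𝓡 n) z).symm ⁻¹' U)) :
    ContinuousOn F U := by
  intro y hy
  have hym : extChartAt (𝓡 n) y y ∈
      (extChartAt (𝓡 n) y).target ∩ (extChartAt (𝓡 n) y).symm ⁻¹' U :=
    ⟨mem_extChartAt_target y, by rwa [mem_preimage, extChartAt_to_inv]⟩
  have h1 := (h y).continuousAt ((isOpen_chart_inter_preimage y hU).mem_nhds hym)
  have h2 : ContinuousAt ((F ∘ (extChartAt (𝓡 n) y).symm) ∘ extChartAt (𝓡 n) y) y :=
    h1.comp (continuousAt_extChartAt y)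
  refine (h2.congr ?_).continuousWithinAt
  filter_upwards [extChartAt_source_mem_nhds (I := 𝓡 n) y] with q hq
  simp only [Function.comp_apply, (extChartAt (𝓡 n) y).left_inv hq]

/-- The ratio of the Riemannian volume densities of two metrics. -/
def relDensity (g g' : Metric n M) (y : M) : ℝ :=
  volDensity g' y (extChartAt (𝓡 n) y y) / volDensity g y (extChartAt (𝓡 n) y y)

/-- Both densities acquire the same factor |det J|. The ratio is therefore a function on M that can
be studied in any fixed chart. -/
theorem relDensity_eq (g g' : Metric n M) {z y : M} (hz : y ∈ (extChartAt (𝓡 n) z).source) :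
    relDensity g g' y =
      volDensity g' z (extChartAt (𝓡 n) z y) / volDensity g z (extChartAt (𝓡 n) z y) := by
  have hp := mem_overlap (mem_extChartAt_source (I := 𝓡 n) y) hz
  have : Nonempty (Metric n M) := ⟨g⟩
  have h0 : |(jac y z (extChartAt (𝓡 n) y y)).det| ≠ 0 := abs_ne_zero.2 (det_jac_ne_zero hp)
  rw [relDensity, volDensity_trans g hp, volDensity_trans g' hp,
    trans_chart (mem_extChartAt_source y), mul_div_mul_left _ _ h0]

theorem relDensity_pos (g g' : Metric n M) (y : M) : 0 < relDensity g g' y :=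
  div_pos (volDensity_pos _ (mem_extChartAt_target y)) (volDensity_pos _ (mem_extChartAt_target y))

theorem continuous_relDensity {g g' : Metric n M} (hg : IsRegular g) (hg' : IsRegular g') :
    Continuous (relDensity g g') := by
  rw [← continuousOn_univ]
  refine continuousOn_of_chart (n := n) isOpen_univ fun z => ?_
  rw [preimage_univ, inter_univ]
  refine ((hg'.contDiffOn_volDensity z).continuousOn.div (hg.contDiffOn_volDensity z).continuousOn
    fun p hp => (volDensity_pos g hp).ne').congr fun p hp => ?_
  rw [Function.comp_apply, relDensity_eq g g' ((extChartAt (𝓡 n) z).map_target hp),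
    (extChartAt (𝓡 n) z).right_inv hp]
  rfl

end RegularMetric

/-! ### The Riemannian volume measure. -/

section Volume

variable {n : ℕ} {M : Type*} [TopologicalSpace M] [ChartedSpace (EuclideanSpace ℝ (Fin n)) M]
  [IsManifold (𝓡 n) ∞ M] [MeasurableSpace M] [BorelSpace M]

theorem aemeasurable_symm (z : M) : AEMeasurable (extChartAt (𝓡 n) z).symm
    ((volume : Measure (𝔼 n)).restrict (extChartAt (𝓡 n) z).target) :=
  (continuousOn_extChartAt_symm z).aemeasurable (isOpen_extChartAt_target z).measurableSet

theorem IsRegular.aemeasurable_volDensity {g : Metric n M} (hg : IsRegular g) (z : M) :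
    AEMeasurable (fun p => ENNReal.ofReal (volDensity g z p))
    ((volume : Measure (𝔼 n)).restrict (extChartAt (𝓡 n) z).target) :=
  ((hg.contDiffOn_volDensity z).continuousOn.aemeasurable
    (isOpen_extChartAt_target z).measurableSet).ennreal_ofReal

theorem withDensity_chart_absolutelyContinuous (g : Metric n M) (z : M) :
    ((volume.restrict (extChartAt (𝓡 n) z).target).withDensity
      (fun p => ENNReal.ofReal (volDensity g z p))) ≪
    ((volume : Measure (𝔼 n)).restrict (extChartAt (𝓡 n) z).target) :=
  withDensity_absolutelyContinuous _ _

theorem lintegral_chartVol {g : Metric n M} (hg : IsRegular g) (z : M) {F : M → ℝ≥0∞}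
    (hF : Measurable F) :
    ∫⁻ y, F y ∂(chartVol g z) = ∫⁻ p in (extChartAt (𝓡 n) z).target,
      ENNReal.ofReal (volDensity g z p) * F ((extChartAt (𝓡 n) z).symm p) := by
  rw [chartVol, lintegral_map' hF.aemeasurable
    ((aemeasurable_symm z).mono_ac (withDensity_chart_absolutelyContinuous g z))]
  exact lintegral_withDensity_eq_lintegral_mul₀ (hg.aemeasurable_volDensity z)
    (hF.comp_aemeasurable (aemeasurable_symm z))

theorem measurableSet_chart_inter_preimage (z : M) {S : Set M} (hS : MeasurableSet S) :
    MeasurableSet ((extChartAt (𝓡 n) z).target ∩ (extChartAt (𝓡 n) z).symm ⁻¹' S) := by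
  have h1 := (continuousOn_iff_continuous_domRestrict.1
    (continuousOn_extChartAt_symm (I := 𝓡 n) z)).measurable hS
  have h2 := (MeasurableEmbedding.subtype_coe
    (isOpen_extChartAt_target (I := 𝓡 n) z).measurableSet).measurableSet_image.2 h1
  convert h2 using 1
  ext p
  simp only [mem_inter_iff, mem_preimage, mem_image, Subtype.exists, exists_and_right,
    exists_eq_right]
  exact ⟨fun h => ⟨h.1, h.2⟩, fun ⟨h1, h2⟩ => ⟨h1, h2⟩⟩

theorem chartVol_apply {g : Metric n M} (hg : IsRegular g) (z : M) {S : Set M}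
    (hS : MeasurableSet S) :
    chartVol g z S = ∫⁻ p in (extChartAt (𝓡 n) z).target ∩ (extChartAt (𝓡 n) z).symm ⁻¹' S,
      ENNReal.ofReal (volDensity g z p) := by
  have h1 : MeasurableSet ((extChartAt (𝓡 n) z).target ∩ (extChartAt (𝓡 n) z).symm ⁻¹' S) :=
    measurableSet_chart_inter_preimage z hS
  rw [← lintegral_indicator_one hS, lintegral_chartVol hg z (measurable_one.indicator hS),
    ← lintegral_indicator h1, ← lintegral_indicator (isOpen_extChartAt_target z).measurableSet]
  refine lintegral_congr fun p => ?_
  by_cases hp : p ∈ (extChartAt (𝓡 n) z).target <;>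
    by_cases hq : (extChartAt (𝓡 n) z).symm p ∈ S <;> simp [-extChartAt, indicator, hp, hq]

theorem chartVol_compl_source {g : Metric n M} (hg : IsRegular g) (z : M) :
    chartVol g z ((extChartAt (𝓡 n) z).source)ᶜ = 0 := by
  rw [chartVol_apply hg z (isOpen_extChartAt_source z).measurableSet.compl]
  have : (extChartAt (𝓡 n) z).target ∩
      (extChartAt (𝓡 n) z).symm ⁻¹' ((extChartAt (𝓡 n) z).source)ᶜ = ∅ := by
    ext p
    simp only [mem_inter_iff, mem_preimage, mem_compl_iff, mem_empty_iff_false, iff_false, not_and,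
      not_not]
    exact (extChartAt (𝓡 n) z).map_target
  rw [this]; simp

/-- The volumes defined by two charts agree on the overlap. -/
theorem chartVol_eq_of_subset {g : Metric n M} (hg : IsRegular g) {z z' : M} {S : Set M}
    (hS : MeasurableSet S) (hz : S ⊆ (extChartAt (𝓡 n) z).source)
    (hz' : S ⊆ (extChartAt (𝓡 n) z').source) : chartVol g z S = chartVol g z' S := by
  have h1 : MeasurableSet ((extChartAt (𝓡 n) z).target ∩ (extChartAt (𝓡 n) z).symm ⁻¹' S) :=
    measurableSet_chart_inter_preimage z hS
  set A := (extChartAt (𝓡 n) z).target ∩ (extChartAt (𝓡 n) z).symm ⁻¹' S with hA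
  have hAo : A ⊆ overlap n z z' := fun p hp => ⟨hp.1, hz' hp.2⟩
  have himg : (extChartAt (𝓡 n) z').target ∩ (extChartAt (𝓡 n) z').symm ⁻¹' S =
      trans n z z' '' A := by
    ext q
    constructor
    · rintro ⟨hq, hqS⟩
      have hqo : q ∈ overlap n z' z := ⟨hq, hz hqS⟩
      refine ⟨trans n z' z q, ⟨(trans_mem hqo).1, ?_⟩, trans_trans hqo⟩
      rw [mem_preimage, symm_trans hqo]; exact hqS
    · rintro ⟨p, hp, rfl⟩
      refine ⟨(trans_mem (hAo hp)).1, ?_⟩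
      rw [mem_preimage, symm_trans (hAo hp)]; exact hp.2
  rw [chartVol_apply hg z hS, chartVol_apply hg z' hS, himg,
    lintegral_image_eq_lintegral_abs_det_fderiv_mul volume h1
      (fun p hp => (differentiableAt_trans (hAo hp)).hasFDerivAt.hasFDerivWithinAt)
      (fun p hp q hq h => by rw [← trans_trans (hAo hp), h, trans_trans (hAo hq)])]
  refine setLIntegral_congr_fun h1 fun p hp => ?_
  simp only [det_fderiv_trans]
  rw [volDensity_trans g (hAo hp), ENNReal.ofReal_mul (abs_nonneg _)]

variable [T2Space M] [SigmaCompactSpace M]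

theorem tsupport_chartPartition_subset (z : M) :
    tsupport (chartPartition n M z) ⊆ (extChartAt (𝓡 n) z).source := by
  rw [extChartAt_source]
  exact (SmoothPartitionOfUnity.exists_isSubordinate_chartAt_source (𝓡 n) M).choose_spec z

theorem tsum_ofReal_chartPartition (y : M) :
    ∑' z : M, ENNReal.ofReal (chartPartition n M z y) = 1 := by
  have hfin : (Function.support fun z => chartPartition n M z y).Finite :=
    (chartPartition n M).locallyFinite.point_finite y
  have h1 := (chartPartition n M).sum_eq_one (mem_univ y)
  rw [finsum_eq_sum_of_support_subset (s := hfin.toFinset) _ (by simp)] at h1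
  rw [tsum_eq_sum (s := hfin.toFinset) fun z hz => by
    have : chartPartition n M z y = 0 := by simpa using hz
    simp [this], ← ENNReal.ofReal_sum_of_nonneg fun z _ => (chartPartition n M).nonneg z y, h1,
    ENNReal.ofReal_one]

/-- On overlaps the chart volumes agree, so in each summand the measure of chart w may be replaced
by that of chart z; the weights then add up to 1. In particular the choice of the partition of unity
is immaterial. -/
theorem vol_restrict_source {g : Metric n M} (hg : IsRegular g) (z : M) :
    (vol g).restrict (extChartAt (𝓡 n) z).source = chartVol g z := by
  have hsrc := (isOpen_extChartAt_source (I := 𝓡 n) z).measurableSet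
  ext S hS
  rw [Measure.restrict_apply hS, vol, Measure.sum_apply _ (hS.inter hsrc)]
  have hmeas : ∀ w : M, Measurable fun y => ENNReal.ofReal (chartPartition n M w y) := fun w =>
    (chartPartition n M w).contMDiff.continuous.measurable.ennreal_ofReal
  have key : ∀ w : M, (chartVol g w).withDensity
      (fun y => ENNReal.ofReal (chartPartition n M w y)) (S ∩ (extChartAt (𝓡 n) z).source) =
      ∫⁻ y in S, ENNReal.ofReal (chartPartition n M w y) ∂(chartVol g z) := by
    intro w
    have hw := (isOpen_extChartAt_source (I := 𝓡 n) w).measurableSet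
    have h0 : (chartVol g w).restrict ((S ∩ (extChartAt (𝓡 n) z).source) ∩
        (extChartAt (𝓡 n) w).source) = (chartVol g z).restrict
        ((S ∩ (extChartAt (𝓡 n) z).source) ∩ (extChartAt (𝓡 n) w).source) := by
      ext V hV
      rw [Measure.restrict_apply hV, Measure.restrict_apply hV]
      refine chartVol_eq_of_subset hg (hV.inter ((hS.inter hsrc).inter hw)) ?_ ?_
      · exact fun y hy => hy.2.2
      · exact fun y hy => hy.2.1.2
    have hz0 : ∀ᵐ y ∂(chartVol g z), y ∈ (extChartAt (𝓡 n) z).source :=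
      chartVol_compl_source hg z
    rw [withDensity_apply _ (hS.inter hsrc)]
    have hsupp : ∀ y ∉ (extChartAt (𝓡 n) w).source,
        ENNReal.ofReal (chartPartition n M w y) = 0 := fun y hy => by
      rw [image_eq_zero_of_notMem_tsupport fun h => hy (tsupport_chartPartition_subset w h),
        ENNReal.ofReal_zero]
    calc ∫⁻ y in S ∩ (extChartAt (𝓡 n) z).source,
          ENNReal.ofReal (chartPartition n M w y) ∂(chartVol g w)
        = ∫⁻ y in (S ∩ (extChartAt (𝓡 n) z).source) ∩ (extChartAt (𝓡 n) w).source,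
          ENNReal.ofReal (chartPartition n M w y) ∂(chartVol g w) := by
          rw [← lintegral_indicator (hS.inter hsrc), ← lintegral_indicator
            ((hS.inter hsrc).inter hw)]
          refine lintegral_congr fun y => ?_
          by_cases hy : y ∈ (extChartAt (𝓡 n) w).source
          · by_cases hyS : y ∈ S ∩ (extChartAt (𝓡 n) z).source
            · rw [indicator_of_mem hyS, indicator_of_mem (mem_inter hyS hy)]
            · rw [indicator_of_notMem hyS, indicator_of_notMem fun h => hyS h.1]
          · simp [-extChartAt, indicator, hy, hsupp y hy]
      _ = ∫⁻ y in (S ∩ (extChartAt (𝓡 n) z).source) ∩ (extChartAt (𝓡 n) w).source,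
          ENNReal.ofReal (chartPartition n M w y) ∂(chartVol g z) := by rw [h0]
      _ = ∫⁻ y in S, ENNReal.ofReal (chartPartition n M w y) ∂(chartVol g z) := by
          rw [← lintegral_indicator hS, ← lintegral_indicator ((hS.inter hsrc).inter hw)]
          refine lintegral_congr_ae ?_
          filter_upwards [hz0] with y hyz
          by_cases hy : y ∈ (extChartAt (𝓡 n) w).source
          · by_cases hyS : y ∈ S
            · rw [indicator_of_mem hyS, indicator_of_mem (mem_inter (mem_inter hyS hyz) hy)]
            · rw [indicator_of_notMem hyS, indicator_of_notMem fun h => hyS h.1.1]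
          · simp [-extChartAt, indicator, hy, hsupp y hy]
  simp_rw [key]
  -- The sum runs over all points of M, an uncountable family. By local finiteness and σ-compactness
  -- only countably many weights are nonzero, which permits exchanging sum and integral.
  let C : Set M := {w | (Function.support (chartPartition n M w)).Nonempty}
  have hC : C.Countable := by
    have h1 : LocallyFinite fun w : C => Function.support (chartPartition n M w) :=
      (chartPartition n M).locallyFinite.comp_injective Subtype.val_injective
    have h2 := h1.countable_univ fun w => w.2
    exact countable_coe_iff.1 (countable_univ_iff.1 h2)
  have hsub : ∀ (F : M → ℝ≥0∞), (∀ w ∉ C, F w = 0) → ∑' w, F w = ∑' w : C, F w := fun F hF =>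
    (tsum_subtype_eq_of_support_subset fun w hw => by
      by_contra h; exact hw (hF w h)).symm
  have hC0 : ∀ w ∉ C, ∀ y, ENNReal.ofReal (chartPartition n M w y) = 0 := by
    intro w hw y
    have : chartPartition n M w y = 0 := by
      by_contra h; exact hw ⟨y, h⟩
    rw [this, ENNReal.ofReal_zero]
  rw [hsub _ fun w hw => by simp [hC0 w hw]]
  have := hC.to_subtype
  rw [← lintegral_tsum (f := fun (w : C) y => ENNReal.ofReal (chartPartition n M w y))
    fun w => (hmeas w).aemeasurable]
  have h3 : ∀ y, ∑' w : C, ENNReal.ofReal (chartPartition n M w y) = 1 := fun y => by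
    rw [← tsum_ofReal_chartPartition (n := n) y, hsub _ fun w hw => hC0 w hw y]
  simp_rw [h3]
  simp

theorem vol_apply_of_subset {g : Metric n M} (hg : IsRegular g) {z : M} {S : Set M}
    (hS : MeasurableSet S) (hz : S ⊆ (extChartAt (𝓡 n) z).source) : vol g S = chartVol g z S := by
  rw [← vol_restrict_source hg z, Measure.restrict_apply hS, inter_eq_left.2 hz]

/-- Integration in coordinates of a function supported in a chart domain. -/
theorem integral_vol_eq {g : Metric n M} (hg : IsRegular g) (z : M) {F : M → ℝ}
    (hF : AEStronglyMeasurable F (vol g)) (hs : ∀ y ∉ (extChartAt (𝓡 n) z).source, F y = 0) :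
    ∫ y, F y ∂(vol g) = ∫ p in (extChartAt (𝓡 n) z).target,
      volDensity g z p * F ((extChartAt (𝓡 n) z).symm p) := by
  rw [← setIntegral_eq_integral_of_forall_compl_eq_zero hs, vol_restrict_source hg, chartVol,
    integral_map ((aemeasurable_symm z).mono_ac (withDensity_chart_absolutelyContinuous g z))]
  · rw [integral_withDensity_eq_integral_toReal_smul₀ (hg.aemeasurable_volDensity z)
      (ae_of_all _ fun _ => ENNReal.ofReal_lt_top)]
    refine setIntegral_congr_fun (isOpen_extChartAt_target z).measurableSet fun p hp => ?_
    simp only [smul_eq_mul]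
    rw [ENNReal.toReal_ofReal (volDensity_pos g hp).le]
  · have h1 := hF.restrict (s := (extChartAt (𝓡 n) z).source)
    rwa [vol_restrict_source hg, chartVol] at h1

theorem isLocallyFinite_vol {g : Metric n M} (hg : IsRegular g) :
    IsLocallyFiniteMeasure (vol g) := by
  refine ⟨fun y => ?_⟩
  have hy := mem_extChartAt_target (I := 𝓡 n) y
  have hc := (hg.contDiffOn_volDensity y).continuousOn.continuousAt
    ((isOpen_extChartAt_target y).mem_nhds hy)
  obtain ⟨ε, hε, hball⟩ := Metric.mem_nhds_iff.1 (inter_mem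
    ((isOpen_extChartAt_target (I := 𝓡 n) y).mem_nhds hy)
    (hc.eventually (gt_mem_nhds (lt_add_one (volDensity g y (extChartAt (𝓡 n) y y))))))
  set S : Set M := (extChartAt (𝓡 n) y).source ∩
    extChartAt (𝓡 n) y ⁻¹' Metric.ball (extChartAt (𝓡 n) y y) ε
  have hSo : IsOpen S := (continuousOn_extChartAt y).isOpen_inter_preimage
    (isOpen_extChartAt_source y) Metric.isOpen_ball
  refine ⟨S, hSo.mem_nhds ⟨mem_extChartAt_source y, Metric.mem_ball_self hε⟩, ?_⟩
  rw [vol_apply_of_subset hg hSo.measurableSet inter_subset_left,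
    chartVol_apply hg y hSo.measurableSet]
  have hsub : (extChartAt (𝓡 n) y).target ∩ (extChartAt (𝓡 n) y).symm ⁻¹' S ⊆
      Metric.ball (extChartAt (𝓡 n) y y) ε := by
    rintro p ⟨hp, hp2⟩
    have := hp2.2
    rwa [mem_preimage, (extChartAt (𝓡 n) y).right_inv hp] at this
  calc _ ≤ ∫⁻ p in Metric.ball (extChartAt (𝓡 n) y y) ε,
        ENNReal.ofReal (volDensity g y p) := lintegral_mono_set hsub
    _ ≤ ∫⁻ p in Metric.ball (extChartAt (𝓡 n) y y) ε,
        ENNReal.ofReal (volDensity g y (extChartAt (𝓡 n) y y) + 1) :=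
        setLIntegral_mono' measurableSet_ball fun p hp =>
          ENNReal.ofReal_le_ofReal (le_of_lt (hball hp).2)
    _ < ⊤ := by
        rw [setLIntegral_const]
        exact ENNReal.mul_lt_top ENNReal.ofReal_lt_top measure_ball_lt_top

/-- Used to pass from almost everywhere to everywhere for continuous functions, and to see that
neighbourhoods have positive volume. -/
theorem isOpenPosMeasure_vol {g : Metric n M} (hg : IsRegular g) :
    (vol g).IsOpenPosMeasure := by
  refine ⟨fun U hU ⟨y, hy⟩ h0 => ?_⟩
  have hV : IsOpen (U ∩ (extChartAt (𝓡 n) y).source) := hU.inter (isOpen_extChartAt_source y)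
  have h1 : vol g (U ∩ (extChartAt (𝓡 n) y).source) = 0 := measure_mono_null inter_subset_left h0
  rw [vol_apply_of_subset hg hV.measurableSet inter_subset_right,
    chartVol_apply hg y hV.measurableSet] at h1
  have hO := isOpen_chart_inter_preimage (n := n) y hV
  have h2 : (volume : Measure (𝔼 n)).restrict ((extChartAt (𝓡 n) y).target ∩
      (extChartAt (𝓡 n) y).symm ⁻¹' (U ∩ (extChartAt (𝓡 n) y).source)) = 0 := by
    have h3 := (lintegral_eq_zero_iff' (((hg.aemeasurable_volDensity y).mono_set
      inter_subset_left))).1 h1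
    have h4 := (ae_restrict_iff' hO.measurableSet).1 h3
    rw [Measure.restrict_eq_zero]
    refine measure_mono_null (fun p hp => ?_) h4
    simp only [mem_compl_iff, mem_ofPred_eq, Classical.not_imp]
    refine ⟨hp, fun h => ?_⟩
    have := volDensity_pos g hp.1
    simp only [Pi.zero_apply, ENNReal.ofReal_eq_zero] at h
    linarith
  rw [Measure.restrict_eq_zero] at h2
  refine (hO.measure_pos volume ⟨extChartAt (𝓡 n) y y, mem_extChartAt_target y, ?_⟩).ne' h2
  rw [mem_preimage, extChartAt_to_inv]
  exact ⟨hy, mem_extChartAt_source y⟩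

/-- All the volumes of a family g(t) can thus be written against the fixed measure of g(0), and the
time dependence moves into the integrand. -/
theorem vol_eq_withDensity {g g' : Metric n M} (hg : IsRegular g) (hg' : IsRegular g') :
    vol g' = (vol g).withDensity fun y => ENNReal.ofReal (relDensity g g' y) := by
  have hρ : Measurable fun y => ENNReal.ofReal (relDensity g g' y) :=
    (continuous_relDensity hg hg').measurable.ennreal_ofReal
  have hc : ∀ z : M, chartVol g' z =
      (chartVol g z).withDensity fun y => ENNReal.ofReal (relDensity g g' y) := by
    intro z
    ext S hS
    rw [withDensity_apply _ hS, ← lintegral_indicator hS,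
      lintegral_chartVol hg z (hρ.indicator hS), ← lintegral_indicator_one hS,
      lintegral_chartVol hg' z (measurable_one.indicator hS)]
    refine setLIntegral_congr_fun (isOpen_extChartAt_target z).measurableSet fun p hp => ?_
    by_cases hq : (extChartAt (𝓡 n) z).symm p ∈ S
    · simp only [indicator_of_mem hq, Pi.one_apply, mul_one]
      rw [relDensity_eq g g' ((extChartAt (𝓡 n) z).map_target hp),
        (extChartAt (𝓡 n) z).right_inv hp, ← ENNReal.ofReal_mul (volDensity_pos g hp).le,
        mul_div_cancel₀ _ (volDensity_pos g hp).ne']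
    · simp only [indicator_of_notMem hq, mul_zero]
  rw [vol, vol, withDensity_sum]
  congr 1
  funext z
  have hχ : Measurable fun y => ENNReal.ofReal (chartPartition n M z y) :=
    (chartPartition n M z).contMDiff.continuous.measurable.ennreal_ofReal
  rw [hc z, ← withDensity_mul _ hρ hχ, ← withDensity_mul _ hχ hρ, mul_comm]

end Volume

/-! ### Compactly supported functions, localization and coordinate expressions. -/

section TestFunctions

variable {n : ℕ} {M : Type*} [TopologicalSpace M] [ChartedSpace (EuclideanSpace ℝ (Fin n)) M]
  [IsManifold (𝓡 n) ∞ M]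

theorem contDiffOn_chart {k : ℕ∞} {f : M → ℝ} {U : Set M}
    (hf : ContMDiffOn (𝓡 n) 𝓘(ℝ, ℝ) k f U) (z : M) :
    ContDiffOn ℝ k (f ∘ (extChartAt (𝓡 n) z).symm)
      ((extChartAt (𝓡 n) z).target ∩ (extChartAt (𝓡 n) z).symm ⁻¹' U) := by
  have h1 : ContMDiffOn 𝓘(ℝ, 𝔼 n) (𝓡 n) ∞ (extChartAt (𝓡 n) z).symm (extChartAt (𝓡 n) z).target :=
    contMDiffOn_extChartAt_symm z
  have h2 := hf.comp ((h1.of_le (by exact_mod_cast le_top)).mono (inter_subset_left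
    (t := (extChartAt (𝓡 n) z).symm ⁻¹' U))) (fun p hp => hp.2)
  exact contMDiffOn_iff_contDiffOn.1 h2

theorem contMDiffOn_of_chart {k : ℕ∞} {f : M → ℝ} {U : Set M} (hU : IsOpen U)
    (hf : ∀ z : M, ContDiffOn ℝ k (f ∘ (extChartAt (𝓡 n) z).symm)
      ((extChartAt (𝓡 n) z).target ∩ (extChartAt (𝓡 n) z).symm ⁻¹' U)) :
    ContMDiffOn (𝓡 n) 𝓘(ℝ, ℝ) k f U := by
  intro y hy
  have hym : extChartAt (𝓡 n) y y ∈
      (extChartAt (𝓡 n) y).target ∩ (extChartAt (𝓡 n) y).symm ⁻¹' U :=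
    ⟨mem_extChartAt_target y, by rwa [mem_preimage, extChartAt_to_inv]⟩
  have h1 := (hf y).contDiffAt ((isOpen_chart_inter_preimage y hU).mem_nhds hym)
  have h2 : ContMDiffAt (𝓡 n) 𝓘(ℝ, 𝔼 n) k (extChartAt (𝓡 n) y) y :=
    (contMDiffAt_extChartAt (n := ∞)).of_le (by exact_mod_cast le_top)
  have h3 := h1.contMDiffAt.comp y h2
  refine (h3.congr_of_eventuallyEq ?_).contMDiffWithinAt
  filter_upwards [extChartAt_source_mem_nhds (I := 𝓡 n) y] with q hq
  simp only [Function.comp_apply, (extChartAt (𝓡 n) y).left_inv hq]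

/-- `C^k` functions with compact support in `U`. -/
structure IsTest (n : ℕ) {M : Type*} [TopologicalSpace M]
    [ChartedSpace (EuclideanSpace ℝ (Fin n)) M] (k : ℕ∞) (U : Set M) (ψ : M → ℝ) : Prop where
  smooth : ContMDiff (𝓡 n) 𝓘(ℝ, ℝ) k ψ
  compact : HasCompactSupport ψ
  subset : tsupport ψ ⊆ U

theorem IsTest.mono {k k' : ℕ∞} {U V : Set M} {ψ : M → ℝ} (h : IsTest n k U ψ) (hk : k' ≤ k)
    (hU : U ⊆ V) : IsTest n k' V ψ :=
  ⟨h.smooth.of_le (by exact_mod_cast hk), h.compact, h.subset.trans hU⟩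

theorem IsTest.add {k : ℕ∞} {U : Set M} {ψ₁ ψ₂ : M → ℝ} (h₁ : IsTest n k U ψ₁)
    (h₂ : IsTest n k U ψ₂) : IsTest n k U (fun y => ψ₁ y + ψ₂ y) :=
  ⟨h₁.smooth.add h₂.smooth, h₁.compact.add h₂.compact,
    (tsupport_add ψ₁ ψ₂).trans (union_subset h₁.subset h₂.subset)⟩

theorem IsTest.zero (k : ℕ∞) (U : Set M) : IsTest n k U (fun _ => (0 : ℝ)) :=
  ⟨contMDiff_const, HasCompactSupport.zero, by
    have : tsupport (fun _ : M => (0 : ℝ)) = ∅ := tsupport_eq_empty_iff.2 rfl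
    rw [this]; exact empty_subset _⟩

/-- A function that is `C^k` near its support is `C^k`. -/
theorem contMDiff_of_tsupport_subset {k : ℕ∞} {U : Set M} {ψ : M → ℝ} (hU : IsOpen U)
    (h : ContMDiffOn (𝓡 n) 𝓘(ℝ, ℝ) k ψ U) (hs : tsupport ψ ⊆ U) :
    ContMDiff (𝓡 n) 𝓘(ℝ, ℝ) k ψ :=
  contMDiff_of_tsupport fun _ hy => h.contMDiffAt (hU.mem_nhds (hs hy))

/-- The product of a test function and a function that is `C^k` near the support. -/
theorem IsTest.mul {k : ℕ∞} {U : Set M} {ψ f : M → ℝ} (hU : IsOpen U) (hψ : IsTest n k U ψ)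
    (hf : ContMDiffOn (𝓡 n) 𝓘(ℝ, ℝ) k f U) : IsTest n k U (fun y => ψ y * f y) := by
  have hs : tsupport (fun y => ψ y * f y) ⊆ tsupport ψ := tsupport_mul_subset_left
  exact ⟨contMDiff_of_tsupport_subset hU (hψ.smooth.contMDiffOn.mul hf) (hs.trans hψ.subset),
    hψ.compact.mul_right, hs.trans hψ.subset⟩

/-- To prove an additive statement for test functions, one may assume that the support lies in the
domain of a chart. -/
theorem IsTest.induction [T2Space M] [SigmaCompactSpace M] {k : ℕ∞} {U : Set M} (hU : IsOpen U)
    {P : (M → ℝ) → Prop} (h0 : P fun _ => 0)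
    (hadd : ∀ ψ₁ ψ₂, IsTest n k U ψ₁ → IsTest n k U ψ₂ → P ψ₁ → P ψ₂ → P fun y => ψ₁ y + ψ₂ y)
    (hchart : ∀ z ψ, IsTest n k U ψ → tsupport ψ ⊆ (extChartAt (𝓡 n) z).source → P ψ)
    {ψ : M → ℝ} (hψ : IsTest n k U ψ) : P ψ := by
  obtain ⟨χ, hχ⟩ := SmoothPartitionOfUnity.exists_isSubordinate_chartAt_source (𝓡 n) M
  have hfin := χ.locallyFinite.finite_nonempty_inter_compact hψ.compact
  have hχψ : ∀ z, IsTest n k U (fun y => ψ y * χ z y) := fun z =>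
    hψ.mul hU (((χ z).contMDiff.of_le (by exact_mod_cast le_top)).contMDiffOn)
  have hP : ∀ S : Finset M, IsTest n k U (fun y => ∑ z ∈ S, ψ y * χ z y) ∧
      P (fun y => ∑ z ∈ S, ψ y * χ z y) := by
    classical
    intro S
    induction S using Finset.induction_on with
    | empty => simpa using ⟨IsTest.zero k U, h0⟩
    | insert z S hz ih =>
      simp only [Finset.sum_insert hz]
      refine ⟨(hχψ z).add ih.1, hadd _ _ (hχψ z) ih.1 (hchart z _ (hχψ z) ?_) ih.2⟩
      rw [extChartAt_source]
      exact (tsupport_mul_subset_right).trans (hχ z)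
  have := (hP hfin.toFinset).2
  convert this using 1
  funext y
  by_cases hy : y ∈ tsupport ψ
  · have h1 := χ.sum_eq_one (mem_univ y)
    rw [finsum_eq_sum_of_support_subset (s := hfin.toFinset)] at h1
    · rw [← Finset.mul_sum, h1, mul_one]
    · intro z hz
      simp only [Finite.coe_toFinset, mem_ofPred_eq]
      exact ⟨y, hz, hy⟩
  · simp [image_eq_zero_of_notMem_tsupport hy]

theorem continuous_of_continuousOn_tsupport {X : Type*} [TopologicalSpace X] {F : X → ℝ}
    {U : Set X} (hU : IsOpen U) (hF : ContinuousOn F U) (hs : tsupport F ⊆ U) : Continuous F :=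
  continuous_of_tsupport fun _ hy => hF.continuousAt (hU.mem_nhds (hs hy))

theorem tsupport_subset_of_forall_notMem {X : Type*} [TopologicalSpace X] {F ψ : X → ℝ}
    (h : ∀ y ∉ tsupport ψ, F y = 0) : tsupport F ⊆ tsupport ψ :=
  closure_minimal (fun y hy => by by_contra h'; exact hy (h y h')) (isClosed_tsupport ψ)

theorem ContMDiffOn.mdifferentiableAt_of_isOpen {k : ℕ∞} {f : M → ℝ} {U : Set M} (hU : IsOpen U)
    (hk : 1 ≤ k) (hf : ContMDiffOn (𝓡 n) 𝓘(ℝ, ℝ) k f U) {y : M} (hy : y ∈ U) :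
    MDifferentiableAt (𝓡 n) 𝓘(ℝ, ℝ) f y :=
  (hf.contMDiffAt (hU.mem_nhds hy)).mdifferentiableAt (by
    intro h; rw [WithTop.coe_eq_zero] at h; rw [h] at hk; exact absurd hk (by simp))

theorem continuousOn_partialD {m : ℕ} {k : WithTop ℕ∞} {O : Set (𝔼 m)} (hO : IsOpen O)
    {F : (𝔼 m) → ℝ} (hk : 1 ≤ k) (hF : ContDiffOn ℝ k F O) (i : Fin m) :
    ContinuousOn (partialD i F) O :=
  (hF.continuousOn_fderiv_of_isOpen hO hk).clm_apply continuousOn_const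

theorem gradInner_symm_eq (g : Metric n M) {φ ψ : M → ℝ} {z : M} {p : 𝔼 n}
    (hp : p ∈ (extChartAt (𝓡 n) z).target)
    (hφ : MDifferentiableAt (𝓡 n) 𝓘(ℝ, ℝ) φ ((extChartAt (𝓡 n) z).symm p))
    (hψ : MDifferentiableAt (𝓡 n) 𝓘(ℝ, ℝ) ψ ((extChartAt (𝓡 n) z).symm p)) :
    gradInner g φ ψ ((extChartAt (𝓡 n) z).symm p) =
      coinner g z p (dcoord z φ p) (dcoord z ψ p) := by
  rw [gradInner_eq_in g ((extChartAt (𝓡 n) z).map_target hp) hφ hψ, gradInnerIn,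
    (extChartAt (𝓡 n) z).right_inv hp]

/-- The definition of `gradInner` changes the chart from point to point; invariance allows one fixed
chart near a given point, where the coefficients are continuous. -/
theorem continuousOn_gradInner {g : Metric n M} (hg : IsRegular g) {φ ψ : M → ℝ} {U : Set M}
    (hU : IsOpen U) (hφ : ContMDiffOn (𝓡 n) 𝓘(ℝ, ℝ) (1 : ℕ∞) φ U)
    (hψ : ContMDiffOn (𝓡 n) 𝓘(ℝ, ℝ) (1 : ℕ∞) ψ U) : ContinuousOn (gradInner g φ ψ) U := by
  refine continuousOn_of_chart (n := n) hU fun z => ?_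
  have hO := isOpen_chart_inter_preimage (n := n) z hU
  have h1 : ContinuousOn (fun p => ∑ i, ∑ j, (metricMatrix g z p)⁻¹ i j *
      dcoord z φ p i * dcoord z ψ p j)
      ((extChartAt (𝓡 n) z).target ∩ (extChartAt (𝓡 n) z).symm ⁻¹' U) := by
    refine continuousOn_finsetSum _ fun i _ => continuousOn_finsetSum _ fun j _ => ?_
    exact (((hg.contDiffOn_inv z i j).continuousOn.mono inter_subset_left).mul
      (continuousOn_partialD hO le_rfl (contDiffOn_chart hφ z) i)).mul
      (continuousOn_partialD hO le_rfl (contDiffOn_chart hψ z) j)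
  refine h1.congr fun p hp => ?_
  rw [Function.comp_apply, gradInner_symm_eq g hp.1
    (ContMDiffOn.mdifferentiableAt_of_isOpen hU le_rfl hφ hp.2)
    (ContMDiffOn.mdifferentiableAt_of_isOpen hU le_rfl hψ hp.2), coinner_eq_sum]

theorem IsTest.continuous_gradInner {g : Metric n M} (hg : IsRegular g) {ψ f : M → ℝ} {U : Set M}
    (hU : IsOpen U) (hψ : IsTest n 1 U ψ) (hf : ContMDiffOn (𝓡 n) 𝓘(ℝ, ℝ) (1 : ℕ∞) f U) :
    Continuous (gradInner g ψ f) ∧ tsupport (gradInner g ψ f) ⊆ tsupport ψ := by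
  have h1 : tsupport (gradInner g ψ f) ⊆ tsupport ψ :=
    tsupport_subset_of_forall_notMem fun y hy => gradInner_eq_zero_left g hy
  exact ⟨continuous_of_continuousOn_tsupport hU
    (continuousOn_gradInner hg hU hψ.smooth.contMDiffOn hf) (h1.trans hψ.subset), h1⟩

/-- The coordinate expression of a function supported in a chart domain, extended by zero. -/
def chartPull (z : M) (ψ : M → ℝ) : (𝔼 n) → ℝ :=
  (extChartAt (𝓡 n) z).target.indicator (ψ ∘ (extChartAt (𝓡 n) z).symm)

/-- The image of the compact support is compact, hence closed. So the support stays inside the open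
chart target, and extension by zero loses no regularity. -/
theorem tsupport_chartPull [T2Space M] {z : M} {ψ : M → ℝ} (hc : HasCompactSupport ψ)
    (hz : tsupport ψ ⊆ (extChartAt (𝓡 n) z).source) :
    tsupport (chartPull (n := n) z ψ) ⊆ extChartAt (𝓡 n) z '' tsupport ψ := by
  have hK : IsCompact (extChartAt (𝓡 n) z '' tsupport ψ) :=
    hc.image_of_continuousOn ((continuousOn_extChartAt z).mono hz)
  refine closure_minimal (fun p hp => ?_) hK.isClosed
  have hpt : p ∈ (extChartAt (𝓡 n) z).target := by
    by_contra h; exact hp (indicator_of_notMem h _)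
  rw [Function.mem_support, chartPull, indicator_of_mem hpt] at hp
  exact ⟨_, subset_tsupport _ hp, (extChartAt (𝓡 n) z).right_inv hpt⟩

theorem image_tsupport_subset {z : M} {ψ : M → ℝ} {U : Set M} (hU : tsupport ψ ⊆ U)
    (hz : tsupport ψ ⊆ (extChartAt (𝓡 n) z).source) :
    extChartAt (𝓡 n) z '' tsupport ψ ⊆
      (extChartAt (𝓡 n) z).target ∩ (extChartAt (𝓡 n) z).symm ⁻¹' U := by
  rintro _ ⟨y, hy, rfl⟩
  exact ⟨(extChartAt (𝓡 n) z).map_source (hz hy), by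
    rw [mem_preimage, (extChartAt (𝓡 n) z).left_inv (hz hy)]; exact hU hy⟩

theorem hasCompactSupport_chartPull [T2Space M] {z : M} {ψ : M → ℝ} (hc : HasCompactSupport ψ)
    (hz : tsupport ψ ⊆ (extChartAt (𝓡 n) z).source) :
    HasCompactSupport (chartPull (n := n) z ψ) :=
  (hc.image_of_continuousOn ((continuousOn_extChartAt z).mono hz)).of_isClosed_subset
    (isClosed_tsupport _) (tsupport_chartPull hc hz)

theorem chartPull_eventuallyEq (z : M) (ψ : M → ℝ) {p : 𝔼 n}
    (hp : p ∈ (extChartAt (𝓡 n) z).target) :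
    chartPull z ψ =ᶠ[𝓝 p] ψ ∘ (extChartAt (𝓡 n) z).symm := by
  filter_upwards [(isOpen_extChartAt_target z).mem_nhds hp] with q hq
  exact indicator_of_mem hq _

theorem contDiff_chartPull [T2Space M] {k : ℕ∞} {z : M} {U : Set M} {ψ : M → ℝ}
    (hψ : IsTest n k U ψ) (hz : tsupport ψ ⊆ (extChartAt (𝓡 n) z).source) :
    ContDiff ℝ k (chartPull (n := n) z ψ) := by
  have h := contMDiff_of_tsupport (I := 𝓘(ℝ, 𝔼 n)) (I' := 𝓘(ℝ, ℝ)) (n := k)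
    (f := chartPull (n := n) z ψ) fun p hp => by
    have hpt := (image_tsupport_subset hψ.subset hz (tsupport_chartPull hψ.compact hz hp)).1
    have h1 := (contDiffOn_chart (n := n) hψ.smooth.contMDiffOn (U := univ) z).contDiffAt
      ((isOpen_chart_inter_preimage z isOpen_univ).mem_nhds ⟨hpt, mem_univ _⟩)
    exact (h1.congr_of_eventuallyEq (chartPull_eventuallyEq z ψ hpt)).contMDiffAt
  exact h.contDiff

theorem IsTest.mdifferentiableAt {k : ℕ∞} {U : Set M} {ψ : M → ℝ} (hψ : IsTest n k U ψ)
    (hk : 1 ≤ k) (y : M) : MDifferentiableAt (𝓡 n) 𝓘(ℝ, ℝ) ψ y :=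
  ContMDiffOn.mdifferentiableAt_of_isOpen isOpen_univ hk hψ.smooth.contMDiffOn (mem_univ y)

end TestFunctions

/-! ### Green's formula and invariance of the Laplace–Beltrami operator. -/

section Divergence

/-- Integration by parts against a test function on the coordinate space. -/
theorem integral_mul_partialD {m : ℕ} {O : Set (𝔼 m)} (hO : IsOpen O) {u X : (𝔼 m) → ℝ}
    (hu : ContDiff ℝ 1 u) (hc : HasCompactSupport u) (hs : tsupport u ⊆ O)
    (hX : ContDiffOn ℝ 1 X O) (i : Fin m) :
    Integrable (fun p => u p * partialD i X p) ∧ Integrable (fun p => partialD i u p * X p) ∧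
      ∫ p, u p * partialD i X p = -∫ p, partialD i u p * X p := by
  have hd : ∀ F : (𝔼 m) → ℝ, tsupport F ⊆ tsupport u → ContinuousOn F O → Integrable F :=
    fun F hF hFc => (continuous_of_continuousOn_tsupport hO hFc (hF.trans hs)).integrable_of_hasCompactSupport
      (hc.of_isClosed_subset (isClosed_tsupport _) hF)
  have hpu : tsupport (partialD i u) ⊆ tsupport u :=
    tsupport_subset_of_forall_notMem fun p hp => by
      have h0 : u =ᶠ[𝓝 p] fun _ => (0 : ℝ) := notMem_tsupport_iff_eventuallyEq.1 hp
      rw [partialD, h0.fderiv_eq]; simp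
  have h1 : Integrable (fun p => u p * partialD i X p) :=
    hd _ tsupport_mul_subset_left
      (hu.continuous.continuousOn.mul (continuousOn_partialD hO le_rfl hX i))
  have h2 : Integrable (fun p => partialD i u p * X p) :=
    hd _ (tsupport_mul_subset_left.trans hpu)
      ((continuousOn_partialD hO le_rfl hu.contDiffOn i).mul hX.continuousOn)
  have h3 : Integrable (fun p => u p * X p) :=
    hd _ tsupport_mul_subset_left (hu.continuous.continuousOn.mul hX.continuousOn)
  exact ⟨h1, h2, integral_mul_fderiv_eq_neg_fderiv_mul_of_integrable h2 h1 h3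
    (fun p _ => hu.contDiffAt.differentiableAt one_ne_zero)
    (fun p hp => (hX.contDiffAt (hO.mem_nhds (hs hp))).differentiableAt one_ne_zero)⟩

variable {n : ℕ} {M : Type*} [TopologicalSpace M] [ChartedSpace (EuclideanSpace ℝ (Fin n)) M]
  [IsManifold (𝓡 n) ∞ M]

/-- The components of the vector field `√det g · ∇f` in the chart around `z`. -/
def flux (g : Metric n M) (z : M) (f : M → ℝ) (i : Fin n) (p : 𝔼 n) : ℝ :=
  volDensity g z p * ∑ j, (metricMatrix g z p)⁻¹ i j *
    partialD j (f ∘ (extChartAt (𝓡 n) z).symm) p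

/-- The Laplace–Beltrami operator computed in the chart around `z`. -/
def laplacianIn (g : Metric n M) (z : M) (f : M → ℝ) (p : 𝔼 n) : ℝ :=
  (volDensity g z p)⁻¹ * ∑ i, partialD i (flux g z f i) p

theorem laplacian_eq (g : Metric n M) (f : M → ℝ) (y : M) :
    laplacian g f y = laplacianIn g y f (extChartAt (𝓡 n) y y) := rfl

theorem contDiffOn_flux {g : Metric n M} (hg : IsRegular g) {f : M → ℝ} {U : Set M}
    (hU : IsOpen U) (hf : ContMDiffOn (𝓡 n) 𝓘(ℝ, ℝ) (2 : ℕ∞) f U) (z : M) (i : Fin n) :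
    ContDiffOn ℝ 1 (flux g z f i)
      ((extChartAt (𝓡 n) z).target ∩ (extChartAt (𝓡 n) z).symm ⁻¹' U) := by
  have hO := isOpen_chart_inter_preimage (n := n) z hU
  have h1 : ∀ j, ContDiffOn ℝ 1 (partialD j (f ∘ (extChartAt (𝓡 n) z).symm))
      ((extChartAt (𝓡 n) z).target ∩ (extChartAt (𝓡 n) z).symm ⁻¹' U) := fun j =>
    ((contDiffOn_chart hf z).fderiv_of_isOpen hO (m := 1) (by norm_num)).clm_apply contDiffOn_const
  have h0 : (1 : WithTop ℕ∞) ≤ (∞ : ℕ∞ω) := by exact_mod_cast le_top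
  refine (((hg.contDiffOn_volDensity z).of_le h0).mono inter_subset_left).mul
    (ContDiffOn.sum fun j _ => ?_)
  exact (((hg.contDiffOn_inv z i j).of_le h0).mono inter_subset_left).mul (h1 j)

theorem continuousOn_laplacianIn {g : Metric n M} (hg : IsRegular g) {f : M → ℝ} {U : Set M}
    (hU : IsOpen U) (hf : ContMDiffOn (𝓡 n) 𝓘(ℝ, ℝ) (2 : ℕ∞) f U) (z : M) :
    ContinuousOn (fun y => laplacianIn g z f (extChartAt (𝓡 n) z y))
      ((extChartAt (𝓡 n) z).source ∩ U) := by
  have hO := isOpen_chart_inter_preimage (n := n) z hU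
  have h1 : ContinuousOn (laplacianIn g z f)
      ((extChartAt (𝓡 n) z).target ∩ (extChartAt (𝓡 n) z).symm ⁻¹' U) :=
    (((hg.contDiffOn_volDensity z).continuousOn.inv₀
      fun p hp => (volDensity_pos g hp).ne').mono inter_subset_left).mul
      (continuousOn_finsetSum _ fun i _ =>
        continuousOn_partialD hO le_rfl (contDiffOn_flux hg hU hf z i) i)
  refine h1.comp ((continuousOn_extChartAt z).mono inter_subset_left) fun y hy => ?_
  exact ⟨(extChartAt (𝓡 n) z).map_source hy.1, by
    rw [mem_preimage, (extChartAt (𝓡 n) z).left_inv hy.1]; exact hy.2⟩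

variable [MeasurableSpace M] [BorelSpace M] [T2Space M] [SigmaCompactSpace M]

/-- Green's formula for a test function supported in the domain of a chart. -/
theorem integral_mul_laplacianIn {g : Metric n M} (hg : IsRegular g) {f ψ : M → ℝ} {U : Set M}
    (hU : IsOpen U) (hf : ContMDiffOn (𝓡 n) 𝓘(ℝ, ℝ) (2 : ℕ∞) f U) {z : M} (hψ : IsTest n 1 U ψ)
    (hz : tsupport ψ ⊆ (extChartAt (𝓡 n) z).source) :
    ∫ y, ψ y * laplacianIn g z f (extChartAt (𝓡 n) z y) ∂(vol g) =
      -∫ y, gradInner g ψ f y ∂(vol g) := by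
  have hO := isOpen_chart_inter_preimage (n := n) z hU
  have hf1 : ContMDiffOn (𝓡 n) 𝓘(ℝ, ℝ) (1 : ℕ∞) f U := hf.of_le (by norm_num)
  have hT := isOpen_extChartAt_target (I := 𝓡 n) z
  have hpull := contDiff_chartPull hψ hz
  have hsub := (tsupport_chartPull hψ.compact hz).trans (image_tsupport_subset hψ.subset hz)
  have hcs := hasCompactSupport_chartPull hψ.compact hz
  have hibp := fun i => integral_mul_partialD hO hpull hcs hsub (contDiffOn_flux hg hU hf z i) i
  have hcont1 : Continuous (fun y => ψ y * laplacianIn g z f (extChartAt (𝓡 n) z y)) :=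
    continuous_of_continuousOn_tsupport ((isOpen_extChartAt_source z).inter hU)
      (hψ.smooth.continuous.continuousOn.mul (continuousOn_laplacianIn hg hU hf z))
      (tsupport_mul_subset_left.trans (subset_inter hz hψ.subset))
  obtain ⟨hcont2, hs2⟩ := hψ.continuous_gradInner hg hU hf1
  have hzero : ∀ p ∉ (extChartAt (𝓡 n) z).target, ∀ i,
      chartPull (n := n) z ψ p = 0 ∧ partialD i (chartPull (n := n) z ψ) p = 0 := by
    intro p hp i
    have hnt : p ∉ tsupport (chartPull (n := n) z ψ) := fun h => hp (hsub h).1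
    refine ⟨image_eq_zero_of_notMem_tsupport hnt, ?_⟩
    have h0 : chartPull (n := n) z ψ =ᶠ[𝓝 p] fun _ => (0 : ℝ) :=
      notMem_tsupport_iff_eventuallyEq.1 hnt
    rw [partialD, h0.fderiv_eq]; simp
  rw [integral_vol_eq hg z hcont1.aestronglyMeasurable, integral_vol_eq hg z
    hcont2.aestronglyMeasurable]
  · have e1 : ∫ p in (extChartAt (𝓡 n) z).target, volDensity g z p *
        (ψ ((extChartAt (𝓡 n) z).symm p) * laplacianIn g z f
          (extChartAt (𝓡 n) z ((extChartAt (𝓡 n) z).symm p))) =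
        ∫ p, ∑ i, chartPull z ψ p * partialD i (flux g z f i) p := by
      refine Eq.trans ?_ (setIntegral_eq_integral_of_forall_compl_eq_zero
        (s := (extChartAt (𝓡 n) z).target) ?_)
      · refine setIntegral_congr_fun hT.measurableSet fun p hp => ?_
        simp only [(extChartAt (𝓡 n) z).right_inv hp, laplacianIn, chartPull, indicator_of_mem hp,
          Function.comp_apply]
        have := (volDensity_pos g hp).ne'
        rw [← Finset.mul_sum]
        field_simp
      · intro p hp
        exact Finset.sum_eq_zero fun i _ => by rw [(hzero p hp i).1, zero_mul]
    have e2 : ∫ p in (extChartAt (𝓡 n) z).target, volDensity g z p *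
        gradInner g ψ f ((extChartAt (𝓡 n) z).symm p) =
        ∫ p, ∑ i, partialD i (chartPull z ψ) p * flux g z f i p := by
      refine Eq.trans ?_ (setIntegral_eq_integral_of_forall_compl_eq_zero
        (s := (extChartAt (𝓡 n) z).target) ?_)
      · refine setIntegral_congr_fun hT.measurableSet fun p hp => ?_
        have hpd : ∀ i, partialD i (chartPull (n := n) z ψ) p = dcoord z ψ p i := fun i => by
          rw [partialD, (chartPull_eventuallyEq z ψ hp).fderiv_eq]; rfl
        by_cases hy : (extChartAt (𝓡 n) z).symm p ∈ tsupport ψ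
        · rw [gradInner_symm_eq g hp
            (ContMDiffOn.mdifferentiableAt_of_isOpen isOpen_univ le_rfl
              hψ.smooth.contMDiffOn (mem_univ _))
            (ContMDiffOn.mdifferentiableAt_of_isOpen hU le_rfl hf1 (hψ.subset hy)),
            coinner_eq_sum, Finset.mul_sum]
          refine Finset.sum_congr rfl fun i _ => ?_
          rw [hpd, flux, Finset.mul_sum, Finset.mul_sum, Finset.mul_sum]
          refine Finset.sum_congr rfl fun j _ => ?_
          rw [dcoord, dcoord]; ring
        · rw [gradInner_eq_zero_left g hy, mul_zero]
          symm
          have h0 := dcoord_eq_zero_of_notMem_tsupport (n := n)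
            ((extChartAt (𝓡 n) z).map_target hp) hy
          rw [(extChartAt (𝓡 n) z).right_inv hp] at h0
          exact Finset.sum_eq_zero fun i _ => by rw [hpd, h0, Pi.zero_apply, zero_mul]
      · intro p hp
        exact Finset.sum_eq_zero fun i _ => by rw [(hzero p hp i).2, zero_mul]
    rw [e1, e2, integral_finsetSum _ fun i _ => (hibp i).1,
      integral_finsetSum _ fun i _ => (hibp i).2.1, ← Finset.sum_neg_distrib]
    exact Finset.sum_congr rfl fun i _ => (hibp i).2.2
  · exact fun y hy => gradInner_eq_zero_left g fun h => hy (hz h)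
  · exact fun y hy => by rw [image_eq_zero_of_notMem_tsupport fun h => hy (hz h), zero_mul]

/-- The expressions of the Laplace–Beltrami operator in two charts agree. -/
theorem laplacianIn_eq {g : Metric n M} (hg : IsRegular g) {f : M → ℝ} {U : Set M}
    (hU : IsOpen U) (hf : ContMDiffOn (𝓡 n) 𝓘(ℝ, ℝ) (2 : ℕ∞) f U) {z z' y : M} (hy : y ∈ U)
    (hz : y ∈ (extChartAt (𝓡 n) z).source) (hz' : y ∈ (extChartAt (𝓡 n) z').source) :
    laplacianIn g z f (extChartAt (𝓡 n) z y) = laplacianIn g z' f (extChartAt (𝓡 n) z' y) := by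
  set W := ((extChartAt (𝓡 n) z).source ∩ (extChartAt (𝓡 n) z').source) ∩ U with hW
  have hWo : IsOpen W :=
    ((isOpen_extChartAt_source z).inter (isOpen_extChartAt_source z')).inter hU
  have hc1 : ContinuousOn (fun y => laplacianIn g z f (extChartAt (𝓡 n) z y)) W :=
    (continuousOn_laplacianIn hg hU hf z).mono fun y hy => ⟨hy.1.1, hy.2⟩
  have hc2 : ContinuousOn (fun y => laplacianIn g z' f (extChartAt (𝓡 n) z' y)) W :=
    (continuousOn_laplacianIn hg hU hf z').mono fun y hy => ⟨hy.1.2, hy.2⟩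
  have : LocallyCompactSpace M := Manifold.locallyCompact_of_finiteDimensional (𝓡 n)
  have := isLocallyFinite_vol hg
  have := isOpenPosMeasure_vol hg
  -- Invariance is proved weakly: against a test function ψ supported in the overlap, both
  -- expressions integrate to -∫ ⟨∇ψ, ∇f⟩, which is already known to be chart independent.
  -- Continuity then gives equality at every point.
  have hae := hWo.ae_eq_zero_of_integral_contMDiff_smul_eq_zero (𝓡 n) (μ := vol g)
    ((hc1.sub hc2).locallyIntegrableOn hWo.measurableSet) fun ψ hψ hψc hψs => by
      have hψ1 : IsTest n 1 U ψ :=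
        ⟨hψ.of_le (by exact_mod_cast le_top), hψc, hψs.trans fun y hy => hy.2⟩
      have i1 := integral_mul_laplacianIn hg hU hf hψ1 (z := z) (hψs.trans fun y hy => hy.1.1)
      have i2 := integral_mul_laplacianIn hg hU hf hψ1 (z := z') (hψs.trans fun y hy => hy.1.2)
      have hint : ∀ {F : M → ℝ}, ContinuousOn F W → Integrable (fun y => ψ y * F y) (vol g) :=
        fun hF => (continuous_of_continuousOn_tsupport hWo
          (hψ.continuous.continuousOn.mul hF)
          (tsupport_mul_subset_left.trans hψs)).integrable_of_hasCompactSupport hψc.mul_right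
      simp only [smul_eq_mul, Pi.sub_apply, mul_sub]
      rw [integral_sub (hint hc1) (hint hc2), i1, i2, sub_self]
  have heq := Measure.eqOn_open_of_ae_eq (μ := vol g) (f := (fun y => laplacianIn g z f (extChartAt (𝓡 n) z y)) -
    fun y => laplacianIn g z' f (extChartAt (𝓡 n) z' y)) (g := fun _ => (0 : ℝ)) (U := W)
    ((ae_restrict_iff' hWo.measurableSet).2 hae) hWo (hc1.sub hc2) continuousOn_const
  exact sub_eq_zero.1 (heq ⟨⟨hz, hz'⟩, hy⟩)

/-- As for `gradInner`, the chart in the definition moves with the point and is frozen by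
`laplacianIn_eq`. -/
theorem continuousOn_laplacian {g : Metric n M} (hg : IsRegular g) {f : M → ℝ} {U : Set M}
    (hU : IsOpen U) (hf : ContMDiffOn (𝓡 n) 𝓘(ℝ, ℝ) (2 : ℕ∞) f U) :
    ContinuousOn (laplacian g f) U := by
  intro y hy
  have h1 := (continuousOn_laplacianIn hg hU hf y).continuousAt
    (((isOpen_extChartAt_source y).inter hU).mem_nhds ⟨mem_extChartAt_source y, hy⟩)
  refine (h1.congr ?_).continuousWithinAt
  filter_upwards [((isOpen_extChartAt_source (I := 𝓡 n) y).inter hU).mem_nhds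
    ⟨mem_extChartAt_source y, hy⟩] with q hq
  rw [laplacian_eq]
  exact laplacianIn_eq hg hU hf hq.2 hq.1 (mem_extChartAt_source q)

theorem gradInner_add_left (g : Metric n M) {φ ψ f : M → ℝ} {y : M}
    (hφ : MDifferentiableAt (𝓡 n) 𝓘(ℝ, ℝ) φ y) (hψ : MDifferentiableAt (𝓡 n) 𝓘(ℝ, ℝ) ψ y) :
    gradInner g (fun y => φ y + ψ y) f y = gradInner g φ f y + gradInner g ψ f y := by
  rw [gradInner, gradInnerIn, dcoord_add (mem_extChartAt_source y) hφ hψ, coinner_add_left]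
  rfl

/-- Green's formula. -/
theorem integral_mul_laplacian {g : Metric n M} (hg : IsRegular g) {f ψ : M → ℝ} {U : Set M}
    (hU : IsOpen U) (hf : ContMDiffOn (𝓡 n) 𝓘(ℝ, ℝ) (2 : ℕ∞) f U) (hψ : IsTest n 1 U ψ) :
    ∫ y, ψ y * laplacian g f y ∂(vol g) = -∫ y, gradInner g ψ f y ∂(vol g) := by
  have : LocallyCompactSpace M := Manifold.locallyCompact_of_finiteDimensional (𝓡 n)
  have := isLocallyFinite_vol hg
  have hf1 : ContMDiffOn (𝓡 n) 𝓘(ℝ, ℝ) (1 : ℕ∞) f U := hf.of_le (by norm_num)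
  have hi1 : ∀ {ψ : M → ℝ}, IsTest n 1 U ψ →
      Integrable (fun y => ψ y * laplacian g f y) (vol g) := fun hψ =>
    (continuous_of_continuousOn_tsupport hU (hψ.smooth.continuous.continuousOn.mul
      (continuousOn_laplacian hg hU hf))
      (tsupport_mul_subset_left.trans hψ.subset)).integrable_of_hasCompactSupport
      hψ.compact.mul_right
  have hi2 : ∀ {ψ : M → ℝ}, IsTest n 1 U ψ → Integrable (gradInner g ψ f) (vol g) := fun hψ =>
    (hψ.continuous_gradInner hg hU hf1).1.integrable_of_hasCompactSupport
      (hψ.compact.of_isClosed_subset (isClosed_tsupport _)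
        (hψ.continuous_gradInner hg hU hf1).2)
  refine IsTest.induction (n := n) hU (P := fun ψ => ∫ y, ψ y * laplacian g f y ∂(vol g) =
    -∫ y, gradInner g ψ f y ∂(vol g)) ?_ ?_ ?_ hψ
  · have h0 : ∀ y, gradInner g (fun _ => (0 : ℝ)) f y = 0 := fun y =>
      gradInner_eq_zero_left g (by
        have : tsupport (fun _ : M => (0 : ℝ)) = ∅ := tsupport_eq_empty_iff.2 rfl
        simp [this])
    simp [h0]
  · intro ψ₁ ψ₂ h₁ h₂ e₁ e₂
    have h3 : ∀ y, gradInner g (fun y => ψ₁ y + ψ₂ y) f y =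
        gradInner g ψ₁ f y + gradInner g ψ₂ f y := fun y =>
      gradInner_add_left g (h₁.mdifferentiableAt le_rfl y) (h₂.mdifferentiableAt le_rfl y)
    simp only [h3, add_mul]
    rw [integral_add (hi1 h₁) (hi1 h₂), integral_add (hi2 h₁) (hi2 h₂), e₁, e₂]
    ring
  · intro z ψ hψ hz
    rw [← integral_mul_laplacianIn hg hU hf hψ hz]
    refine integral_congr_ae (ae_of_all _ fun y => ?_)
    by_cases hy : y ∈ tsupport ψ
    · simp only [laplacian_eq]
      rw [laplacianIn_eq hg hU hf (hψ.subset hy) (mem_extChartAt_source y) (hz hy)]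
    · simp only [image_eq_zero_of_notMem_tsupport hy, zero_mul]

end Divergence

/-! ### Smooth approximation of C¹ test functions. -/

section Approximation

open Matrix

/-- Approximation in `C^1` of a compactly supported function by smooth functions. -/
theorem exists_contDiff_approx {m : ℕ} {u : (𝔼 m) → ℝ} (hu : ContDiff ℝ 1 u)
    (hc : HasCompactSupport u) {δ ε : ℝ} (hδ : 0 < δ) (hε : 0 < ε) :
    ∃ v : (𝔼 m) → ℝ, ContDiff ℝ ∞ v ∧ tsupport v ⊆ Metric.cthickening δ (tsupport u) ∧
      ∀ p, |v p - u p| ≤ ε ∧ ∀ i, |partialD i v p - partialD i u p| ≤ ε := by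
  have hdc : ∀ i : Fin m, Continuous (partialD i u) := fun i =>
    (hu.continuous_fderiv one_ne_zero).clm_apply continuous_const
  have hdcs : ∀ i : Fin m, HasCompactSupport (partialD i u) := fun i =>
    hc.fderiv_apply (𝕜 := ℝ) _
  have h1 := Metric.uniformContinuous_iff.1
    (hc.uniformContinuous_of_continuous hu.continuous) ε hε
  have h2 := fun i => Metric.uniformContinuous_iff.1
    ((hdcs i).uniformContinuous_of_continuous (hdc i)) ε hε
  obtain ⟨d₀, hd₀, h1⟩ := h1
  choose d hd h2 using h2
  obtain ⟨ρ, hρ0, hρd₀, hρd, hρδ⟩ : ∃ ρ > 0, ρ ≤ d₀ ∧ (∀ i, ρ ≤ d i) ∧ ρ ≤ δ := by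
    rcases isEmpty_or_nonempty (Fin m) with hm | hm
    · exact ⟨min d₀ δ, lt_min hd₀ hδ, min_le_left _ _, fun i => hm.elim i, min_le_right _ _⟩
    · obtain ⟨i₀, hi₀⟩ := Finite.exists_min d
      exact ⟨min (min d₀ δ) (d i₀), lt_min (lt_min hd₀ hδ) (hd i₀),
        (min_le_left _ _).trans (min_le_left _ _), fun i => (min_le_right _ _).trans (hi₀ i),
        (min_le_left _ _).trans (min_le_right _ _)⟩
  -- The radius ρ lies below the moduli of continuity of u and of all its partial derivatives, and
  -- below δ, so one mollifier controls values, derivatives and support.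
  let φ : ContDiffBump (0 : 𝔼 m) := ⟨ρ / 2, ρ, half_pos hρ0, half_lt_self hρ0⟩
  let v : (𝔼 m) → ℝ := MeasureTheory.convolution (φ.normed volume) u
    (ContinuousLinearMap.lsmul ℝ ℝ) volume
  have hli : LocallyIntegrable (φ.normed (volume : Measure (𝔼 m))) volume :=
    φ.continuous_normed.locallyIntegrable
  have hv' : ∀ p i, partialD i v p = MeasureTheory.convolution (φ.normed volume) (partialD i u)
      (ContinuousLinearMap.lsmul ℝ ℝ) volume p := by
    intro p i
    have := hc.hasFDerivAt_convolution_right (ContinuousLinearMap.lsmul ℝ ℝ) hli hu p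
    rw [partialD, this.fderiv, convolution_precompR_apply _ hli (hc.fderiv ℝ)
      (hu.continuous_fderiv one_ne_zero)]
    rfl
  refine ⟨v, φ.hasCompactSupport_normed.contDiff_convolution_left _ φ.contDiff_normed
    hu.continuous.locallyIntegrable, ?_, fun p => ⟨?_, fun i => ?_⟩⟩
  · refine closure_minimal ?_ Metric.isClosed_cthickening
    refine (support_convolution_subset (ContinuousLinearMap.lsmul ℝ ℝ)).trans ?_
    rintro _ ⟨a, ha, b, hb, rfl⟩
    rw [φ.support_normed_eq] at ha
    refine Metric.mem_cthickening_of_dist_le _ b _ _ (subset_tsupport _ hb) ?_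
    have ha' : ‖a‖ < ρ := by simpa using ha
    simp only [dist_eq_norm, add_sub_cancel_right]
    linarith
  · rw [← Real.dist_eq]
    refine φ.dist_normed_convolution_le hu.continuous.aestronglyMeasurable fun q hq => ?_
    exact (h1 ((Metric.mem_ball.1 hq).trans_le hρd₀)).le
  · rw [hv', ← Real.dist_eq]
    refine φ.dist_normed_convolution_le (hdc i).aestronglyMeasurable fun q hq => ?_
    exact (h2 i ((Metric.mem_ball.1 hq).trans_le (hρd i))).le

variable {n : ℕ} {M : Type*} [TopologicalSpace M] [ChartedSpace (EuclideanSpace ℝ (Fin n)) M]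
  [IsManifold (𝓡 n) ∞ M]

theorem IsTest.sub {k : ℕ∞} {U : Set M} {ψ₁ ψ₂ : M → ℝ} (h₁ : IsTest n k U ψ₁)
    (h₂ : IsTest n k U ψ₂) : IsTest n k U (fun y => ψ₁ y - ψ₂ y) :=
  ⟨h₁.smooth.sub h₂.smooth, h₁.compact.sub h₂.compact,
    (tsupport_sub ψ₁ ψ₂).trans (union_subset h₁.subset h₂.subset)⟩

theorem gradNormSq_add_le (g : Metric n M) {φ ψ : M → ℝ} {y : M}
    (hφ : MDifferentiableAt (𝓡 n) 𝓘(ℝ, ℝ) φ y) (hψ : MDifferentiableAt (𝓡 n) 𝓘(ℝ, ℝ) ψ y) :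
    gradNormSq g (fun y => φ y + ψ y) y ≤ 2 * gradNormSq g φ y + 2 * gradNormSq g ψ y := by
  simp only [gradNormSq_eq]
  rw [gradInner, gradInnerIn, dcoord_add (mem_extChartAt_source y) hφ hψ]
  exact coinner_add_self_le g (mem_extChartAt_target y) _ _

/-- Smooth functions with support in a fixed compact subset of `U` that approximate `ψ` in `C^1`. -/
def HasSmoothApprox (g : Metric n M) (U : Set M) (ψ : M → ℝ) : Prop :=
  ∃ K : Set M, IsCompact K ∧ K ⊆ U ∧ ∀ ε > 0, ∃ v : M → ℝ, IsTest n ⊤ U v ∧ tsupport v ⊆ K ∧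
    ∀ y, |v y - ψ y| ≤ ε ∧ gradNormSq g (fun y => v y - ψ y) y ≤ ε

theorem HasSmoothApprox.add {g : Metric n M} {U : Set M} {ψ₁ ψ₂ : M → ℝ}
    (t₁ : IsTest n 1 U ψ₁) (t₂ : IsTest n 1 U ψ₂)
    (h₁ : HasSmoothApprox g U ψ₁) (h₂ : HasSmoothApprox g U ψ₂) :
    HasSmoothApprox g U fun y => ψ₁ y + ψ₂ y := by
  obtain ⟨K₁, hK₁, hKU₁, H₁⟩ := h₁
  obtain ⟨K₂, hK₂, hKU₂, H₂⟩ := h₂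
  refine ⟨K₁ ∪ K₂, hK₁.union hK₂, union_subset hKU₁ hKU₂, fun ε hε => ?_⟩
  obtain ⟨v₁, hv₁, hs₁, e₁⟩ := H₁ (ε / 4) (by positivity)
  obtain ⟨v₂, hv₂, hs₂, e₂⟩ := H₂ (ε / 4) (by positivity)
  refine ⟨_, hv₁.add hv₂, (tsupport_add v₁ v₂).trans (union_subset_union hs₁ hs₂), fun y => ?_⟩
  have heq : (fun y => v₁ y + v₂ y - (ψ₁ y + ψ₂ y)) =
      fun y => (v₁ y - ψ₁ y) + (v₂ y - ψ₂ y) := by funext y; ring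
  constructor
  · have := congrFun heq y
    rw [this]
    refine (abs_add_le _ _).trans ?_
    linarith [(e₁ y).1, (e₂ y).1]
  · rw [heq]
    have d₁ := ((hv₁.mono le_top subset_rfl).sub t₁).mdifferentiableAt le_rfl y
    have d₂ := ((hv₂.mono le_top subset_rfl).sub t₂).mdifferentiableAt le_rfl y
    linarith [gradNormSq_add_le g d₁ d₂, (e₁ y).2, (e₂ y).2]

theorem sum_sum_mul_le {m : ℕ} {G : Matrix (Fin m) (Fin m) ℝ} {a : Fin m → ℝ} {c ε : ℝ}
    (hG : ∀ i j, |G i j| ≤ c) (ha : ∀ i, |a i| ≤ ε) (hc : 0 ≤ c) (hε : 0 ≤ ε) :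
    ∑ i, ∑ j, G i j * a i * a j ≤ m * m * (c * ε * ε) := by
  have h : ∀ i j, G i j * a i * a j ≤ c * ε * ε := fun i j => by
    refine (le_abs_self _).trans ?_
    rw [abs_mul, abs_mul]
    exact mul_le_mul (mul_le_mul (hG i j) (ha i) (abs_nonneg _) hc) (ha j) (abs_nonneg _)
      (mul_nonneg hc hε)
  calc ∑ i, ∑ j, G i j * a i * a j ≤ ∑ _i : Fin m, ∑ _j : Fin m, c * ε * ε :=
        Finset.sum_le_sum fun i _ => Finset.sum_le_sum fun j _ => h i j
    _ = _ := by simp; ring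

variable [T2Space M]

/-- A function on the coordinate space, transplanted to the manifold and extended by zero. -/
def chartPush (z : M) (v : (𝔼 n) → ℝ) : M → ℝ :=
  (extChartAt (𝓡 n) z).source.indicator (v ∘ extChartAt (𝓡 n) z)

theorem chartPush_of_mem {z y : M} (v : (𝔼 n) → ℝ) (hy : y ∈ (extChartAt (𝓡 n) z).source) :
    chartPush z v y = v (extChartAt (𝓡 n) z y) := indicator_of_mem hy _

theorem isCompact_symm_image {z : M} {K : Set (𝔼 n)} (hK : IsCompact K)
    (hs : K ⊆ (extChartAt (𝓡 n) z).target) : IsCompact ((extChartAt (𝓡 n) z).symm '' K) :=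
  hK.image_of_continuousOn ((continuousOn_extChartAt_symm z).mono hs)

theorem tsupport_chartPush {z : M} {v : (𝔼 n) → ℝ} {K : Set (𝔼 n)} (hK : IsCompact K)
    (hKt : K ⊆ (extChartAt (𝓡 n) z).target) (hv : tsupport v ⊆ K) :
    tsupport (chartPush z v) ⊆ (extChartAt (𝓡 n) z).symm '' K := by
  refine closure_minimal (fun y hy => ?_) (isCompact_symm_image hK hKt).isClosed
  have hys : y ∈ (extChartAt (𝓡 n) z).source := by
    by_contra h; exact hy (indicator_of_notMem h _)
  rw [Function.mem_support, chartPush_of_mem v hys] at hy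
  exact ⟨_, hv (subset_tsupport _ hy), (extChartAt (𝓡 n) z).left_inv hys⟩

theorem isTest_chartPush {k : ℕ∞} {z : M} {v : (𝔼 n) → ℝ} {K : Set (𝔼 n)} {U : Set M}
    (hK : IsCompact K) (hKt : K ⊆ (extChartAt (𝓡 n) z).target)
    (hKU : (extChartAt (𝓡 n) z).symm '' K ⊆ U) (hv : tsupport v ⊆ K) (hvs : ContDiff ℝ k v) :
    IsTest n k U (chartPush z v) := by
  have h1 := tsupport_chartPush hK hKt hv
  have hsrc : (extChartAt (𝓡 n) z).symm '' K ⊆ (extChartAt (𝓡 n) z).source := by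
    rintro _ ⟨p, hp, rfl⟩
    exact (extChartAt (𝓡 n) z).map_target (hKt hp)
  refine ⟨contMDiff_of_tsupport_subset (isOpen_extChartAt_source z) ?_ (h1.trans hsrc),
    (isCompact_symm_image hK hKt).of_isClosed_subset (isClosed_tsupport _) h1, h1.trans hKU⟩
  have h2 : ContMDiffOn (𝓡 n) 𝓘(ℝ, 𝔼 n) k (extChartAt (𝓡 n) z) (extChartAt (𝓡 n) z).source := by
    rw [extChartAt_source]
    exact (contMDiffOn_extChartAt (n := ∞)).of_le (by exact_mod_cast le_top)
  exact (hvs.contMDiff.comp_contMDiffOn h2).congr fun y hy => chartPush_of_mem v hy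

theorem chartPush_eventuallyEq {z y : M} (v : (𝔼 n) → ℝ)
    (hy : y ∈ (extChartAt (𝓡 n) z).source) :
    chartPush z v ∘ (extChartAt (𝓡 n) z).symm =ᶠ[𝓝 (extChartAt (𝓡 n) z y)] v := by
  filter_upwards [(isOpen_extChartAt_target z).mem_nhds ((extChartAt (𝓡 n) z).map_source hy)]
    with q hq
  rw [Function.comp_apply, chartPush_of_mem v ((extChartAt (𝓡 n) z).map_target hq),
    (extChartAt (𝓡 n) z).right_inv hq]

theorem exists_bound_inv {g : Metric n M} (hg : IsRegular g) {z : M} {K : Set (𝔼 n)}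
    (hK : IsCompact K) (hKt : K ⊆ (extChartAt (𝓡 n) z).target) :
    ∃ c, 0 ≤ c ∧ ∀ p ∈ K, ∀ i j, |(metricMatrix g z p)⁻¹ i j| ≤ c := by
  have h : ∀ i j, ∃ c, ∀ p ∈ K, ‖(metricMatrix g z p)⁻¹ i j‖ ≤ c := fun i j =>
    hK.exists_bound_of_continuousOn ((hg.contDiffOn_inv z i j).continuousOn.mono hKt)
  choose c hc using h
  refine ⟨∑ i, ∑ j, |c i j|, by positivity, fun p hp i j => ?_⟩
  refine (hc i j p hp).trans ((le_abs_self _).trans ?_)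
  exact (Finset.single_le_sum (f := fun j => |c i j|) (fun _ _ => abs_nonneg _)
    (Finset.mem_univ j)).trans (Finset.single_le_sum (f := fun i => ∑ j, |c i j|)
    (fun _ _ => Finset.sum_nonneg fun _ _ => abs_nonneg _) (Finset.mem_univ i))

/-- Mollification in coordinates enlarges the support to a compact set K that still lies over U. The
inverse metric is bounded on K, so C¹ closeness in coordinates makes the Riemannian gradients close.
-/
theorem hasSmoothApprox_of_chart {g : Metric n M} (hg : IsRegular g) {U : Set M} (hU : IsOpen U)
    {z : M} {ψ : M → ℝ} (hψ : IsTest n 1 U ψ) (hz : tsupport ψ ⊆ (extChartAt (𝓡 n) z).source) :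
    HasSmoothApprox g U ψ := by
  have hO := isOpen_chart_inter_preimage (n := n) z hU
  have hpull := contDiff_chartPull hψ hz
  have hsub := (tsupport_chartPull hψ.compact hz).trans (image_tsupport_subset hψ.subset hz)
  have hcs := hasCompactSupport_chartPull hψ.compact hz
  obtain ⟨δ, hδ, hδO⟩ := hcs.isCompact.exists_cthickening_subset_open hO hsub
  set K := Metric.cthickening δ (tsupport (chartPull (n := n) z ψ)) with hK
  have hKc : IsCompact K := hcs.isCompact.cthickening
  have hKt : K ⊆ (extChartAt (𝓡 n) z).target := fun p hp => (hδO hp).1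
  have hKU : (extChartAt (𝓡 n) z).symm '' K ⊆ U := by
    rintro _ ⟨p, hp, rfl⟩; exact (hδO hp).2
  obtain ⟨c, hc0, hc⟩ := exists_bound_inv hg hKc hKt
  refine ⟨_, isCompact_symm_image hKc hKt, hKU, fun ε hε => ?_⟩
  -- If all partial derivatives differ by at most ε' and the entries of the inverse metric are at
  -- most c, then the squared gradient of the difference is at most n² c ε'². The cap at 1 reduces
  -- the quadratic condition to a linear one.
  obtain ⟨ε', hε', hε'1, hε'2⟩ : ∃ ε' > 0, ε' ≤ ε ∧ n * n * (c * ε' * ε') ≤ ε := by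
    refine ⟨min (min ε 1) (ε / (n * n * c + 1)), lt_min (lt_min hε one_pos) (by positivity),
      (min_le_left _ _).trans (min_le_left _ _), ?_⟩
    set e := min (min ε 1) (ε / (n * n * c + 1)) with he
    have he0 : 0 < e := lt_min (lt_min hε one_pos) (by positivity)
    have he1 : e ≤ 1 := (min_le_left _ _).trans (min_le_right _ _)
    have he2 : e * (n * n * c + 1) ≤ ε := by
      rw [← le_div_iff₀ (by positivity)]; exact min_le_right _ _
    have h3 : (n * n * c * e) * e ≤ n * n * c * e := mul_le_of_le_one_right (by positivity) he1
    nlinarith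
  obtain ⟨v, hv, hvs, hve⟩ := exists_contDiff_approx hpull hcs hδ hε'
  have hT : IsTest n ⊤ U (chartPush z v) := isTest_chartPush hKc hKt hKU hvs hv
  refine ⟨chartPush z v, hT, tsupport_chartPush hKc hKt hvs, fun y => ?_⟩
  have hpe : ∀ {y}, y ∈ (extChartAt (𝓡 n) z).source →
      chartPull (n := n) z ψ (extChartAt (𝓡 n) z y) = ψ y := fun hy => by
    rw [chartPull, indicator_of_mem ((extChartAt (𝓡 n) z).map_source hy), Function.comp_apply,
      (extChartAt (𝓡 n) z).left_inv hy]
  constructor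
  · by_cases hy : y ∈ (extChartAt (𝓡 n) z).source
    · rw [chartPush_of_mem v hy, ← hpe hy]
      exact ((hve _).1).trans hε'1
    · rw [chartPush, indicator_of_notMem hy, image_eq_zero_of_notMem_tsupport fun h => hy (hz h)]
      simpa using hε.le
  · have hts : tsupport (fun y => chartPush z v y - ψ y) ⊆ (extChartAt (𝓡 n) z).symm '' K := by
      refine (tsupport_sub _ _).trans (union_subset (tsupport_chartPush hKc hKt hvs) ?_)
      intro y hy
      refine ⟨extChartAt (𝓡 n) z y, ?_, (extChartAt (𝓡 n) z).left_inv (hz hy)⟩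
      refine Metric.self_subset_cthickening _ ?_
      have hcont : ContinuousAt (extChartAt (𝓡 n) z) y := continuousAt_extChartAt' (hz hy)
      rw [tsupport, mem_closure_iff_nhds] at hy ⊢
      intro t ht
      obtain ⟨q, ⟨hq1, hq3⟩, hq2⟩ := hy _ (inter_mem (hcont.preimage_mem_nhds ht)
        ((isOpen_extChartAt_source z).mem_nhds (hz (mem_closure_iff_nhds.2 hy))))
      exact ⟨_, hq1, by rw [Function.mem_support, hpe hq3]; exact hq2⟩
    by_cases hy : y ∈ tsupport (fun y => chartPush z v y - ψ y)
    · obtain ⟨p, hp, rfl⟩ := hts hy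
      have hps := (extChartAt (𝓡 n) z).map_target (hKt hp)
      have hd := ((hT.mono le_top subset_rfl).sub hψ).mdifferentiableAt le_rfl
        ((extChartAt (𝓡 n) z).symm p)
      rw [gradNormSq_eq, gradInner_symm_eq g (hKt hp) hd hd, coinner_eq_sum]
      refine (sum_sum_mul_le (hc p hp) (fun i => ?_) hc0 hε'.le).trans hε'2
      have he : (fun y => chartPush z v y - ψ y) ∘ (extChartAt (𝓡 n) z).symm =ᶠ[𝓝 p]
          fun q => v q - chartPull z ψ q := by
        have e1 := chartPush_eventuallyEq v hps
        rw [(extChartAt (𝓡 n) z).right_inv (hKt hp)] at e1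
        filter_upwards [e1, chartPull_eventuallyEq z ψ (hKt hp)] with q h1 h2
        rw [h2, ← h1]; rfl
      have hd1 : DifferentiableAt ℝ v p := hv.contDiffAt.differentiableAt (by simp)
      have hd2 : DifferentiableAt ℝ (chartPull (n := n) z ψ) p :=
        hpull.contDiffAt.differentiableAt (by simp)
      have := (hve p).2 i
      rw [dcoord, partialD, he.fderiv_eq, fderiv_fun_sub hd1 hd2]
      exact this
    · rw [gradNormSq_eq_zero g hy]; exact hε.le

theorem IsTest.hasSmoothApprox [SigmaCompactSpace M] {g : Metric n M} (hg : IsRegular g)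
    {U : Set M} (hU : IsOpen U) {ψ : M → ℝ} (hψ : IsTest n 1 U ψ) : HasSmoothApprox g U ψ := by
  refine IsTest.induction hU (P := HasSmoothApprox g U) ?_
    (fun _ _ t₁ t₂ h₁ h₂ => HasSmoothApprox.add t₁ t₂ h₁ h₂)
    (fun z ψ hψ hz => hasSmoothApprox_of_chart hg hU hψ hz) hψ
  have h0 : tsupport (fun _ : M => (0 : ℝ)) = ∅ := tsupport_eq_empty_iff.2 rfl
  refine ⟨∅, isCompact_empty, empty_subset _, fun ε hε => ⟨fun _ => 0, IsTest.zero _ _, h0.subset,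
    fun y => ⟨by simpa using hε.le, ?_⟩⟩⟩
  simp only [sub_zero]
  rw [gradNormSq_eq_zero g (by simp [h0])]
  exact hε.le

end Approximation

/-! ### The Sobolev inequality for C¹ functions. -/

section Sobolev

variable {n : ℕ} {M : Type*} [TopologicalSpace M] [ChartedSpace (EuclideanSpace ℝ (Fin n)) M]
  [IsManifold (𝓡 n) ∞ M] [MeasurableSpace M] [BorelSpace M] [T2Space M] [SigmaCompactSpace M]

/-- The Sobolev inequality extends to `C^1` functions with compact support. -/
theorem SobolevOn.isTest {g : Metric n M} (hg : IsRegular g) {B : Set M} (hB : IsOpen B) {A : ℝ}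
    (hS : SobolevOn g B A) {ψ : M → ℝ} (hψ : IsTest n 1 B ψ) :
    (∫ y in B, ψ y ^ 4 ∂(vol g)) ^ (1 / 2 : ℝ) ≤ A * ∫ y in B, gradNormSq g ψ y ∂(vol g) := by
  have : LocallyCompactSpace M := Manifold.locallyCompact_of_finiteDimensional (𝓡 n)
  have := isLocallyFinite_vol hg
  obtain ⟨K, hK, hKB, hKv⟩ := hψ.hasSmoothApprox hg hB
  choose! v hv hvK hve using hKv
  let ε : ℕ → ℝ := fun k => 1 / (k + 1 : ℝ)
  have hε : ∀ k, 0 < ε k := fun k => by positivity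
  have hε1 : ∀ k, ε k ≤ 1 := fun k => by
    simp only [ε]
    rw [div_le_one (by positivity)]
    linarith [(Nat.cast_nonneg k : (0 : ℝ) ≤ k)]
  have hεt : Tendsto ε atTop (𝓝 0) := tendsto_one_div_add_atTop_nhds_zero_nat
  have hgc : ∀ {φ : M → ℝ}, IsTest n 1 B φ → Continuous (gradNormSq g φ) := fun hφ => by
    have := (hφ.continuous_gradInner hg hB hφ.smooth.contMDiffOn).1
    exact this.congr fun y => (gradNormSq_eq g _ y).symm
  have hv1 : ∀ k, IsTest n 1 B (v (ε k)) := fun k => (hv _ (hε k)).mono le_top subset_rfl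
  obtain ⟨c₁, hc₁⟩ := hK.exists_bound_of_continuousOn hψ.smooth.continuous.continuousOn
  obtain ⟨c₂, hc₂⟩ := hK.exists_bound_of_continuousOn (hgc hψ).continuousOn
  -- All approximants are supported in the one compact set K, so constants on K serve as dominating
  -- functions.
  have hbd : ∀ c : ℝ, Integrable (K.indicator fun _ => c) ((vol g).restrict B) := fun c =>
    (integrable_indicator_iff hK.isClosed.measurableSet).2
      (integrableOn_const ((Measure.restrict_apply_le _ _).trans_lt hK.measure_lt_top).ne)
  have hpt : ∀ y, Tendsto (fun k => v (ε k) y) atTop (𝓝 (ψ y)) := fun y => by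
    rw [tendsto_iff_dist_tendsto_zero]
    exact squeeze_zero (fun _ => dist_nonneg) (fun k => (hve _ (hε k) y).1) hεt
  -- The squared gradient is expanded around ψ; the cross term tends to zero by Cauchy–Schwarz,
  -- giving pointwise convergence.
  have hdif : ∀ k y, gradNormSq g (v (ε k)) y = gradNormSq g ψ y +
      2 * gradInner g (fun y => v (ε k) y - ψ y) ψ y +
      gradNormSq g (fun y => v (ε k) y - ψ y) y := fun k y => by
    have hd1 := ((hv1 k).sub hψ).mdifferentiableAt le_rfl y
    have hd2 := hψ.mdifferentiableAt le_rfl y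
    have e : v (ε k) = fun y => ψ y + (v (ε k) y - ψ y) := by funext y; ring
    conv_lhs => rw [e]
    simp only [gradNormSq_eq]
    rw [gradInner, gradInnerIn, dcoord_add (mem_extChartAt_source y) hd2 hd1]
    simp only [coinner_add_left, coinner_add_right]
    rw [coinner_comm g (mem_extChartAt_target y) (dcoord y ψ _)
      (dcoord y (fun y => v (ε k) y - ψ y) _)]
    simp only [gradInner, gradInnerIn]
    ring
  have hcs : ∀ k y, gradInner g (fun y => v (ε k) y - ψ y) ψ y ^ 2 ≤
      gradNormSq g (fun y => v (ε k) y - ψ y) y * gradNormSq g ψ y := fun k y => by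
    have hp := mem_extChartAt_target (I := 𝓡 n) y
    set a := dcoord y (fun y => v (ε k) y - ψ y) (extChartAt (𝓡 n) y y)
    set b := dcoord y ψ (extChartAt (𝓡 n) y y)
    have key : ∀ s : ℝ, 0 ≤ coinner g y (extChartAt (𝓡 n) y y) b b * (s * s) +
        (2 * coinner g y (extChartAt (𝓡 n) y y) a b) * s +
        coinner g y (extChartAt (𝓡 n) y y) a a := fun s => by
      have := coinner_self_nonneg g hp (a + s • b)
      simp only [coinner_add_left, coinner_add_right, coinner_smul_left, coinner_smul_right,
        coinner_comm g hp b a] at this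
      linarith
    have := discrim_le_zero key
    rw [discrim] at this
    simp only [gradNormSq_eq]
    change coinner g y _ a b ^ 2 ≤ coinner g y _ a a * coinner g y _ b b
    nlinarith
  have hpt2 : ∀ y, Tendsto (fun k => gradNormSq g (v (ε k)) y) atTop (𝓝 (gradNormSq g ψ y)) := by
    intro y
    have t2 : Tendsto (fun k => gradNormSq g (fun y => v (ε k) y - ψ y) y) atTop (𝓝 0) :=
      squeeze_zero (fun k => gradNormSq_nonneg g _ y) (fun k => (hve _ (hε k) y).2) hεt
    have t1 : Tendsto (fun k => gradInner g (fun y => v (ε k) y - ψ y) ψ y) atTop (𝓝 0) := by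
      have h1 : Tendsto (fun k => gradInner g (fun y => v (ε k) y - ψ y) ψ y ^ 2) atTop (𝓝 0) :=
        squeeze_zero (fun k => sq_nonneg _) (fun k => hcs k y)
          (by simpa using t2.mul_const (gradNormSq g ψ y))
      have h2 := h1.sqrt
      simp only [Real.sqrt_sq_eq_abs, Real.sqrt_zero] at h2
      exact (tendsto_zero_iff_abs_tendsto_zero _).2 h2
    have := (tendsto_const_nhds (x := gradNormSq g ψ y)).add (t1.const_mul 2) |>.add t2
    simp only [mul_zero, add_zero] at this
    exact this.congr fun k => (hdif k y).symm
  have T1 : Tendsto (fun k => ∫ y in B, v (ε k) y ^ 4 ∂(vol g)) atTop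
      (𝓝 (∫ y in B, ψ y ^ 4 ∂(vol g))) := by
    refine tendsto_integral_of_dominated_convergence (K.indicator fun _ => (c₁ + 1) ^ 4)
      (fun k => ((hv1 k).smooth.continuous.pow 4).aestronglyMeasurable) (hbd _)
      (fun k => ae_of_all _ fun y => ?_) (ae_of_all _ fun y => (hpt y).pow 4)
    by_cases hy : y ∈ K
    · rw [indicator_of_mem hy, norm_pow]
      refine pow_le_pow_left₀ (norm_nonneg _) ?_ 4
      have h1 := (hve _ (hε k) y).1
      have h2 := hc₁ y hy
      rw [Real.norm_eq_abs] at h2 ⊢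
      have h3 := abs_add_le (ψ y) (v (ε k) y - ψ y)
      rw [add_sub_cancel] at h3
      linarith [hε1 k]
    · rw [indicator_of_notMem hy, image_eq_zero_of_notMem_tsupport fun h => hy (hvK _ (hε k) h)]
      simp
  have T2 : Tendsto (fun k => ∫ y in B, gradNormSq g (v (ε k)) y ∂(vol g)) atTop
      (𝓝 (∫ y in B, gradNormSq g ψ y ∂(vol g))) := by
    refine tendsto_integral_of_dominated_convergence (K.indicator fun _ => 2 * c₂ + 2)
      (fun k => (hgc (hv1 k)).aestronglyMeasurable) (hbd _)
      (fun k => ae_of_all _ fun y => ?_) (ae_of_all _ hpt2)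
    by_cases hy : y ∈ K
    · rw [indicator_of_mem hy, Real.norm_of_nonneg (gradNormSq_nonneg g _ y)]
      have h1 := (hve _ (hε k) y).2
      have h2 := hc₂ y hy
      rw [Real.norm_of_nonneg (gradNormSq_nonneg g _ y)] at h2
      have hd1 := ((hv1 k).sub hψ).mdifferentiableAt le_rfl y
      have hd2 := hψ.mdifferentiableAt le_rfl y
      have e : v (ε k) = fun y => ψ y + (v (ε k) y - ψ y) := by funext y; ring
      have h3 := gradNormSq_add_le g hd2 hd1
      rw [← e] at h3
      linarith [hε1 k]
    · rw [indicator_of_notMem hy, gradNormSq_eq_zero g fun h => hy (hvK _ (hε k) h)]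
      simp
  have T3 := (Real.continuous_rpow_const (q := 1 / 2) (by norm_num)).continuousAt.tendsto.comp T1
  refine le_of_tendsto_of_tendsto' T3 (T2.const_mul A) fun k => ?_
  have hk := hv _ (hε k)
  exact hS _ hk.smooth hk.compact hk.subset

end Sobolev

/-! ### The Hopf–Rinow theorem in length spaces. -/

section LengthSpace

variable {X : Type*} [PseudoEMetricSpace X]

/-- In a length space a closed ball is in the `ε`-neighbourhood of a slightly smaller one. -/
theorem exists_edist_lt_of_length
    (hl : ∀ (y z : X) (a b : ℝ≥0∞), edist y z < a + b → 0 < b → ∃ w, edist y w ≤ a ∧ edist w z < b)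
    {x y : X} {s s' ε : ℝ} (hs : 0 ≤ s) (hε : s' < s + ε) (hε0 : 0 < ε)
    (hy : edist x y ≤ ENNReal.ofReal s') :
    ∃ w, edist x w ≤ ENNReal.ofReal s ∧ edist w y < ENNReal.ofReal ε := by
  refine hl x y _ _ (hy.trans_lt ?_) (ENNReal.ofReal_pos.2 hε0)
  rw [← ENNReal.ofReal_add hs hε0.le]
  exact (ENNReal.ofReal_lt_ofReal_iff (by linarith)).2 hε

/-- The Hopf–Rinow theorem: in a locally compact length space in which Cauchy sequences in the
closed balls of radius less than `r` converge, these balls are compact. -/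
theorem isCompact_closedEBall_of_length [LocallyCompactSpace X]
    (hl : ∀ (y z : X) (a b : ℝ≥0∞), edist y z < a + b → 0 < b → ∃ w, edist y w ≤ a ∧ edist w z < b)
    {x : X} {r : ℝ}
    (hc : ∀ s < r, ∀ u : ℕ → X, (∀ k, edist x (u k) ≤ ENNReal.ofReal s) → CauchySeq u →
      ∃ z, Tendsto u atTop (𝓝 z)) {s₁ : ℝ} (hs₁ : s₁ < r) (h0 : 0 ≤ s₁) :
    IsCompact {y : X | edist x y ≤ ENNReal.ofReal s₁} := by
  have hcl : ∀ s : ℝ, IsClosed {y : X | edist x y ≤ ENNReal.ofReal s} := fun s =>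
    isClosed_le (continuous_const.edist continuous_id) continuous_const
  have hmono : ∀ {s s' : ℝ}, s ≤ s' → {y : X | edist x y ≤ ENNReal.ofReal s} ⊆
      {y : X | edist x y ≤ ENNReal.ofReal s'} := fun h y hy =>
    le_trans (show edist x y ≤ _ from hy) (ENNReal.ofReal_le_ofReal h)
  -- Continuity method in the radius: the supremum σ of the radii with compact ball is attained, and
  -- it cannot lie below s₁.
  let S : Set ℝ := {s | s ∈ Icc 0 s₁ ∧ IsCompact {y : X | edist x y ≤ ENNReal.ofReal s}}
  have h0S : (0 : ℝ) ∈ S := by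
    refine ⟨⟨le_rfl, h0⟩, ?_⟩
    obtain ⟨K, hK, hxK⟩ := exists_compact_mem_nhds x
    refine hK.of_isClosed_subset (hcl 0) fun y hy => ?_
    have hxy : edist x y = 0 := by simpa using hy
    obtain ⟨δ, hδ, hδK⟩ := EMetric.mem_nhds_iff.1 hxK
    exact hδK (by rw [Metric.mem_eball, edist_comm, hxy]; exact hδ)
  have hbdd : BddAbove S := ⟨s₁, fun s hs => hs.1.2⟩
  set σ := sSup S with hσ
  have hσ0 : 0 ≤ σ := le_csSup hbdd h0S
  have hσ1 : σ ≤ s₁ := csSup_le ⟨0, h0S⟩ fun s hs => hs.1.2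
  have hσS : IsCompact {y : X | edist x y ≤ ENNReal.ofReal σ} := by
    rw [isCompact_iff_totallyBounded_isComplete]
    constructor
    · rw [EMetric.totallyBounded_iff]
      intro ε hε
      obtain ⟨e, he, heε⟩ : ∃ e : ℝ, 0 < e ∧ ENNReal.ofReal e + ENNReal.ofReal e ≤ ε := by
        obtain ⟨d, hd, hdε⟩ := ENNReal.lt_iff_exists_nnreal_btwn.1 hε
        have hd0 : (0 : ℝ) < d := by exact_mod_cast hd
        refine ⟨d / 2, by positivity, ?_⟩
        rw [← ENNReal.ofReal_add (by positivity) (by positivity), add_halves,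
          ENNReal.ofReal_coe_nnreal]
        exact hdε.le
      -- The ball of radius σ is within e of a compact ball of radius s > σ - e, so an e-net of the
      -- latter is a 2e-net of the former.
      obtain ⟨s, hsS, hs⟩ := exists_lt_of_lt_csSup ⟨0, h0S⟩ (show σ - e < sSup S by linarith)
      obtain ⟨t, -, htf, ht⟩ := EMetric.totallyBounded_iff'.1 hsS.2.totallyBounded _
        (ENNReal.ofReal_pos.2 he)
      refine ⟨t, htf, fun y hy => ?_⟩
      obtain ⟨w, hw, hwy⟩ := exists_edist_lt_of_length hl hsS.1.1 (s' := σ) (ε := e) (by linarith)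
        he hy
      obtain ⟨z, hz, hwz⟩ := mem_iUnion₂.1 (ht hw)
      refine mem_iUnion₂.2 ⟨z, hz, ?_⟩
      rw [Metric.mem_eball] at hwz ⊢
      rw [edist_comm] at hwy
      exact (edist_triangle y w z).trans_lt ((ENNReal.add_lt_add hwy hwz).trans_le heε)
    · rw [← completeSpace_coe_iff_isComplete]
      refine UniformSpace.complete_of_cauchySeq_tendsto fun u hu => ?_
      have hu' : CauchySeq fun k => (u k : X) :=
        hu.map uniformContinuous_subtype_val
      obtain ⟨z, hz⟩ := hc σ (hσ1.trans_lt hs₁) _ (fun k => (u k).2) hu'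
      exact ⟨⟨z, (hcl σ).mem_of_tendsto hz (Eventually.of_forall fun k => (u k).2)⟩,
        tendsto_subtype_rng.2 hz⟩
  -- A compact neighbourhood of the σ-ball contains a δ-thickening of it, and by the length property
  -- that contains the ball of radius σ + δ/2.
  obtain ⟨K, hK, hσK⟩ := exists_compact_superset hσS
  obtain ⟨δ, hδ, hδK⟩ := hσS.exists_thickening_subset_open isOpen_interior hσK
  have hnew : min (σ + δ / 2) s₁ ∈ S := by
    refine ⟨⟨le_min (by positivity) h0, min_le_right _ _⟩,
      hK.of_isClosed_subset (hcl _) fun y hy => interior_subset (hδK ?_)⟩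
    obtain ⟨w, hw, hwy⟩ := exists_edist_lt_of_length hl hσ0 (ε := δ)
      ((min_le_left _ _).trans_lt (by linarith)) hδ hy
    rw [Metric.mem_thickening_iff_exists_edist_lt]
    exact ⟨w, hw, by rwa [edist_comm]⟩
  have h1 := le_csSup hbdd hnew
  have h2 : s₁ ≤ σ := by
    by_contra! h
    have : σ < min (σ + δ / 2) s₁ := lt_min (by linarith) h
    linarith
  exact hσS.of_isClosed_subset (hcl _) (hmono h2)

end LengthSpace

/-! ### The Riemannian distance and compactness of its balls. -/

section Distance

variable {n : ℕ} {M : Type*} [TopologicalSpace M] [ChartedSpace (EuclideanSpace ℝ (Fin n)) M]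
  [IsManifold (𝓡 n) ∞ M]

theorem riemDist_self (g : Metric n M) (x : M) : riemDist g x x = 0 := by
  let _ : Bundle.RiemannianBundle (fun y : M => TangentSpace (𝓡 n) y) := ⟨g.toRiemannianMetric⟩
  exact Manifold.riemannianEDist_self

theorem riemDist_comm (g : Metric n M) (x y : M) : riemDist g x y = riemDist g y x := by
  let _ : Bundle.RiemannianBundle (fun y : M => TangentSpace (𝓡 n) y) := ⟨g.toRiemannianMetric⟩
  exact Manifold.riemannianEDist_comm

theorem riemDist_triangle (g : Metric n M) (x y z : M) :
    riemDist g x z ≤ riemDist g x y + riemDist g y z := by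
  let _ : Bundle.RiemannianBundle (fun y : M => TangentSpace (𝓡 n) y) := ⟨g.toRiemannianMetric⟩
  exact Manifold.riemannianEDist_triangle

variable [T2Space M] [SigmaCompactSpace M]

/-- The metric space structure of the Riemannian distance. -/
theorem exists_pseudoEMetricSpace (g : Metric n M) : ∃ e : PseudoEMetricSpace M,
    e.toUniformSpace.toTopologicalSpace = ‹TopologicalSpace M› ∧
      ∀ x y, e.edist x y = riemDist g x y := by
  let _ : Bundle.RiemannianBundle (fun y : M => TangentSpace (𝓡 n) y) := ⟨g.toRiemannianMetric⟩
  have : IsContinuousRiemannianBundle (𝔼 n) (fun y : M => TangentSpace (𝓡 n) y) :=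
    ⟨⟨g.inner, g.contMDiff.continuous, fun _ _ _ => rfl⟩⟩
  have : IsManifold (𝓡 n) 1 M := IsManifold.of_le (n := ∞) (by exact_mod_cast le_top)
  have : LocallyCompactSpace M := Manifold.locallyCompact_of_finiteDimensional (𝓡 n)
  exact ⟨PseudoEMetricSpace.ofRiemannianMetric (𝓡 n) M, rfl, fun _ _ => rfl⟩

theorem continuous_riemDist (g : Metric n M) (x : M) : Continuous (riemDist g x) := by
  obtain ⟨e, rfl, he⟩ := exists_pseudoEMetricSpace g
  exact (continuous_const.edist continuous_id : Continuous fun y : M => edist x y).congr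
    fun y => he x y

/-- The length space property. A curve from x to y of length below a + b is cut where the distance
from x equals a; the first piece has length at least a, so less than b remains. -/
theorem exists_riemDist_lt (g : Metric n M) {x y : M} {a b : ℝ≥0∞} (h : riemDist g x y < a + b)
    (hb : 0 < b) : ∃ w, riemDist g x w ≤ a ∧ riemDist g w y < b := by
  rcases le_or_gt (riemDist g x y) a with hxy | hxy
  · exact ⟨y, hxy, by rwa [riemDist_self]⟩
  have hc := continuous_riemDist g x
  let _ : Bundle.RiemannianBundle (fun y : M => TangentSpace (𝓡 n) y) := ⟨g.toRiemannianMetric⟩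
  obtain ⟨γ, h0, h1, hγ, hlen⟩ := Manifold.exists_lt_of_riemannianEDist_lt (I := 𝓡 n) h
  have hiv := intermediate_value_Icc (zero_le_one' ℝ) (hc.comp_continuousOn hγ.continuousOn)
  obtain ⟨t, ht, hta⟩ : a ∈ (riemDist g x ∘ γ) '' Icc 0 1 := hiv
    ⟨by simp [h0, riemDist_self], by simpa [h1] using hxy.le⟩
  refine ⟨γ t, hta.le, ?_⟩
  have l1 : riemDist g x (γ t) ≤ Manifold.pathELength (𝓡 n) γ 0 t :=
    Manifold.riemannianEDist_le_pathELength (hγ.mono (Icc_subset_Icc_right ht.2)) h0 rfl ht.1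
  have l2 : riemDist g (γ t) y ≤ Manifold.pathELength (𝓡 n) γ t 1 :=
    Manifold.riemannianEDist_le_pathELength (hγ.mono (Icc_subset_Icc_left ht.1)) rfl h1 ht.2
  rw [← Manifold.pathELength_add ht.1 ht.2] at hlen
  have hta' : riemDist g x (γ t) = a := hta
  rw [hta'] at l1
  have hfin : a ≠ ⊤ := (hxy.trans_le le_top).ne
  refine (ENNReal.add_lt_add_iff_left hfin).1 (lt_of_le_of_lt (add_le_add l1 l2) hlen)

theorem isOpen_geodesicBall (g : Metric n M) (x : M) (r : ℝ) : IsOpen (geodesicBall g x r) :=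
  isOpen_lt (continuous_riemDist g x) continuous_const

theorem isCompact_riemDist_le {g : Metric n M} {x : M} {r : ℝ} (hc : CompleteInside g x r) {s : ℝ}
    (hs : s < r) (h0 : 0 ≤ s) : IsCompact {y | riemDist g x y ≤ ENNReal.ofReal s} := by
  have : LocallyCompactSpace M := Manifold.locallyCompact_of_finiteDimensional (𝓡 n)
  have hl := fun y z a b => exists_riemDist_lt g (x := y) (y := z) (a := a) (b := b)
  obtain ⟨e, he1, he⟩ := exists_pseudoEMetricSpace g
  -- The given topology is replaced by the one of the distance, so that the abstract Hopf–Rinow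
  -- theorem applies to M itself.
  subst he1
  simp only [← he] at hl ⊢
  refine isCompact_closedEBall_of_length hl (fun s hs u hu hC => ?_) hs h0
  refine hc s hs u (fun k => by rw [← he]; exact hu k) fun ε hε => ?_
  obtain ⟨N, hN⟩ := EMetric.cauchySeq_iff.1 hC ε hε
  exact ⟨N, fun k hk l hl => by rw [← he]; exact hN k hk l hl⟩

end Distance

/-! ### Mollification that keeps a Lipschitz bound; perturbation of quadratic forms. -/

section Mollification

open Matrix

/-- Approximation of a Lipschitz function by smooth functions with the same Lipschitz bound. -/
theorem exists_contDiff_approx_of_lipschitz {m : ℕ} {p₀ : 𝔼 m} {ρ : ℝ} (hρ : 0 < ρ)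
    {u N : (𝔼 m) → ℝ} (hN : Continuous N) (h0 : N 0 = 0) (hs : ∀ s w, N (s • w) = |s| * N w)
    (hu : ∀ p ∈ Metric.ball p₀ ρ, ∀ q ∈ Metric.ball p₀ ρ, |u p - u q| ≤ N (p - q))
    {ε : ℝ} (hε : 0 < ε) :
    ∃ v : (𝔼 m) → ℝ, ContDiff ℝ ∞ v ∧
      ∀ p ∈ Metric.ball p₀ (ρ / 2), |v p - u p| ≤ ε ∧ ∀ w, |fderiv ℝ v p w| ≤ N w := by
  obtain ⟨δ, hδ, hδN⟩ := Metric.continuous_iff.1 hN 0 ε hε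
  -- With τ ≤ ρ/4, averaging around a point of the half ball only sees the closed ball of radius
  -- 3ρ/4, where the Lipschitz bound is available; τ ≤ δ makes the average ε-close to u.
  obtain ⟨τ, hτ, hτδ, hτρ⟩ : ∃ τ > 0, τ ≤ δ ∧ τ ≤ ρ / 4 :=
    ⟨min δ (ρ / 4), lt_min hδ (by linarith), min_le_left _ _, min_le_right _ _⟩
  let φ : ContDiffBump (0 : 𝔼 m) := ⟨τ / 2, τ, half_pos hτ, half_lt_self hτ⟩
  set K := Metric.closedBall p₀ (3 / 4 * ρ) with hK
  have hKb : K ⊆ Metric.ball p₀ ρ := Metric.closedBall_subset_ball (by linarith)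
  have huc : ContinuousOn u (Metric.ball p₀ ρ) := fun p hp => by
    rw [ContinuousWithinAt, tendsto_iff_dist_tendsto_zero]
    have hz : Tendsto (fun q => N (q - p)) (𝓝[Metric.ball p₀ ρ] p) (𝓝 0) := by
      have : Continuous fun q => N (q - p) := hN.comp (continuous_id.sub continuous_const)
      have h1 := this.tendsto p
      simp only [sub_self, h0] at h1
      exact h1.mono_left nhdsWithin_le_nhds
    refine squeeze_zero' (Eventually.of_forall fun _ => dist_nonneg) ?_ hz
    filter_upwards [self_mem_nhdsWithin] with q hq
    exact hu q hq p hp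
  have hUi : Integrable (K.indicator u) :=
    (integrable_indicator_iff measurableSet_closedBall).2
      ((huc.mono hKb).integrableOn_compact (isCompact_closedBall _ _))
  have hUl := hUi.locallyIntegrable
  let v : (𝔼 m) → ℝ := MeasureTheory.convolution (φ.normed volume) (K.indicator u)
    (ContinuousLinearMap.lsmul ℝ ℝ) volume
  have hv : ContDiff ℝ ∞ v :=
    φ.hasCompactSupport_normed.contDiff_convolution_left _ φ.contDiff_normed hUl
  have hmem : ∀ p ∈ Metric.ball p₀ (ρ / 2), ∀ t : 𝔼 m, ‖t‖ < τ → p - t ∈ K := fun p hp t ht => by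
    rw [Metric.mem_ball, dist_eq_norm] at hp
    rw [hK, Metric.mem_closedBall, dist_eq_norm, sub_right_comm]
    linarith [norm_sub_le (p - p₀) t]
  have hex : ∀ p, ConvolutionExistsAt (φ.normed volume) (K.indicator u) p
      (ContinuousLinearMap.lsmul ℝ ℝ) (volume : Measure (𝔼 m)) := fun p =>
    φ.hasCompactSupport_normed.convolutionExists_left _ φ.continuous_normed hUl p
  have hlip : ∀ p ∈ Metric.ball p₀ (ρ / 2), ∀ q ∈ Metric.ball p₀ (ρ / 2),
      |v p - v q| ≤ N (p - q) := fun p hp q hq => by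
    have e : v p - v q = ∫ t, (φ.normed volume t * K.indicator u (p - t) -
        φ.normed volume t * K.indicator u (q - t)) := (integral_sub (hex p) (hex q)).symm
    rw [e]
    have hi : Integrable (fun t : 𝔼 m => φ.normed volume t * N (p - q)) :=
      φ.integrable_normed.mul_const _
    have h1 := norm_integral_le_of_norm_le hi (f := fun t =>
      φ.normed volume t * K.indicator u (p - t) - φ.normed volume t * K.indicator u (q - t))
      (ae_of_all _ fun t => by
        by_cases ht : ‖t‖ < τ
        · rw [indicator_of_mem (hmem p hp t ht), indicator_of_mem (hmem q hq t ht), ← mul_sub,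
            norm_mul, Real.norm_of_nonneg (φ.nonneg_normed t)]
          refine mul_le_mul_of_nonneg_left ?_ (φ.nonneg_normed t)
          have := hu _ (hKb (hmem p hp t ht)) _ (hKb (hmem q hq t ht))
          rwa [sub_sub_sub_cancel_right] at this
        · have : φ.normed volume t = 0 := by
            rw [← Function.notMem_support, φ.support_normed_eq]
            simpa using ht
          simp [this])
    rwa [integral_mul_const, φ.integral_normed, one_mul] at h1
  refine ⟨v, hv, fun p hp => ⟨?_, fun w => ?_⟩⟩
  · have hpK : p ∈ K := by simpa using hmem p hp 0 (by simpa using hτ)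
    have h1 : dist (v p) (K.indicator u p) ≤ ε := by
      refine φ.dist_normed_convolution_le hUi.aestronglyMeasurable fun q hq => ?_
      have hq' : ‖p - q‖ < τ := by rw [← dist_eq_norm, dist_comm]; exact hq
      have hqK : q ∈ K := by simpa using hmem p hp (p - q) hq'
      rw [indicator_of_mem hqK, indicator_of_mem hpK, Real.dist_eq]
      refine (hu q (hKb hqK) p (hKb hpK)).trans ?_
      have := hδN (q - p) (by rw [dist_zero_right, ← norm_sub_rev]; exact hq'.trans_le hτδ)
      rw [h0, Real.dist_0_eq_abs] at this
      exact (le_abs_self _).trans this.le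
    rwa [indicator_of_mem hpK, Real.dist_eq] at h1
  · have hd : HasFDerivAt v (fderiv ℝ v p) p :=
      (hv.contDiffAt.differentiableAt (by simp)).hasFDerivAt
    have hl : HasDerivAt (fun s : ℝ => p + s • w) w 0 := by
      simpa using ((hasDerivAt_id (0 : ℝ)).smul_const w).const_add p
    have hc : HasDerivAt (fun s : ℝ => v (p + s • w)) (fderiv ℝ v p w) 0 := by
      have hd' : HasFDerivAt v (fderiv ℝ v p) (p + (0 : ℝ) • w) := by simpa using hd
      exact hd'.comp_hasDerivAt (0 : ℝ) hl
    -- Nonnegativity of N is not assumed: by homogeneity it follows from the Lipschitz inequality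
    -- for a short multiple of w.
    have hNw : 0 ≤ N w := by
      have h2 := hu p₀ (Metric.mem_ball_self hρ) p₀ (Metric.mem_ball_self hρ)
      obtain ⟨s, hs0, hsb⟩ : ∃ s : ℝ, 0 < s ∧ p₀ + s • w ∈ Metric.ball p₀ ρ := by
        refine ⟨ρ / (2 * (‖w‖ + 1)), by positivity, ?_⟩
        rw [Metric.mem_ball, dist_eq_norm, add_sub_cancel_left, norm_smul,
          Real.norm_of_nonneg (by positivity), div_mul_eq_mul_div, div_lt_iff₀ (by positivity)]
        nlinarith [norm_nonneg w]
      have h3 := (abs_nonneg _).trans (hu _ hsb p₀ (Metric.mem_ball_self hρ))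
      rw [add_sub_cancel_left, hs, abs_of_pos hs0] at h3
      exact nonneg_of_mul_nonneg_right h3 hs0
    have hev : ∀ᶠ s in 𝓝 (0 : ℝ), p + s • w ∈ Metric.ball p₀ (ρ / 2) := by
      have hct : Continuous fun s : ℝ => p + s • w := by fun_prop
      exact hct.continuousAt.preimage_mem_nhds
        (Metric.isOpen_ball.mem_nhds (by simpa using hp))
    refine hc.le_of_lip' hNw ?_
    filter_upwards [hev] with s hsb
    have := hlip _ hsb p hp
    rw [add_sub_cancel_left, hs] at this
    simpa [mul_comm] using this

/-- Cauchy–Schwarz gives w_i² ≤ (G₀⁻¹)_{ii} Q with Q = w·G₀w. Hence an entrywise error η changes the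
form by at most m² η κ Q, where κ = tr G₀⁻¹, and η is chosen so that this is at most Q/2. -/
theorem posDef_quadratic_near {m : ℕ} {G₀ : Matrix (Fin m) (Fin m) ℝ} (hG : G₀.PosDef) :
    ∃ η > 0, ∀ G : Matrix (Fin m) (Fin m) ℝ, (∀ i j, |G i j - G₀ i j| ≤ η) →
      ∀ w : Fin m → ℝ, 1 / 2 * (w ⬝ᵥ (G₀ *ᵥ w)) ≤ w ⬝ᵥ (G *ᵥ w) ∧
        w ⬝ᵥ (G *ᵥ w) ≤ 2 * (w ⬝ᵥ (G₀ *ᵥ w)) := by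
  have hk : ∀ i, 0 ≤ G₀⁻¹ i i := fun i => by
    have := posDef_inv_quadratic_nonneg hG (Pi.single i 1)
    simpa using this
  set κ := ∑ i, G₀⁻¹ i i with hκ
  have hκ0 : 0 ≤ κ := Finset.sum_nonneg fun i _ => hk i
  refine ⟨1 / (2 * (m * m * κ + 1)), by positivity, fun G hGG w => ?_⟩
  set η := 1 / (2 * (m * m * κ + 1)) with hη
  have hη0 : 0 ≤ η := by positivity
  set Q := w ⬝ᵥ (G₀ *ᵥ w) with hQ
  have hQ0 : 0 ≤ Q := by simpa using hG.posSemidef.dotProduct_mulVec_nonneg w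
  have hw : ∀ i, |w i| ≤ √(κ * Q) := fun i => by
    refine Real.abs_le_sqrt ?_
    have h1 := posDef_sq_dotProduct_le hG (Pi.single i 1) w
    simp only [single_dotProduct, one_mul, mulVec_single_one, col_apply] at h1
    refine h1.trans (mul_le_mul_of_nonneg_right ?_ hQ0)
    exact Finset.single_le_sum (f := fun i => G₀⁻¹ i i) (fun i _ => hk i) (Finset.mem_univ i)
  have hsm : m * m * (η * √(κ * Q) * √(κ * Q)) ≤ 1 / 2 * Q := by
    rw [mul_assoc η, Real.mul_self_sqrt (by positivity)]
    have h2 : m * m * κ * η ≤ 1 / 2 := by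
      rw [hη, mul_one_div, div_le_iff₀ (by positivity)]
      linarith
    nlinarith
  have hexp : ∀ H : Matrix (Fin m) (Fin m) ℝ, w ⬝ᵥ (H *ᵥ w) = ∑ i, ∑ j, H i j * w i * w j :=
    fun H => by
      simp only [dotProduct, mulVec, Finset.mul_sum]
      exact Finset.sum_congr rfl fun i _ => Finset.sum_congr rfl fun j _ => by ring
  have h1 := (sum_sum_mul_le (G := G - G₀) (fun i j => hGG i j) hw hη0 (Real.sqrt_nonneg _)).trans hsm
  have h2 := (sum_sum_mul_le (G := G₀ - G) (fun i j => by
    rw [Matrix.sub_apply, abs_sub_comm]; exact hGG i j) hw hη0 (Real.sqrt_nonneg _)).trans hsm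
  rw [← hexp, sub_mulVec, dotProduct_sub] at h1 h2
  constructor <;> linarith

end Mollification

/-! ### Local smoothing of functions that are 1-Lipschitz for the distance. -/

section DistanceApproximation

open Matrix

variable {n : ℕ} {M : Type*} [TopologicalSpace M] [ChartedSpace (EuclideanSpace ℝ (Fin n)) M]
  [IsManifold (𝓡 n) ∞ M]

/-- The distance of two points of a chart is at most the length of the coordinate segment. -/
theorem riemDist_symm_le (g : Metric n M) {z : M} {O : Set (𝔼 n)} (hO : Convex ℝ O)
    (hOt : O ⊆ (extChartAt (𝓡 n) z).target) {q : (𝔼 n) → ℝ}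
    (hq : ∀ p ∈ O, ∀ w : 𝔼 n, (w : Fin n → ℝ) ⬝ᵥ (metricMatrix g z p *ᵥ w) ≤ q w)
    {a b : 𝔼 n} (ha : a ∈ O) (hb : b ∈ O) :
    riemDist g ((extChartAt (𝓡 n) z).symm a) ((extChartAt (𝓡 n) z).symm b) ≤
      ENNReal.ofReal √(q (b - a)) := by
  let _ : Bundle.RiemannianBundle (fun y : M => TangentSpace (𝓡 n) y) := ⟨g.toRiemannianMetric⟩
  let η : ℝ → (𝔼 n) := fun t => a + t • (b - a)
  have hη : ContDiff ℝ ∞ η := by fun_prop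
  have hηd : ∀ t, HasDerivAt η (b - a) t := fun t => by
    have := ((hasDerivAt_id t).smul_const (b - a)).const_add a
    rwa [one_smul] at this
  have hηO : ∀ t ∈ Icc (0 : ℝ) 1, η t ∈ O := fun t ht => by
    have := hO ha hb (sub_nonneg.2 ht.2) ht.1 (by ring)
    convert! this using 1
    simp only [η, smul_sub, sub_smul, one_smul]
    abel
  let γ : ℝ → M := fun t => (extChartAt (𝓡 n) z).symm (η t)
  have hsymm : ContMDiffOn 𝓘(ℝ, 𝔼 n) (𝓡 n) ∞ (extChartAt (𝓡 n) z).symm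
      (extChartAt (𝓡 n) z).target := contMDiffOn_extChartAt_symm z
  have hγ : ContMDiffOn 𝓘(ℝ, ℝ) (𝓡 n) 1 γ (Icc 0 1) :=
    (hsymm.comp hη.contMDiff.contMDiffOn fun t ht => hOt (hηO t ht)).of_le
      (by exact_mod_cast le_top)
  have h1 : riemDist g ((extChartAt (𝓡 n) z).symm a) ((extChartAt (𝓡 n) z).symm b) ≤
      Manifold.pathELength (𝓡 n) γ 0 1 :=
    Manifold.riemannianEDist_le_pathELength hγ (by simp [γ, η, -extChartAt])
      (by simp [γ, η, -extChartAt]) zero_le_one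
  refine h1.trans ?_
  rw [Manifold.pathELength_eq_lintegral_mfderiv_Icc]
  have h2 : ∀ t ∈ Icc (0 : ℝ) 1,
      ‖mfderiv 𝓘(ℝ, ℝ) (𝓡 n) γ t 1‖ₑ ≤ ENNReal.ofReal √(q (b - a)) := fun t ht => by
    have hd := mfderiv_comp (I := 𝓘(ℝ, ℝ)) (I' := 𝓘(ℝ, 𝔼 n)) (I'' := 𝓡 n) t
      (mdifferentiableAt_symm (n := n) z (hOt (hηO t ht)))
      (hηd t).differentiableAt.mdifferentiableAt
    have hd1 : mfderiv 𝓘(ℝ, ℝ) (𝓡 n) γ t 1 = symmD z (η t) (b - a) := by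
      have := congrArg (fun L => L (1 : ℝ)) hd
      refine this.trans ?_
      change symmD z (η t) (mfderiv 𝓘(ℝ, ℝ) 𝓘(ℝ, 𝔼 n) η t 1) = _
      rw [mfderiv_eq_fderiv]
      congr 1
      exact (hηd t).deriv
    have hsq : ‖mfderiv 𝓘(ℝ, ℝ) (𝓡 n) γ t 1‖ ^ 2 ≤ q (b - a) := by
      rw [← real_inner_self_eq_norm_sq]
      refine le_trans (le_of_eq ?_) (hq _ (hηO t ht) (b - a))
      rw [dotProduct_metricMatrix, ← hd1]
      rfl
    rw [← ofReal_norm]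
    exact ENNReal.ofReal_le_ofReal (Real.le_sqrt_of_sq_le hsq)
  refine (setLIntegral_mono' measurableSet_Icc h2).trans ?_
  simp

/-- A function that is `1`-Lipschitz for the Riemannian distance can be approximated, near a given
point, by smooth functions with bounded gradient. -/
theorem exists_smooth_approx_near {g : Metric n M} (hg : IsRegular g) {D : M → ℝ}
    (hD : ∀ y y', ENNReal.ofReal |D y - D y'| ≤ riemDist g y y') (z : M) :
    ∃ W : Set M, IsOpen W ∧ z ∈ W ∧ ∀ ε > 0, ∃ v : M → ℝ,
      ContMDiffOn (𝓡 n) 𝓘(ℝ, ℝ) (⊤ : ℕ∞) v W ∧ ∀ y ∈ W, |v y - D y| ≤ ε ∧ gradNormSq g v y ≤ 4 := by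
  set p₀ := extChartAt (𝓡 n) z z with hp₀
  have hp₀t : p₀ ∈ (extChartAt (𝓡 n) z).target := mem_extChartAt_target z
  set G₀ := metricMatrix g z p₀ with hG₀
  have hpos : G₀.PosDef := posDef_metricMatrix g hp₀t
  obtain ⟨η, hη, hGη⟩ := posDef_quadratic_near hpos
  have hnear : ∀ᶠ p in 𝓝 p₀, p ∈ (extChartAt (𝓡 n) z).target ∧
      ∀ i j, |metricMatrix g z p i j - G₀ i j| ≤ η := by
    refine Eventually.and ((isOpen_extChartAt_target z).mem_nhds hp₀t) ?_
    refine eventually_all.2 fun i => eventually_all.2 fun j => ?_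
    have hc := ((hg z i j).continuousOn.continuousAt
      ((isOpen_extChartAt_target z).mem_nhds hp₀t))
    filter_upwards [hc.tendsto (Metric.closedBall_mem_nhds _ hη)] with p hp
    exact hp
  obtain ⟨ρ, hρ, hball⟩ := Metric.eventually_nhds_iff_ball.1 hnear
  have hsub : Metric.ball p₀ ρ ⊆ (extChartAt (𝓡 n) z).target := fun p hp => (hball p hp).1
  have hcomp := fun p hp w => hGη _ (hball p hp).2 w
  -- Near p₀ the metric G satisfies G ≤ 2G₀ ≤ 4G. The first inequality bounds the increments of D by
  -- √(2G₀), which mollification preserves; the second turns this into |∇v|² ≤ 4.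
  let q : (𝔼 n) → ℝ := fun w => 2 * ((w : Fin n → ℝ) ⬝ᵥ (G₀ *ᵥ w))
  have hqc : Continuous q := by
    refine continuous_const.mul ?_
    simp only [dotProduct, mulVec]
    fun_prop
  let N : (𝔼 n) → ℝ := fun w => √(q w)
  have hN : Continuous N := hqc.sqrt
  have hqs : ∀ (s : ℝ) w, q (s • w) = s ^ 2 * q w := fun s w => by
    simp only [q, WithLp.ofLp_smul, smul_dotProduct, mulVec_smul, dotProduct_smul, smul_eq_mul]
    ring
  have hNs : ∀ (s : ℝ) w, N (s • w) = |s| * N w := fun s w => by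
    simp only [N, hqs]
    rw [Real.sqrt_mul (sq_nonneg s), Real.sqrt_sq_eq_abs]
  have hN0 : N 0 = 0 := by simpa using hNs 0 0
  have hlip : ∀ p ∈ Metric.ball p₀ ρ, ∀ p' ∈ Metric.ball p₀ ρ,
      |(D ∘ (extChartAt (𝓡 n) z).symm) p - (D ∘ (extChartAt (𝓡 n) z).symm) p'| ≤ N (p - p') := by
    intro p hp p' hp'
    have h1 := (hD ((extChartAt (𝓡 n) z).symm p') ((extChartAt (𝓡 n) z).symm p)).trans
      (riemDist_symm_le g (convex_ball p₀ ρ) hsub (q := q)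
        (fun p hp w => (hcomp p hp w).2) hp' hp)
    rw [ENNReal.ofReal_le_ofReal_iff (Real.sqrt_nonneg _), abs_sub_comm] at h1
    exact h1
  refine ⟨(extChartAt (𝓡 n) z).source ∩ extChartAt (𝓡 n) z ⁻¹' Metric.ball p₀ (ρ / 2),
    (continuousOn_extChartAt z).isOpen_inter_preimage (isOpen_extChartAt_source z)
      Metric.isOpen_ball, ⟨mem_extChartAt_source z, Metric.mem_ball_self (half_pos hρ)⟩,
    fun ε hε => ?_⟩
  obtain ⟨v, hv, hve⟩ := exists_contDiff_approx_of_lipschitz hρ hN hN0 hNs hlip hε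
  have hsm : ContMDiffOn (𝓡 n) 𝓘(ℝ, ℝ) (⊤ : ℕ∞) (v ∘ extChartAt (𝓡 n) z)
      ((extChartAt (𝓡 n) z).source) := by
    rw [extChartAt_source]
    exact hv.contMDiff.comp_contMDiffOn (contMDiffOn_extChartAt (n := ∞))
  refine ⟨v ∘ extChartAt (𝓡 n) z, hsm.mono inter_subset_left, fun y hy => ⟨?_, ?_⟩⟩
  · have := (hve _ hy.2).1
    simpa only [Function.comp_apply, (extChartAt (𝓡 n) z).left_inv hy.1] using this
  · have hd : MDifferentiableAt (𝓡 n) 𝓘(ℝ, ℝ) (v ∘ extChartAt (𝓡 n) z) y :=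
      ContMDiffOn.mdifferentiableAt_of_isOpen (isOpen_extChartAt_source z) le_top hsm hy.1
    rw [gradNormSq_eq, gradInner_eq_in g hy.1 hd hd]
    refine gradInnerIn_self_le g (by norm_num) hy.1 fun w => ?_
    have he : (v ∘ extChartAt (𝓡 n) z) ∘ (extChartAt (𝓡 n) z).symm
        =ᶠ[𝓝 (extChartAt (𝓡 n) z y)] v := by
      filter_upwards [(isOpen_extChartAt_target z).mem_nhds ((extChartAt (𝓡 n) z).map_source hy.1)]
        with p hp
      simp only [Function.comp_apply, (extChartAt (𝓡 n) z).right_inv hp]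
    have hyb : extChartAt (𝓡 n) z y ∈ Metric.ball p₀ ρ :=
      Metric.ball_subset_ball (by linarith) hy.2
    have h1 := (hve _ hy.2).2 w
    have h2 := (hcomp _ hyb w).1
    have hQ : 0 ≤ (w : Fin n → ℝ) ⬝ᵥ (G₀ *ᵥ w) := by
      simpa using hpos.posSemidef.dotProduct_mulVec_nonneg (w : Fin n → ℝ)
    rw [he.fderiv_eq]
    calc (fderiv ℝ v (extChartAt (𝓡 n) z y) w) ^ 2 ≤ (N w) ^ 2 := by
          rw [← sq_abs]; exact pow_le_pow_left₀ (abs_nonneg _) h1 2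
      _ = q w := Real.sq_sqrt (by positivity)
      _ ≤ _ := by simp only [q]; linarith

/-- The length of a covector. -/
theorem sqrt_coinner_add_le (g : Metric n M) {z : M} {p : 𝔼 n}
    (hp : p ∈ (extChartAt (𝓡 n) z).target) (a b : Fin n → ℝ) :
    √(coinner g z p (a + b) (a + b)) ≤ √(coinner g z p a a) + √(coinner g z p b b) := by
  have ha := coinner_self_nonneg g hp a
  have hb := coinner_self_nonneg g hp b
  have hcs : coinner g z p a b ^ 2 ≤ coinner g z p a a * coinner g z p b b := by
    have key : ∀ s : ℝ, 0 ≤ coinner g z p b b * (s * s) + (2 * coinner g z p a b) * s +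
        coinner g z p a a := fun s => by
      have := coinner_self_nonneg g hp (a + s • b)
      simp only [coinner_add_left, coinner_add_right, coinner_smul_left, coinner_smul_right,
        coinner_comm g hp b a] at this
      linarith
    have := discrim_le_zero key
    rw [discrim] at this
    nlinarith
  have h1 : coinner g z p a b ≤ √(coinner g z p a a) * √(coinner g z p b b) := by
    rw [← Real.sqrt_mul ha]
    exact Real.le_sqrt_of_sq_le hcs
  refine Real.sqrt_le_iff.2 ⟨by positivity, ?_⟩
  simp only [coinner_add_left, coinner_add_right, coinner_comm g hp b a]
  nlinarith [Real.sq_sqrt ha, Real.sq_sqrt hb]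

theorem sqrt_coinner_smul (g : Metric n M) (z : M) (p : 𝔼 n) (k : ℝ) (a : Fin n → ℝ) :
    √(coinner g z p (k • a) (k • a)) = |k| * √(coinner g z p a a) := by
  rw [coinner_smul_left, coinner_smul_right, ← mul_assoc, ← sq, Real.sqrt_mul (sq_nonneg k),
    Real.sqrt_sq_eq_abs]

theorem sqrt_coinner_sum_le (g : Metric n M) {z : M} {p : 𝔼 n}
    (hp : p ∈ (extChartAt (𝓡 n) z).target) {ι : Type*} (s : Finset ι) (a : ι → Fin n → ℝ) :
    √(coinner g z p (∑ i ∈ s, a i) (∑ i ∈ s, a i)) ≤ ∑ i ∈ s, √(coinner g z p (a i) (a i)) := by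
  classical
  induction s using Finset.induction_on with
  | empty => simp [coinner]
  | insert i s hi ih =>
    rw [Finset.sum_insert hi, Finset.sum_insert hi]
    exact (sqrt_coinner_add_le g hp _ _).trans (by gcongr)

end DistanceApproximation

/-! ### Global smoothing of the distance, and the cutoff functions. -/

section Cutoffs

variable {n : ℕ} {M : Type*} [TopologicalSpace M] [ChartedSpace (EuclideanSpace ℝ (Fin n)) M]
  [IsManifold (𝓡 n) ∞ M]

theorem dcoord_const (z : M) (c : ℝ) (p : 𝔼 n) : dcoord z (fun _ : M => c) p = 0 := by
  funext i
  have : (fun _ : M => c) ∘ (extChartAt (𝓡 n) z).symm = fun _ => c := rfl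
  simp [dcoord, partialD, this, -extChartAt]

theorem dcoord_sum {ι : Type*} (s : Finset ι) {φ : ι → M → ℝ} {z y : M}
    (hz : y ∈ (extChartAt (𝓡 n) z).source)
    (hφ : ∀ i ∈ s, MDifferentiableAt (𝓡 n) 𝓘(ℝ, ℝ) (φ i) y) :
    MDifferentiableAt (𝓡 n) 𝓘(ℝ, ℝ) (fun y => ∑ i ∈ s, φ i y) y ∧
    dcoord z (fun y => ∑ i ∈ s, φ i y) (extChartAt (𝓡 n) z y) =
      ∑ i ∈ s, dcoord z (φ i) (extChartAt (𝓡 n) z y) := by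
  classical
  induction s using Finset.induction_on with
  | empty => exact ⟨by simpa using mdifferentiableAt_const, by simp [dcoord_const, -extChartAt]⟩
  | insert i s hi ih =>
    obtain ⟨h1, h2⟩ := ih fun j hj => hφ j (Finset.mem_insert_of_mem hj)
    have h3 := hφ i (Finset.mem_insert_self i s)
    simp only [Finset.sum_insert hi]
    exact ⟨h3.add h1, by rw [dcoord_add hz h3 h1, h2]⟩

variable [T2Space M] [SigmaCompactSpace M]

/-- A function that is `1`-Lipschitz for the Riemannian distance can be approximated on compact sets
by smooth functions with bounded gradient. -/
theorem exists_smooth_approx_on_compact {g : Metric n M} (hg : IsRegular g) {D : M → ℝ}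
    (hD : ∀ y y', ENNReal.ofReal |D y - D y'| ≤ riemDist g y y') {K : Set M} (hK : IsCompact K)
    {ε : ℝ} (hε : 0 < ε) :
    ∃ h : M → ℝ, ContMDiff (𝓡 n) 𝓘(ℝ, ℝ) (⊤ : ℕ∞) h ∧
      ∀ y ∈ K, |h y - D y| ≤ ε ∧ gradNormSq g h y ≤ 9 := by
  have : LocallyCompactSpace M := Manifold.locallyCompact_of_finiteDimensional (𝓡 n)
  choose W hWo hzW hW using exists_smooth_approx_near hg hD
  obtain ⟨χ, hχ⟩ := SmoothPartitionOfUnity.exists_isSubordinate (𝓡 n) (isClosed_univ (X := M)) W hWo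
    fun z _ => mem_iUnion_of_mem z (hzW z)
  -- The finite sum over F must equal 1 in a neighbourhood of each point of K, so that its
  -- differential vanishes there.
  obtain ⟨K', hK', hKK'⟩ := exists_compact_superset hK
  have hfin := χ.locallyFinite.finite_nonempty_inter_compact hK'
  set F := hfin.toFinset with hF
  have hsum : ∀ y ∈ K', ∑ i ∈ F, χ i y = 1 := fun y hy => by
    rw [← χ.sum_eq_one (mem_univ y)]
    refine (finsum_eq_sum_of_support_subset _ fun i hi => ?_).symm
    rw [hF, hfin.coe_toFinset]
    exact ⟨y, hi, hy⟩
  have hχs : ∀ i, ContMDiff (𝓡 n) 𝓘(ℝ, ℝ) (⊤ : ℕ∞) (χ i) := fun i => (χ i).contMDiff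
  have hχd : ∀ i y, MDifferentiableAt (𝓡 n) 𝓘(ℝ, ℝ) (χ i) y := fun i y =>
    ContMDiffOn.mdifferentiableAt_of_isOpen isOpen_univ le_top (hχs i).contMDiffOn (mem_univ y)
  have hbd : ∀ i, ∃ c, ∀ y ∈ K', ‖√(gradNormSq g (χ i) y)‖ ≤ c := fun i => by
    refine hK'.exists_bound_of_continuousOn (ContinuousOn.sqrt ?_)
    have h1 := continuousOn_gradInner hg isOpen_univ
      (((hχs i).of_le (by exact_mod_cast le_top)).contMDiffOn (s := univ))
      (((hχs i).of_le (by exact_mod_cast le_top)).contMDiffOn (s := univ))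
    exact (h1.mono (subset_univ _)).congr fun y _ => gradNormSq_eq g _ y
  choose c hc using hbd
  set S := ∑ i ∈ F, |c i| with hS
  have hS0 : 0 ≤ S := Finset.sum_nonneg fun i _ => abs_nonneg _
  -- S bounds the sum of |∇χ_i| on K'; the local accuracy e is chosen so that gluing adds at most 1
  -- to the gradient.
  obtain ⟨e, he, heε, heS⟩ : ∃ e > 0, e ≤ ε ∧ e * S ≤ 1 := by
    refine ⟨min ε (1 / (S + 1)), lt_min hε (by positivity), min_le_left _ _, ?_⟩
    have h1 : min ε (1 / (S + 1)) * (S + 1) ≤ 1 := by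
      rw [← le_div_iff₀ (by positivity)]; exact min_le_right _ _
    have h2 : 0 < min ε (1 / (S + 1)) := lt_min hε (by positivity)
    linarith
  choose v hv hve using fun i => hW i e he
  have hprod : ∀ i, ContMDiff (𝓡 n) 𝓘(ℝ, ℝ) (⊤ : ℕ∞) fun y => χ i y * v i y := fun i =>
    contMDiff_of_tsupport_subset (hWo i) ((hχs i).contMDiffOn.mul (hv i))
      (tsupport_mul_subset_left.trans (hχ i))
  refine ⟨fun y => ∑ i ∈ F, χ i y * v i y, contMDiff_finsetSum fun i _ => hprod i,
    fun y hy => ?_⟩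
  have hyK' : y ∈ K' := interior_subset (hKK' hy)
  have hmem : ∀ i, χ i y ≠ 0 → y ∈ W i := fun i hi => hχ i (subset_tsupport _ hi)
  constructor
  · have e1 : ∑ i ∈ F, χ i y * v i y - D y = ∑ i ∈ F, χ i y * (v i y - D y) := by
      simp only [mul_sub, Finset.sum_sub_distrib, ← Finset.sum_mul, hsum y hyK', one_mul]
    rw [e1]
    calc |∑ i ∈ F, χ i y * (v i y - D y)| ≤ ∑ i ∈ F, |χ i y * (v i y - D y)| :=
          Finset.abs_sum_le_sum_abs _ _
      _ ≤ ∑ i ∈ F, χ i y * e := Finset.sum_le_sum fun i _ => by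
          rw [abs_mul, abs_of_nonneg (χ.nonneg i y)]
          by_cases h0 : χ i y = 0
          · simp [h0]
          · exact mul_le_mul_of_nonneg_left (hve i y (hmem i h0)).1 (χ.nonneg i y)
      _ = e := by rw [← Finset.sum_mul, hsum y hyK', one_mul]
      _ ≤ ε := heε
  · have hys := mem_extChartAt_source (I := 𝓡 n) y
    have hyt := mem_extChartAt_target (I := 𝓡 n) y
    set p := extChartAt (𝓡 n) y y with hp
    have hpd : ∀ i ∈ F, MDifferentiableAt (𝓡 n) 𝓘(ℝ, ℝ) (fun y => χ i y * v i y) y :=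
      fun i _ => ContMDiffOn.mdifferentiableAt_of_isOpen isOpen_univ le_top
        (hprod i).contMDiffOn (mem_univ y)
    have hdprod : ∀ i, dcoord y (fun y => χ i y * v i y) p =
        χ i y • dcoord y (v i) p + v i y • dcoord y (χ i) p := fun i => by
      by_cases h : y ∈ tsupport (χ i)
      · exact dcoord_mul hys (hχd i y)
          (ContMDiffOn.mdifferentiableAt_of_isOpen (hWo i) le_top (hv i) (hχ i h))
      · rw [dcoord_eq_zero_of_notMem_tsupport hys h, dcoord_eq_zero_of_notMem_tsupport hys
          fun h' => h (tsupport_mul_subset_left h'), image_eq_zero_of_notMem_tsupport h]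
        simp
    have hdone : ∑ i ∈ F, dcoord y (χ i) p = 0 := by
      rw [← (dcoord_sum F hys fun i _ => hχd i y).2, ← dcoord_const y 1 p]
      refine dcoord_congr hys ?_
      filter_upwards [isOpen_interior.mem_nhds (hKK' hy)] with q hq
      exact hsum q (interior_subset hq)
    -- Since ∑ dχ_i = 0, the multiple D(y) ∑ dχ_i may be subtracted, and the coefficient of dχ_i
    -- becomes the small number v_i - D. The gradient is then at most 2 + eS ≤ 3, whence the bound
    -- 9.
    have hd : dcoord y (fun y => ∑ i ∈ F, χ i y * v i y) p =
        ∑ i ∈ F, (χ i y • dcoord y (v i) p + (v i y - D y) • dcoord y (χ i) p) := by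
      rw [(dcoord_sum F hys hpd).2]
      simp only [← hp, hdprod, sub_smul, Finset.sum_add_distrib, Finset.sum_sub_distrib,
        ← Finset.smul_sum, hdone, smul_zero, sub_zero]
    have hcov : ∀ φ : M → ℝ, coinner g y p (dcoord y φ p) (dcoord y φ p) = gradNormSq g φ y :=
      fun φ => (gradNormSq_eq g φ y).symm
    have hle : √(gradNormSq g (fun y => ∑ i ∈ F, χ i y * v i y) y) ≤ 3 := by
      rw [← hcov, hd]
      calc _ ≤ ∑ i ∈ F, _ := sqrt_coinner_sum_le g hyt F _
        _ ≤ ∑ i ∈ F, (χ i y * 2 + e * |c i|) := Finset.sum_le_sum fun i _ => by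
            refine (sqrt_coinner_add_le g hyt _ _).trans ?_
            rw [sqrt_coinner_smul, sqrt_coinner_smul, hcov, hcov, abs_of_nonneg (χ.nonneg i y)]
            refine add_le_add ?_ ?_
            · by_cases h0 : χ i y = 0
              · simp [h0]
              · refine mul_le_mul_of_nonneg_left ?_ (χ.nonneg i y)
                rw [Real.sqrt_le_left (by norm_num)]
                linarith [(hve i y (hmem i h0)).2]
            · by_cases h : y ∈ tsupport (χ i)
              · refine mul_le_mul (hve i y (hχ i h)).1 ?_ (Real.sqrt_nonneg _) he.le
                exact (le_abs_self _).trans ((hc i y hyK').trans (le_abs_self _))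
              · rw [gradNormSq_eq_zero g h]
                simp only [Real.sqrt_zero, mul_zero]
                positivity
        _ = 2 + e * S := by
            rw [Finset.sum_add_distrib, ← Finset.sum_mul, hsum y hyK', ← Finset.mul_sum, one_mul]
        _ ≤ 3 := by linarith
    rw [Real.sqrt_le_left (by norm_num)] at hle
    linarith

/-- The derivative is continuous and vanishes outside [0, 1]. This bound is absolute, so the final
constant does not depend on the manifold. -/
theorem exists_bound_deriv_smoothTransition :
    ∃ L : ℝ, 0 ≤ L ∧ ∀ t, |deriv Real.smoothTransition t| ≤ L := by
  have hc : Continuous (deriv Real.smoothTransition) :=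
    (Real.smoothTransition.contDiff (n := 1)).continuous_deriv le_rfl
  obtain ⟨L, hL⟩ := (isCompact_Icc (a := (0 : ℝ)) (b := 1)).exists_bound_of_continuousOn
    hc.continuousOn
  have hL0 : 0 ≤ L := (norm_nonneg _).trans (hL 0 ⟨le_rfl, zero_le_one⟩)
  refine ⟨L, hL0, fun t => ?_⟩
  by_cases ht : t ∈ Icc (0 : ℝ) 1
  · exact hL t ht
  · have h0 : deriv Real.smoothTransition t = 0 := by
      rcases not_and_or.1 ht with h | h
      · have : Real.smoothTransition =ᶠ[𝓝 t] fun _ => 0 := by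
          filter_upwards [gt_mem_nhds (not_le.1 h)] with s hs
          exact Real.smoothTransition.zero_of_nonpos hs.le
        rw [this.deriv_eq]; simp
      · have : Real.smoothTransition =ᶠ[𝓝 t] fun _ => 1 := by
          filter_upwards [lt_mem_nhds (not_le.1 h)] with s hs
          exact Real.smoothTransition.one_of_one_le hs.le
        rw [this.deriv_eq]; simp
    rw [h0, abs_zero]; exact hL0

/-- A nested sequence of cutoff functions in a geodesic ball. -/
theorem exists_cutoffs {L : ℝ} (hL : ∀ t, |deriv Real.smoothTransition t| ≤ L) {g : Metric n M}
    (hg : IsRegular g) {x : M} {r : ℝ} (hr : 0 < r) (hc : CompleteInside g x r) :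
    ∃ φ : ℕ → M → ℝ, (∀ k, IsTest n ⊤ (geodesicBall g x r) (φ k)) ∧
      (∀ k y, 0 ≤ φ k y ∧ φ k y ≤ 1) ∧ (∀ k, ∀ y ∈ tsupport (φ (k + 1)), φ k y = 1) ∧
      (∀ k y, gradNormSq g (φ k) y ≤ 9 * (16 * L) ^ 2 * 4 ^ k / r ^ 2) ∧
      ∀ᶠ y in 𝓝 x, ∀ k, φ k y = 1 := by
  have hL0 : 0 ≤ L := (abs_nonneg _).trans (hL 0)
  -- Truncation at r keeps the distance finite, also between different components, and preserves the
  -- Lipschitz bound.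
  let D : M → ℝ := fun y => (min (riemDist g x y) (ENNReal.ofReal r)).toReal
  have hfin : ∀ y, min (riemDist g x y) (ENNReal.ofReal r) ≠ ⊤ := fun y =>
    ((min_le_right _ _).trans_lt ENNReal.ofReal_lt_top).ne
  have hDc : Continuous D := by
    refine ENNReal.continuousOn_toReal.comp_continuous
      ((continuous_riemDist g x).min continuous_const) hfin
  have hD1 : ∀ y y', ENNReal.ofReal (D y - D y') ≤ riemDist g y y' := fun y y' => by
    rw [ENNReal.ofReal_sub _ ENNReal.toReal_nonneg, ENNReal.ofReal_toReal (hfin y),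
      ENNReal.ofReal_toReal (hfin y'), tsub_le_iff_left]
    rcases le_total (riemDist g x y') (ENNReal.ofReal r) with h | h
    · rw [min_eq_left h]
      refine (min_le_left _ _).trans ?_
      exact riemDist_triangle g x y' y |>.trans (by rw [riemDist_comm g y' y])
    · rw [min_eq_right h]
      exact (min_le_right _ _).trans le_self_add
  have hD : ∀ y y', ENNReal.ofReal |D y - D y'| ≤ riemDist g y y' := fun y y' => by
    rcases abs_cases (D y - D y') with ⟨h, -⟩ | ⟨h, -⟩
    · rw [h]; exact hD1 y y'
    · rw [h, neg_sub, riemDist_comm]; exact hD1 y' y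
  have hDlt : ∀ {s : ℝ} {y}, s ≤ r → D y < s → riemDist g x y < ENNReal.ofReal s := fun hs h => by
    rw [← ENNReal.ofReal_lt_ofReal_iff_of_nonneg ENNReal.toReal_nonneg,
      ENNReal.ofReal_toReal (hfin _)] at h
    rcases min_lt_iff.1 h with h | h
    · exact h
    · exact absurd (ENNReal.ofReal_le_ofReal hs) (not_le.2 h)
  have hDx : D x = 0 := by simp [D, riemDist_self]
  set K := {y | riemDist g x y ≤ ENNReal.ofReal (7 / 8 * r)} with hKdef
  have hK : IsCompact K := isCompact_riemDist_le hc (by linarith) (by positivity)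
  obtain ⟨h, hh, hhK⟩ := exists_smooth_approx_on_compact hg hD hK (ε := r / 16) (by positivity)
  set V := {y | D y < 7 / 8 * r} with hV
  have hVo : IsOpen V := isOpen_lt hDc continuous_const
  have hVK : V ⊆ K := fun y hy => (hDlt (by linarith) hy).le
  -- The radii a k decrease from 5r/8 to r/2, and ℓ k is the reciprocal of a k - a (k+1). Hence θ k
  -- is 1 for h ≤ a (k+1) and 0 for h ≥ a k, which nests the cutoffs; ℓ k² produces the growth
  -- 4^k/r².
  let a : ℕ → ℝ := fun k => r * (1 / 2 + (1 / 2) ^ k / 8)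
  let ℓ : ℕ → ℝ := fun k => 16 * 2 ^ k / r
  have hdiff : ∀ k, ℓ k * (a k - a (k + 1)) = 1 := fun k => by
    have : (2 : ℝ) ^ k * (1 / 2) ^ k = 1 := by rw [← mul_pow]; norm_num
    simp only [ℓ, a, pow_succ]
    field_simp
    linear_combination 16 * this
  have hℓ : ∀ k, 0 < ℓ k := fun k => by positivity
  have hak : ∀ k, a k ≤ 5 / 8 * r := fun k => by
    have : ((1 : ℝ) / 2) ^ k ≤ 1 := pow_le_one₀ (by norm_num) (by norm_num)
    simp only [a]; nlinarith
  have hak' : ∀ k, r / 2 < a k := fun k => by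
    have : 0 < ((1 : ℝ) / 2) ^ k := by positivity
    simp only [a]; nlinarith
  let θ : ℕ → ℝ → ℝ := fun k s => Real.smoothTransition (ℓ k * (a k - s))
  have hθs : ∀ k, ContDiff ℝ ∞ (θ k) := fun k =>
    Real.smoothTransition.contDiff.comp (contDiff_const.mul (contDiff_const.sub contDiff_id))
  have hθd : ∀ k s, HasDerivAt (θ k) (deriv Real.smoothTransition (ℓ k * (a k - s)) * (-ℓ k)) s :=
    fun k s => by
      have h1 : HasDerivAt (fun s => ℓ k * (a k - s)) (-ℓ k) s := by
        simpa using ((hasDerivAt_id s).const_sub (a k)).const_mul (ℓ k)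
      have h2 : HasDerivAt Real.smoothTransition (deriv Real.smoothTransition (ℓ k * (a k - s)))
          (ℓ k * (a k - s)) :=
        ((Real.smoothTransition.contDiff (n := 1)).differentiable (by norm_num) _).hasDerivAt
      exact h2.comp s h1
  -- Away from K nothing is known about h, so φ k is set to zero off V. On V, h ≤ a k forces D ≤
  -- 5r/8 + r/16 < 3r/4, so no jump occurs at the boundary of V.
  let φ : ℕ → M → ℝ := fun k => V.indicator fun y => θ k (h y)
  have hφV : ∀ {k y}, y ∈ V → φ k y = θ k (h y) := fun hy => indicator_of_mem hy _
  have hsupp : ∀ k y, φ k y ≠ 0 → D y ≤ 3 / 4 * r ∧ h y ≤ a k := fun k y hy => by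
    have hyV : y ∈ V := by by_contra h'; exact hy (indicator_of_notMem h' _)
    rw [hφV hyV] at hy
    have h1 : h y ≤ a k := by
      by_contra! h2
      exact hy (Real.smoothTransition.zero_of_nonpos
        (mul_nonpos_of_nonneg_of_nonpos (hℓ k).le (by linarith)))
    have h2 := abs_le.1 (hhK y (hVK hyV)).1
    exact ⟨by linarith [hak k, h2.1], h1⟩
  have hts : ∀ k, tsupport (φ k) ⊆ {y | D y ≤ 3 / 4 * r} ∩ {y | h y ≤ a k} := fun k =>
    closure_minimal (fun y hy => hsupp k y hy)
      ((isClosed_le hDc continuous_const).inter (isClosed_le hh.continuous continuous_const))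
  have htV : ∀ k, tsupport (φ k) ⊆ V := fun k y hy => by
    have : D y ≤ 3 / 4 * r := (hts k hy).1
    show D y < _
    linarith
  have hφon : ∀ k, ContMDiffOn (𝓡 n) 𝓘(ℝ, ℝ) (⊤ : ℕ∞) (φ k) V := fun k =>
    (((hθs k).contMDiff.comp hh).contMDiffOn).congr fun y hy => hφV hy
  refine ⟨φ, fun k => ⟨contMDiff_of_tsupport_subset hVo (hφon k) (htV k),
    hK.of_isClosed_subset (isClosed_tsupport _) ((htV k).trans hVK), fun y hy => ?_⟩,
    fun k y => ?_, fun k y hy => ?_, fun k y => ?_, ?_⟩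
  · exact hDlt le_rfl (lt_trans (htV k hy) (by linarith))
  · by_cases hy : y ∈ V
    · rw [hφV hy]
      exact ⟨Real.smoothTransition.nonneg _, Real.smoothTransition.le_one _⟩
    · simp [φ, indicator_of_notMem hy]
  · rw [hφV (htV _ hy)]
    refine Real.smoothTransition.one_of_one_le ?_
    have h1 : h y ≤ a (k + 1) := (hts _ hy).2
    rw [← hdiff k]
    exact mul_le_mul_of_nonneg_left (by linarith) (hℓ k).le
  · by_cases hy : y ∈ tsupport (φ k)
    · have hyV := htV k hy
      have hhd : MDifferentiableAt (𝓡 n) 𝓘(ℝ, ℝ) h y :=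
        ContMDiffOn.mdifferentiableAt_of_isOpen isOpen_univ le_top hh.contMDiffOn (mem_univ y)
      have he : φ k =ᶠ[𝓝 y] fun y => θ k (h y) := by
        filter_upwards [hVo.mem_nhds hyV] with q hq using hφV hq
      have hys := mem_extChartAt_source (I := 𝓡 n) y
      rw [gradNormSq_eq, gradInner, gradInnerIn, dcoord_congr hys he,
        dcoord_comp hys hhd (hθd k (h y)), coinner_smul_left, coinner_smul_right]
      change _ * (_ * gradInner g h h y) ≤ _
      rw [← gradNormSq_eq]
      have h1 := (hhK y (hVK hyV)).2
      have h2 := hL (ℓ k * (a k - h y))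
      set s := deriv Real.smoothTransition (ℓ k * (a k - h y))
      have h3 : s ^ 2 ≤ L ^ 2 := sq_le_sq' (abs_le.1 h2).1 (abs_le.1 h2).2
      have h4 : ℓ k ^ 2 = 16 ^ 2 * 4 ^ k / r ^ 2 := by
        simp only [ℓ, div_pow, mul_pow]
        rw [← pow_mul, mul_comm k 2, pow_mul]; norm_num
      calc s * -ℓ k * (s * -ℓ k * gradNormSq g h y) = s ^ 2 * (ℓ k ^ 2 * gradNormSq g h y) := by
            ring
        _ ≤ L ^ 2 * (ℓ k ^ 2 * 9) := by
            have := gradNormSq_nonneg g h y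
            gcongr
        _ = _ := by rw [h4]; ring
    · rw [gradNormSq_eq_zero g hy]; positivity
  · have h0 : h x < r / 2 := by
      have hxK : x ∈ K := hVK (by show D x < _; rw [hDx]; positivity)
      have := abs_le.1 (hhK x hxK).1
      rw [hDx] at this
      linarith [this.2]
    filter_upwards [(isOpen_lt hh.continuous continuous_const).mem_nhds h0,
      hVo.mem_nhds (show D x < _ by rw [hDx]; positivity)] with y hy hyV k
    rw [hφV hyV]
    refine Real.smoothTransition.one_of_one_le ?_
    have h1 : h y < r / 2 := hy
    rw [← hdiff k]
    exact mul_le_mul_of_nonneg_left (by linarith [hak' (k + 1)]) (hℓ k).le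

end Cutoffs

/-! ### Differentiation under the integral sign. -/

section ParametricIntegral

/-- The derivative F' is bounded on the product of a short closed time interval with K, and this
constant is the dominating function. -/
theorem hasDerivAt_setIntegral_of_isCompact {X : Type*} [TopologicalSpace X] [T2Space X]
    [MeasurableSpace X] [BorelSpace X] {μ : Measure X} [IsFiniteMeasureOnCompacts μ] {K : Set X}
    (hK : IsCompact K) {J : Set ℝ} (hJ : IsOpen J) {F F' : ℝ → X → ℝ}
    (hF : ContinuousOn (fun q : ℝ × X => F q.1 q.2) (J ×ˢ K))
    (hF' : ContinuousOn (fun q : ℝ × X => F' q.1 q.2) (J ×ˢ K))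
    (hd : ∀ t ∈ J, ∀ y ∈ K, HasDerivAt (fun s => F s y) (F' t y) t) {t : ℝ} (ht : t ∈ J) :
    HasDerivAt (fun s => ∫ y in K, F s y ∂μ) (∫ y in K, F' t y ∂μ) t := by
  obtain ⟨δ, hδ, hδJ⟩ := Metric.nhds_basis_closedBall.mem_iff.1 (hJ.mem_nhds ht)
  obtain ⟨c, hc⟩ := ((isCompact_closedBall t δ).prod hK).exists_bound_of_continuousOn
    (hF'.mono (prod_mono hδJ subset_rfl))
  have hslice : ∀ {H : ℝ → X → ℝ}, ContinuousOn (fun q : ℝ × X => H q.1 q.2) (J ×ˢ K) →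
      ∀ s ∈ J, ContinuousOn (H s) K := fun hH s hs =>
    hH.comp (continuous_const.prodMk continuous_id).continuousOn fun y hy => ⟨hs, hy⟩
  have hKm := hK.isClosed.measurableSet
  refine (hasDerivAt_integral_of_dominated_loc_of_deriv_le (bound := fun _ => c)
    (Metric.closedBall_mem_nhds t hδ) ?_ ((hslice hF t ht).integrableOn_compact hK) ?_ ?_ ?_ ?_).2
  · filter_upwards [hJ.mem_nhds ht] with s hs
    exact ((hslice hF s hs).integrableOn_compact hK).aestronglyMeasurable
  · exact ((hslice hF' t ht).integrableOn_compact hK).aestronglyMeasurable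
  · exact (ae_restrict_mem hKm).mono fun y hy s hs => hc (s, y) ⟨hs, hy⟩
  · exact integrableOn_const hK.measure_lt_top.ne
  · exact (ae_restrict_mem hKm).mono fun y hy s hs => hd s (hδJ hs) y hy

end ParametricIntegral

/-! ### Time derivatives of densities and of integrals over the moving volume. -/

section TimeDerivative

variable {n : ℕ} {M : Type*} [TopologicalSpace M] [ChartedSpace (EuclideanSpace ℝ (Fin n)) M]
  [IsManifold (𝓡 n) ∞ M]

theorem continuousOn_prod_of_chart {F : ℝ → M → ℝ} {J : Set ℝ} {U : Set M} (hJ : IsOpen J)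
    (hU : IsOpen U)
    (h : ∀ z : M, ContinuousOn
      (fun q : ℝ × (𝔼 n) => F q.1 ((extChartAt (𝓡 n) z).symm q.2))
      (J ×ˢ ((extChartAt (𝓡 n) z).target ∩ (extChartAt (𝓡 n) z).symm ⁻¹' U))) :
    ContinuousOn (fun q : ℝ × M => F q.1 q.2) (J ×ˢ U) := by
  rintro ⟨t, y⟩ ⟨ht, hy⟩
  have hym : extChartAt (𝓡 n) y y ∈
      (extChartAt (𝓡 n) y).target ∩ (extChartAt (𝓡 n) y).symm ⁻¹' U :=
    ⟨mem_extChartAt_target y, by rwa [mem_preimage, extChartAt_to_inv]⟩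
  have h1 := (h y).continuousAt (x := (t, extChartAt (𝓡 n) y y))
    ((hJ.prod (isOpen_chart_inter_preimage y hU)).mem_nhds ⟨ht, hym⟩)
  have h3 : ContinuousAt (fun q : ℝ × M => (q.1, extChartAt (𝓡 n) y q.2)) (t, y) :=
    by
      refine continuousAt_fst.prodMk ?_
      exact ContinuousAt.comp (f := fun q : ℝ × M => q.2) (g := extChartAt (𝓡 n) y) (x := (t, y))
        (continuousAt_extChartAt y) continuousAt_snd
  have h2 : ContinuousAt (fun q : ℝ × M =>
      F q.1 ((extChartAt (𝓡 n) y).symm (extChartAt (𝓡 n) y q.2))) (t, y) :=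
    ContinuousAt.comp (f := fun q : ℝ × M => (q.1, extChartAt (𝓡 n) y q.2))
      (g := fun q : ℝ × (𝔼 n) => F q.1 ((extChartAt (𝓡 n) y).symm q.2)) h1 h3
  refine (h2.congr ?_).continuousWithinAt
  filter_upwards [continuousAt_snd.preimage_mem_nhds (extChartAt_source_mem_nhds (I := 𝓡 n) y)]
    with q hq
  rw [(extChartAt (𝓡 n) y).left_inv hq]

variable {g : ℝ → Metric n M} {T : ℝ}

theorem SmoothFamilyOn.contDiffOn_volDensity (hg : SmoothFamilyOn g (Ico 0 T)) (z : M) :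
    ContDiffOn ℝ ∞ (fun q : ℝ × (𝔼 n) => volDensity (g q.1) z q.2)
      (Ioo 0 T ×ˢ (extChartAt (𝓡 n) z).target) :=
  (contDiffOn_matrix_det fun i j => (hg z i j).mono (prod_mono Ioo_subset_Ico_self subset_rfl)).sqrt
    fun _ hq => (det_metricMatrix_pos _ hq.2).ne'

theorem SmoothFamilyOn.hasDerivAt_volDensity (hg : SmoothFamilyOn g (Ico 0 T)) (z : M) {t : ℝ}
    (ht : t ∈ Ioo 0 T) {p : 𝔼 n} (hp : p ∈ (extChartAt (𝓡 n) z).target) :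
    HasDerivAt (fun s => volDensity (g s) z p)
      (fderiv ℝ (fun q : ℝ × (𝔼 n) => volDensity (g q.1) z q.2) (t, p) (1, 0)) t := by
  have hO := isOpen_Ioo (a := (0 : ℝ)) (b := T) |>.prod (isOpen_extChartAt_target (I := 𝓡 n) z)
  have h1 := (((hg.contDiffOn_volDensity z).contDiffAt
    (hO.mem_nhds (x := (t, p)) ⟨ht, hp⟩)).differentiableAt (by simp)).hasFDerivAt
  exact h1.comp_hasDerivAt t ((hasDerivAt_id t).prodMk (hasDerivAt_const t p))

theorem SmoothFamilyOn.continuousOn_deriv_volDensity (hg : SmoothFamilyOn g (Ico 0 T)) (z : M) :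
    ContinuousOn (fun q : ℝ × (𝔼 n) => deriv (fun s => volDensity (g s) z q.2) q.1)
      (Ioo 0 T ×ˢ (extChartAt (𝓡 n) z).target) := by
  have hO := isOpen_Ioo (a := (0 : ℝ)) (b := T) |>.prod (isOpen_extChartAt_target (I := 𝓡 n) z)
  have h1 := ((hg.contDiffOn_volDensity z).continuousOn_fderiv_of_isOpen hO (by simp)).clm_apply
    (continuousOn_const (c := ((1 : ℝ), (0 : 𝔼 n))))
  exact h1.congr fun q hq => (hg.hasDerivAt_volDensity z hq.1 hq.2).deriv

/-- The derivative in time of the volume density of `g` relative to `g 0`. -/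
def relDensityDeriv (g : ℝ → Metric n M) (t : ℝ) (y : M) : ℝ :=
  deriv (fun s => relDensity (g 0) (g s) y) t

theorem relDensityDeriv_eq (g : ℝ → Metric n M) (t : ℝ) {z y : M}
    (hz : y ∈ (extChartAt (𝓡 n) z).source) :
    relDensityDeriv g t y = deriv (fun s => volDensity (g s) z (extChartAt (𝓡 n) z y)) t /
      volDensity (g 0) z (extChartAt (𝓡 n) z y) := by
  rw [relDensityDeriv, funext fun s => relDensity_eq (g 0) (g s) hz]
  exact deriv_div_const _

theorem SmoothFamilyOn.hasDerivAt_relDensity (hg : SmoothFamilyOn g (Ico 0 T)) {t : ℝ}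
    (ht : t ∈ Ioo 0 T) (y : M) :
    HasDerivAt (fun s => relDensity (g 0) (g s) y) (relDensityDeriv g t y) t :=
  ((hg.hasDerivAt_volDensity y ht (mem_extChartAt_target y)).div_const _).differentiableAt.hasDerivAt

theorem SmoothFamilyOn.continuousOn_relDensity (hg : SmoothFamilyOn g (Ico 0 T)) (hT : 0 < T) :
    ContinuousOn (fun q : ℝ × M => relDensity (g 0) (g q.1) q.2) (Ioo 0 T ×ˢ univ) ∧
      ContinuousOn (fun q : ℝ × M => relDensityDeriv g q.1 q.2) (Ioo 0 T ×ˢ univ) := by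
  have h0 : ∀ z : M, ContinuousOn (fun q : ℝ × (𝔼 n) => volDensity (g 0) z q.2)
      (Ioo 0 T ×ˢ (extChartAt (𝓡 n) z).target) := fun z =>
    ((hg.isRegular ⟨le_rfl, hT⟩).contDiffOn_volDensity z).continuousOn.comp
      continuousOn_snd fun q hq => hq.2
  have hne : ∀ z : M, ∀ q ∈ Ioo 0 T ×ˢ (extChartAt (𝓡 n) z).target,
      volDensity (g 0) z q.2 ≠ 0 := fun z q hq => (volDensity_pos _ hq.2).ne'
  constructor
  · refine continuousOn_prod_of_chart (n := n) (F := fun s y => relDensity (g 0) (g s) y) isOpen_Ioo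
      isOpen_univ fun z => ?_
    rw [preimage_univ, inter_univ]
    refine ((hg.contDiffOn_volDensity z).continuousOn.div (h0 z) (hne z)).congr fun q hq => ?_
    rw [relDensity_eq _ _ ((extChartAt (𝓡 n) z).map_target hq.2),
      (extChartAt (𝓡 n) z).right_inv hq.2]
    rfl
  · refine continuousOn_prod_of_chart (n := n) (F := relDensityDeriv g) isOpen_Ioo
      isOpen_univ fun z => ?_
    rw [preimage_univ, inter_univ]
    refine ((hg.continuousOn_deriv_volDensity z).div (h0 z) (hne z)).congr fun q hq => ?_
    rw [relDensityDeriv_eq _ _ ((extChartAt (𝓡 n) z).map_target hq.2),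
      (extChartAt (𝓡 n) z).right_inv hq.2]
    rfl

/-- The logarithmic derivative in time of the volume density. -/
def logDensityDeriv (g : ℝ → Metric n M) (t : ℝ) (y : M) : ℝ :=
  deriv (fun s => volDensity (g s) y (extChartAt (𝓡 n) y y)) t /
    volDensity (g t) y (extChartAt (𝓡 n) y y)

/-- Used to return from an integral against the volume of g(0) to one against that of g(t) after
differentiation. -/
theorem relDensityDeriv_eq_mul (g : ℝ → Metric n M) (t : ℝ) (y : M) :
    relDensityDeriv g t y = logDensityDeriv g t y * relDensity (g 0) (g t) y := by
  have h1 := (volDensity_pos (g t) (mem_extChartAt_target (I := 𝓡 n) y)).ne'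
  rw [relDensityDeriv_eq g t (mem_extChartAt_source y), logDensityDeriv, relDensity,
    div_mul_div_cancel₀ h1]

variable [MeasurableSpace M] [BorelSpace M] [T2Space M] [SigmaCompactSpace M]

theorem integral_vol_eq_relDensity {g g' : Metric n M} (hg : IsRegular g) (hg' : IsRegular g')
    (F : M → ℝ) : ∫ y, F y ∂(vol g') = ∫ y, F y * relDensity g g' y ∂(vol g) := by
  rw [vol_eq_withDensity hg hg', integral_withDensity_eq_integral_toReal_smul
    (continuous_relDensity hg hg').measurable.ennreal_ofReal (ae_of_all _ fun _ =>
      ENNReal.ofReal_lt_top)]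
  refine integral_congr_ae (ae_of_all _ fun y => ?_)
  simp only [ENNReal.toReal_ofReal (relDensity_pos g g' y).le, smul_eq_mul, mul_comm]

theorem ClassC21On.continuousOn {f : ℝ → M → ℝ} {B : Set M} (hB : IsOpen B)
    (hf : ClassC21On (n := n) f (Ioo 0 T) B) :
    ContinuousOn (fun q : ℝ × M => f q.1 q.2) (Ioo 0 T ×ˢ B) :=
  continuousOn_prod_of_chart isOpen_Ioo hB hf.cont

theorem ClassC21On.continuousOn_deriv {f : ℝ → M → ℝ} {B : Set M} (hB : IsOpen B)
    (hf : ClassC21On (n := n) f (Ioo 0 T) B) :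
    ContinuousOn (fun q : ℝ × M => deriv (fun s => f s q.2) q.1) (Ioo 0 T ×ˢ B) :=
  continuousOn_prod_of_chart (F := fun t y => deriv (fun s => f s y) t) isOpen_Ioo hB hf.time_cont

/-- The time derivative of a weighted integral of a power of `f`. -/
theorem hasDerivAt_integral_mul_rpow (hg : SmoothFamilyOn g (Ico 0 T)) {f : ℝ → M → ℝ} {B : Set M}
    (hB : IsOpen B) (hf : ClassC21On (n := n) f (Ioo 0 T) B) {ψ : M → ℝ} (hψ : Continuous ψ)
    (hψc : HasCompactSupport ψ) (hψB : tsupport ψ ⊆ B) {q : ℝ} (hq : 1 ≤ q) {t : ℝ}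
    (ht : t ∈ Ioo 0 T) :
    HasDerivAt (fun s => ∫ y, ψ y * f s y ^ q ∂(vol (g s)))
      (∫ y, ψ y * (q * f t y ^ (q - 1) * deriv (fun s => f s y) t +
        f t y ^ q * logDensityDeriv g t y) ∂(vol (g t))) t := by
  have : LocallyCompactSpace M := Manifold.locallyCompact_of_finiteDimensional (𝓡 n)
  have hT : 0 < T := ht.1.trans ht.2
  have h0 := hg.isRegular ⟨le_rfl, hT⟩
  have := isLocallyFinite_vol h0
  have hreg : ∀ s ∈ Ioo 0 T, IsRegular (g s) := fun s hs => hg.isRegular ⟨hs.1.le, hs.2⟩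
  have hK : IsCompact (tsupport ψ) := hψc
  -- The moving measure is replaced by the fixed measure of g(0) on the compact support of ψ, with
  -- the relative density in the integrand.
  have hres : ∀ s ∈ Ioo 0 T, ∀ H : M → ℝ, ∫ y, ψ y * H y ∂(vol (g s)) =
      ∫ y in tsupport ψ, ψ y * H y * relDensity (g 0) (g s) y ∂(vol (g 0)) := fun s hs H => by
    rw [integral_vol_eq_relDensity h0 (hreg s hs)]
    refine (setIntegral_eq_integral_of_forall_compl_eq_zero fun y hy => ?_).symm
    rw [image_eq_zero_of_notMem_tsupport hy]; simp
  have hsub : Ioo 0 T ×ˢ tsupport ψ ⊆ Ioo 0 T ×ˢ B := prod_mono subset_rfl hψB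
  have hsub' : Ioo 0 T ×ˢ tsupport ψ ⊆ Ioo 0 T ×ˢ univ := prod_mono subset_rfl (subset_univ _)
  have cf := (hf.continuousOn hB).mono hsub
  have cf' := (hf.continuousOn_deriv hB).mono hsub
  have cρ := (hg.continuousOn_relDensity hT).1.mono hsub'
  have cρ' := (hg.continuousOn_relDensity hT).2.mono hsub'
  have cψ : ContinuousOn (fun p : ℝ × M => ψ p.2) (Ioo 0 T ×ˢ tsupport ψ) :=
    (hψ.comp continuous_snd).continuousOn
  have cfq : ∀ q : ℝ, 0 ≤ q → ContinuousOn (fun p : ℝ × M => f p.1 p.2 ^ q)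
      (Ioo 0 T ×ˢ tsupport ψ) := fun q hq => cf.rpow_const fun _ _ => Or.inr hq
  have key := hasDerivAt_setIntegral_of_isCompact (μ := vol (g 0)) hK isOpen_Ioo
    (F := fun s y => ψ y * f s y ^ q * relDensity (g 0) (g s) y)
    (F' := fun s y => ψ y * ((deriv (fun s => f s y) s * q * f s y ^ (q - 1)) *
      relDensity (g 0) (g s) y + f s y ^ q * relDensityDeriv g s y))
    ((cψ.mul (cfq q (by linarith))).mul cρ)
    (cψ.mul ((((cf'.mul continuousOn_const).mul (cfq (q - 1) (by linarith))).mul cρ).add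
      ((cfq q (by linarith)).mul cρ'))) (fun s hs y hy => ?_) ht
  · refine (key.congr_of_eventuallyEq ?_).congr_deriv ?_
    · filter_upwards [isOpen_Ioo.mem_nhds ht] with s hs
      exact hres s hs _
    · rw [hres t ht]
      refine integral_congr_ae (ae_of_all _ fun y => ?_)
      simp only [relDensityDeriv_eq_mul]
      ring
  · have h1 := ((hf.time_diff y (hψB hy) s hs).hasDerivAt.rpow_const (p := q) (Or.inr hq)).mul
      (hg.hasDerivAt_relDensity hs y)
    have h2 := h1.const_mul (ψ y)
    refine h2.congr_of_eventuallyEq (Eventually.of_forall fun s => ?_)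
    simp only [Pi.mul_apply, mul_assoc]

end TimeDerivative

/-! ### Young and Hölder inequalities for the potential term. -/

section Interpolation

/-- A form of Young's inequality: the left side is at most max(a, ν)³. -/
theorem mul_sq_le_add_cube {a ν : ℝ} (ha : 0 ≤ a) (hν : 0 ≤ ν) : a * ν ^ 2 ≤ ν ^ 3 + a ^ 3 := by
  rcases le_total a ν with h | h
  · nlinarith [mul_le_mul_of_nonneg_right h (sq_nonneg ν), pow_nonneg ha 3]
  · nlinarith [mul_le_mul_of_nonneg_left (pow_le_pow_left₀ hν h 2) ha, pow_nonneg hν 3]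

/-- This is `mul_sq_le_add_cube` with ν = N^{1/6} A^{-1/3} and a = P m E^{1/3} A^{2/3}, scaled so
that ν³ is exactly the term N^{1/2}/A supplied by the Sobolev inequality. -/
theorem mul_le_add_of_le_rpow {I m E N A P : ℝ} (hm : 0 ≤ m) (hE : 0 ≤ E) (hN : 0 ≤ N)
    (hA : 0 < A) (hP : 0 ≤ P) (h : I ≤ m * (E ^ (1 / 3 : ℝ) * N ^ (1 / 3 : ℝ))) :
    P * I ≤ N ^ (1 / 2 : ℝ) / A + P ^ 3 * m ^ 3 * A ^ 2 * E := by
  have hpow : ∀ {x : ℝ}, 0 ≤ x → ∀ (a b : ℝ) (k : ℕ), a * k = b → (x ^ a) ^ k = x ^ b :=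
    fun hx a b k hab => by rw [← Real.rpow_natCast, ← Real.rpow_mul hx, hab]
  have e1 : (E ^ (1 / 3 : ℝ)) ^ 3 = E := by rw [hpow hE _ 1 3 (by norm_num), Real.rpow_one]
  have e2 : (A ^ (1 / 3 : ℝ)) ^ 3 = A := by rw [hpow hA.le _ 1 3 (by norm_num), Real.rpow_one]
  have e3 : (N ^ (1 / 6 : ℝ)) ^ 2 = N ^ (1 / 3 : ℝ) := hpow hN _ _ 2 (by norm_num)
  have e4 : (N ^ (1 / 6 : ℝ)) ^ 3 = N ^ (1 / 2 : ℝ) := hpow hN _ _ 3 (by norm_num)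
  set e := E ^ (1 / 3 : ℝ)
  set α := A ^ (1 / 3 : ℝ)
  set κ := N ^ (1 / 6 : ℝ)
  have he : 0 ≤ e := Real.rpow_nonneg hE _
  have hα : 0 < α := Real.rpow_pos_of_pos hA _
  have hκ : 0 ≤ κ := Real.rpow_nonneg hN _
  rw [← e3] at h
  rw [← e4, ← e2, ← e1]
  have key := mul_sq_le_add_cube (a := P * m * e * α ^ 2) (ν := κ / α) (by positivity)
    (by positivity)
  calc P * I ≤ P * (m * (e * κ ^ 2)) := mul_le_mul_of_nonneg_left h hP
    _ = P * m * e * α ^ 2 * (κ / α) ^ 2 := by field_simp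
    _ ≤ _ := key
    _ = _ := by rw [div_pow]; ring

/-- Hölder's inequality for `∫ u h²`. -/
theorem integrable_mul_sq_and_le {X : Type*} [MeasurableSpace X] {μ : Measure X} {u h : X → ℝ}
    (hu : AEMeasurable u μ) (hu0 : ∀ᵐ y ∂μ, 0 ≤ u y) (hh0 : ∀ᵐ y ∂μ, 0 ≤ h y)
    (hh : AEStronglyMeasurable h μ) (h3 : Integrable (fun y => h y ^ 3) μ) {m J : ℝ}
    (hm0 : 0 ≤ m) (hJ : ∫ y, h y ^ 3 ∂μ ≤ J)
    (hm : (∫⁻ y, ENNReal.ofReal (u y) ^ 3 ∂μ) ^ (1 / 3 : ℝ) ≤ ENNReal.ofReal m) :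
    Integrable (fun y => u y * h y ^ 2) μ ∧ ∫ y, u y * h y ^ 2 ∂μ ≤ m * J ^ (2 / 3 : ℝ) := by
  have hJ0 : 0 ≤ J := (integral_nonneg_of_ae (by
    filter_upwards [hh0] with y hy using pow_nonneg hy 3)).trans hJ
  have hpos : ∀ᵐ y ∂μ, 0 ≤ u y * h y ^ 2 := by
    filter_upwards [hu0] with y hy using mul_nonneg hy (sq_nonneg _)
  have hmeas : AEStronglyMeasurable (fun y => u y * h y ^ 2) μ :=
    hu.aestronglyMeasurable.mul (hh.pow 2)
  -- Hölder with exponents 3 and 3/2 is applied to extended nonnegative integrals, so that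
  -- integrability of u h² comes out together with the bound.
  have hL : ∫⁻ y, ENNReal.ofReal (u y * h y ^ 2) ∂μ ≤ ENNReal.ofReal (m * J ^ (2 / 3 : ℝ)) := by
    have h1 := ENNReal.lintegral_mul_le_Lp_mul_Lq μ
      (Real.holderConjugate_iff.2 (show (1 : ℝ) < 3 ∧ 3⁻¹ + (3 / 2)⁻¹ = (1 : ℝ) by norm_num))
      hu.ennreal_ofReal (hh.aemeasurable.pow_const 2).ennreal_ofReal
    have e1 : ∫⁻ y, ENNReal.ofReal (u y * h y ^ 2) ∂μ =
        ∫⁻ y, ((fun y => ENNReal.ofReal (u y)) * fun y => ENNReal.ofReal (h y ^ 2)) y ∂μ := by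
      refine lintegral_congr_ae ?_
      filter_upwards [hu0] with y hy
      rw [ENNReal.ofReal_mul hy]; rfl
    have e2 : ∫⁻ y, ENNReal.ofReal (u y) ^ (3 : ℝ) ∂μ = ∫⁻ y, ENNReal.ofReal (u y) ^ 3 ∂μ := by
      refine lintegral_congr fun y => ?_
      rw [← ENNReal.rpow_natCast]; norm_num
    have e3 : ∫⁻ y, ENNReal.ofReal (h y ^ 2) ^ (3 / 2 : ℝ) ∂μ = ENNReal.ofReal (∫ y, h y ^ 3 ∂μ) := by
      rw [ofReal_integral_eq_lintegral_ofReal h3 (by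
        filter_upwards [hh0] with y hy using pow_nonneg hy 3)]
      refine lintegral_congr_ae ?_
      filter_upwards [hh0] with y hy
      rw [ENNReal.ofReal_rpow_of_nonneg (sq_nonneg _) (by norm_num), ← Real.rpow_natCast,
        ← Real.rpow_mul hy, ← Real.rpow_natCast]
      norm_num
    rw [e1]
    refine h1.trans ?_
    rw [e2, e3, ENNReal.ofReal_mul hm0]
    refine mul_le_mul' hm ?_
    have h2 : (1 / (3 / 2) : ℝ) = 2 / 3 := by norm_num
    rw [h2, ENNReal.ofReal_rpow_of_nonneg (integral_nonneg_of_ae (by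
      filter_upwards [hh0] with y hy using pow_nonneg hy 3)) (by norm_num)]
    exact ENNReal.ofReal_le_ofReal (Real.rpow_le_rpow (integral_nonneg_of_ae (by
      filter_upwards [hh0] with y hy using pow_nonneg hy 3)) hJ (by norm_num))
  refine ⟨⟨hmeas, ?_⟩, ?_⟩
  · rw [hasFiniteIntegral_iff_ofReal hpos]
    exact hL.trans_lt ENNReal.ofReal_lt_top
  · rw [integral_eq_lintegral_of_nonneg_ae hpos hmeas]
    exact ENNReal.toReal_le_of_le_ofReal (by positivity) hL

/-- The Cauchy–Schwarz inequality `∫ h³ ≤ (∫ h²)^{1/2} (∫ h⁴)^{1/2}`. -/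
theorem integral_cube_le {X : Type*} [MeasurableSpace X] {μ : Measure X} {h : X → ℝ}
    (hh0 : ∀ᵐ y ∂μ, 0 ≤ h y) (h1 : MemLp h 2 μ) (h2 : MemLp (fun y => h y ^ 2) 2 μ) :
    ∫ y, h y ^ 3 ∂μ ≤ (∫ y, h y ^ 2 ∂μ) ^ (1 / 2 : ℝ) * (∫ y, h y ^ 4 ∂μ) ^ (1 / 2 : ℝ) := by
  have key := integral_mul_le_Lp_mul_Lq_of_nonneg (μ := μ)
    (Real.holderConjugate_iff.2 (show (1 : ℝ) < 2 ∧ 2⁻¹ + 2⁻¹ = (1 : ℝ) by norm_num))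
    hh0 (ae_of_all μ fun y => sq_nonneg (h y)) (by simpa using h1) (by simpa using h2)
  have e1 : ∀ y, h y * h y ^ 2 = h y ^ 3 := fun y => by ring
  have e2 : ∀ y, h y ^ (2 : ℝ) = h y ^ 2 := fun y => by
    rw [← Real.rpow_natCast]; norm_num
  have e3 : ∀ y, (h y ^ 2) ^ (2 : ℝ) = h y ^ 4 := fun y => by
    rw [show (2 : ℝ) = (2 : ℕ) by norm_num, Real.rpow_natCast, ← pow_mul]
  simpa only [e1, e2, e3] using key

end Interpolation

/-! ### The pointwise energy inequality. -/

section Energy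

variable {n : ℕ} {M : Type*} [TopologicalSpace M] [ChartedSpace (EuclideanSpace ℝ (Fin n)) M]
  [IsManifold (𝓡 n) ∞ M]

theorem ClassC21On.contMDiffOn {f : ℝ → M → ℝ} {J : Set ℝ} {B : Set M} (hB : IsOpen B)
    (hf : ClassC21On (n := n) f J B) {t : ℝ} (ht : t ∈ J) :
    ContMDiffOn (𝓡 n) 𝓘(ℝ, ℝ) (2 : ℕ∞) (f t) B :=
  contMDiffOn_of_chart hB fun z => by exact_mod_cast hf.space_diff z t ht

theorem contMDiffOn_rpow {f : M → ℝ} {B : Set M}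
    (hf : ContMDiffOn (𝓡 n) 𝓘(ℝ, ℝ) (2 : ℕ∞) f B) {q : ℝ} (hq : 1 ≤ q) :
    ContMDiffOn (𝓡 n) 𝓘(ℝ, ℝ) (1 : ℕ∞) (fun y => f y ^ q) B := by
  have h1 : ContDiff ℝ (1 : ℕ) fun x : ℝ => x ^ q := Real.contDiff_rpow_const_of_le (by simpa)
  have h2 : ContMDiff 𝓘(ℝ, ℝ) 𝓘(ℝ, ℝ) (1 : ℕ∞) fun x : ℝ => x ^ q := by
    exact_mod_cast h1.contMDiff
  exact h2.comp_contMDiffOn (hf.of_le (by norm_num))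

/-- The pointwise inequality behind the energy estimate. -/
theorem neg_gradInner_rpow_le (g : Metric n M) {f φ : M → ℝ} {y : M} {q : ℝ} (hq : 2 < q)
    (hf : MDifferentiableAt (𝓡 n) 𝓘(ℝ, ℝ) f y) (hφ : MDifferentiableAt (𝓡 n) 𝓘(ℝ, ℝ) φ y)
    (h0 : 0 ≤ f y) :
    -(q * gradInner g (fun y => φ y * φ y * f y ^ (q - 1)) f y) ≤
      -2 * gradNormSq g (fun y => φ y * f y ^ (q / 2)) y + 2 * (f y ^ q * gradNormSq g φ y) := by
  have hys := mem_extChartAt_source (I := 𝓡 n) y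
  have hyt := mem_extChartAt_target (I := 𝓡 n) y
  -- All powers of f are expressed by s and f. The exponents occurring are nonnegative because q >
  -- 2, so the identities also hold where f = 0.
  set s := f y ^ (q / 2 - 1) with hs
  have hd : ∀ {r : ℝ}, 1 ≤ r → HasDerivAt (fun x : ℝ => x ^ r) (r * f y ^ (r - 1)) (f y) :=
    fun hr => Real.hasDerivAt_rpow_const (Or.inr hr)
  have hrp : ∀ {r : ℝ}, 1 ≤ r → MDifferentiableAt (𝓡 n) 𝓘(ℝ, ℝ) (fun y => f y ^ r) y := fun hr =>
    (hd hr).differentiableAt.mdifferentiableAt.comp y hf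
  have p1 : f y ^ (q / 2) = s * f y := by
    rw [hs]; nth_rewrite 3 [← Real.rpow_one (f y)]
    rw [← Real.rpow_add_of_nonneg h0 (by linarith) zero_le_one]; ring_nf
  have p2 : f y ^ (q - 1 - 1) = s * s := by
    rw [hs, ← Real.rpow_add_of_nonneg h0 (by linarith) (by linarith)]; ring_nf
  have p3 : f y ^ (q - 1) = s * s * f y := by
    rw [← p2]; nth_rewrite 3 [← Real.rpow_one (f y)]
    rw [← Real.rpow_add_of_nonneg h0 (by linarith) zero_le_one]; ring_nf
  have p4 : f y ^ q = (s * f y) * (s * f y) := by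
    rw [← p1, ← Real.rpow_add_of_nonneg h0 (by linarith) (by linarith)]; ring_nf
  set p := extChartAt (𝓡 n) y y with hp
  set α := dcoord y φ p with hα
  set β := dcoord y f p with hβ
  have d1 : dcoord y (fun y => φ y * φ y * f y ^ (q - 1)) p =
      (φ y * φ y) • (((q - 1) * (s * s)) • β) + (s * s * f y) • (φ y • α + φ y • α) := by
    rw [dcoord_mul (φ := fun y => φ y * φ y) (ψ := fun y => f y ^ (q - 1)) hys (hφ.mul hφ)
      (hrp (by linarith)), dcoord_mul hys hφ hφ,
      dcoord_comp hys hf (hd (by linarith)), p2, p3]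
  have d2 : dcoord y (fun y => φ y * f y ^ (q / 2)) p =
      φ y • ((q / 2 * s) • β) + (s * f y) • α := by
    rw [dcoord_mul hys hφ (hrp (by linarith)), dcoord_comp hys hf (hd (by linarith)), p1, hs]
  have hb : 0 ≤ coinner g y p β β := coinner_self_nonneg g hyt β
  rw [gradNormSq_eq, gradNormSq_eq]
  simp only [gradInner, gradInnerIn, ← hp]
  rw [d1, d2, p4, ← hα, ← hβ]
  simp only [coinner_add_left, coinner_add_right, coinner_smul_left, coinner_smul_right,
    coinner_comm g hyt β α]
  -- The mixed terms ⟨∇φ, ∇f⟩ cancel exactly, and so do the terms |∇φ|²; the difference of the two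
  -- sides is half of this quantity.
  have hk : 0 ≤ (s * φ y) ^ 2 * coinner g y p β β * (q * (q - 2)) :=
    mul_nonneg (mul_nonneg (sq_nonneg _) hb) (mul_nonneg (by linarith) (by linarith))
  nlinarith

end Energy

/-! ### The energy inequality at a fixed time. -/

section EnergyInequality

variable {n : ℕ} {M : Type*} [TopologicalSpace M] [ChartedSpace (EuclideanSpace ℝ (Fin n)) M]
  [IsManifold (𝓡 n) ∞ M]

theorem rpow_half_pow {a x q : ℝ} (ha : 0 ≤ a) :
    (x * a ^ (q / 2)) ^ 2 = x * x * a ^ q ∧ (x * a ^ (q / 2)) ^ 3 = x ^ 3 * a ^ (3 / 2 * q) ∧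
      (x * a ^ (q / 2)) ^ 4 = x ^ 4 * a ^ (2 * q) := by
  refine ⟨?_, ?_, ?_⟩ <;> rw [mul_pow, ← Real.rpow_natCast (a ^ (q / 2)), ← Real.rpow_mul ha]
  · rw [sq]; congr 2; push_cast; ring
  · congr 2; push_cast; ring
  · congr 2; push_cast; ring

variable [T2Space M] [SigmaCompactSpace M] [MeasurableSpace M] [BorelSpace M]

theorem integrable_of_tsupport_subset {g : Metric n M} (hg : IsRegular g) {B : Set M}
    (hB : IsOpen B) {F φ : M → ℝ} (hF : ContinuousOn F B) (hφ : HasCompactSupport φ)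
    (hφB : tsupport φ ⊆ B) (h : ∀ y ∉ tsupport φ, F y = 0) :
    Continuous F ∧ HasCompactSupport F ∧ Integrable F (vol g) := by
  have : LocallyCompactSpace M := Manifold.locallyCompact_of_finiteDimensional (𝓡 n)
  have := isLocallyFinite_vol hg
  have hs := tsupport_subset_of_forall_notMem h
  have hc := continuous_of_continuousOn_tsupport hB hF (hs.trans hφB)
  have hcs : HasCompactSupport F := hφ.of_isClosed_subset (isClosed_tsupport _) hs
  exact ⟨hc, hcs, hc.integrable_of_hasCompactSupport hcs⟩

/-- For q close to 2 the power f^{q/2} may be no better than C¹ at zeros of f, which is why the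
Sobolev inequality was extended to C¹ functions. -/
theorem IsTest.mul_rpow {f φ : M → ℝ} {B : Set M} (hB : IsOpen B) (hφ : IsTest n ⊤ B φ)
    (hf : ContMDiffOn (𝓡 n) 𝓘(ℝ, ℝ) (2 : ℕ∞) f B) {q : ℝ} (hq : 2 < q) :
    IsTest n 1 B fun y => φ y * f y ^ (q / 2) :=
  (hφ.mono le_top subset_rfl).mul hB (contMDiffOn_rpow hf (by linarith))

/-- The energy estimate at a fixed time. -/
theorem integral_laplacian_add_le {g : Metric n M} (hg : IsRegular g) {B : Set M} (hB : IsOpen B)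
    {A : ℝ} (hA : 0 < A) (hS : SobolevOn g B A) {f u φ : M → ℝ}
    (hf : ContMDiffOn (𝓡 n) 𝓘(ℝ, ℝ) (2 : ℕ∞) f B) (hf0 : ∀ y ∈ B, 0 ≤ f y)
    (hu0 : ∀ y ∈ B, 0 ≤ u y) (hu : AEMeasurable u ((vol g).restrict B)) {m : ℝ} (hm0 : 0 ≤ m)
    (hm : (∫⁻ y in B, ENNReal.ofReal (u y) ^ 3 ∂(vol g)) ^ (1 / 3 : ℝ) ≤ ENNReal.ofReal m)
    (hφ : IsTest n ⊤ B φ) (hφ0 : ∀ y, 0 ≤ φ y) {q P : ℝ} (hq : 2 < q) (hP : 0 ≤ P) :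
    IntegrableOn (fun y => u y * (φ y * f y ^ (q / 2)) ^ 2) B (vol g) ∧
    q * ∫ y, φ y * φ y * f y ^ (q - 1) * laplacian g f y ∂(vol g) +
      P * ∫ y in B, u y * (φ y * f y ^ (q / 2)) ^ 2 ∂(vol g) +
      (∫ y in B, (φ y * f y ^ (q / 2)) ^ 4 ∂(vol g)) ^ (1 / 2 : ℝ) / A ≤
    2 * ∫ y, f y ^ q * gradNormSq g φ y ∂(vol g) +
      P ^ 3 * m ^ 3 * A ^ 2 * ∫ y in B, (φ y * f y ^ (q / 2)) ^ 2 ∂(vol g) := by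
  have : LocallyCompactSpace M := Manifold.locallyCompact_of_finiteDimensional (𝓡 n)
  have := isLocallyFinite_vol hg
  have hφ1 : IsTest n 1 B φ := hφ.mono le_top subset_rfl
  have hh := hφ.mul_rpow hB hf hq
  have hψ : IsTest n 1 B fun y => φ y * φ y * f y ^ (q - 1) :=
    (hφ1.mul hB hφ1.smooth.contMDiffOn).mul hB (contMDiffOn_rpow hf (by linarith))
  have hf1 : ContMDiffOn (𝓡 n) 𝓘(ℝ, ℝ) (1 : ℕ∞) f B := hf.of_le (by norm_num)
  have c1 := hψ.continuous_gradInner hg hB hf1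
  have c2 := hh.continuous_gradInner hg hB hh.smooth.contMDiffOn
  have c3 := hφ1.continuous_gradInner hg hB hφ1.smooth.contMDiffOn
  have i1 := c1.1.integrable_of_hasCompactSupport (μ := vol g)
    (hψ.compact.of_isClosed_subset (isClosed_tsupport _) c1.2)
  have i2 : Integrable (gradNormSq g fun y => φ y * f y ^ (q / 2)) (vol g) := by
    have := c2.1.integrable_of_hasCompactSupport (μ := vol g)
      (hh.compact.of_isClosed_subset (isClosed_tsupport _) c2.2)
    exact this.congr (ae_of_all _ fun y => (gradNormSq_eq g _ y).symm)
  have i3 : Integrable (fun y => f y ^ q * gradNormSq g φ y) (vol g) := by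
    refine (integrable_of_tsupport_subset hg hB (φ := φ) ?_ hφ.compact hφ.subset fun y hy => by
      rw [gradNormSq_eq_zero g hy, mul_zero]).2.2
    exact (hf.continuousOn.rpow_const fun _ _ => Or.inr (by linarith)).mul
      ((c3.1.continuousOn (s := B)).congr fun y _ => gradNormSq_eq g _ y)
  have hgreen := integral_mul_laplacian hg hB hf hψ
  have hmain : -(q * ∫ y, gradInner g (fun y => φ y * φ y * f y ^ (q - 1)) f y ∂(vol g)) ≤
      -2 * ∫ y, gradNormSq g (fun y => φ y * f y ^ (q / 2)) y ∂(vol g) +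
        2 * ∫ y, f y ^ q * gradNormSq g φ y ∂(vol g) := by
    rw [← integral_const_mul, ← integral_const_mul, ← integral_const_mul, ← integral_neg,
      ← integral_add (i2.const_mul _) (i3.const_mul _)]
    refine integral_mono (i1.const_mul q).neg ((i2.const_mul _).add (i3.const_mul _)) fun y => ?_
    by_cases hy : y ∈ tsupport φ
    · exact neg_gradInner_rpow_le g hq (ContMDiffOn.mdifferentiableAt_of_isOpen hB le_rfl hf1
        (hφ.subset hy)) (hφ1.mdifferentiableAt le_rfl y) (hf0 y (hφ.subset hy))
    · have h1 : y ∉ tsupport fun y => φ y * φ y * f y ^ (q - 1) := fun h => hy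
        (tsupport_mul_subset_left (tsupport_mul_subset_left (f := fun y => φ y * φ y) h))
      have h2 : y ∉ tsupport fun y => φ y * f y ^ (q / 2) := fun h => hy
        (tsupport_mul_subset_left h)
      simp [gradInner_eq_zero_left g h1, gradNormSq_eq_zero g h2, gradNormSq_eq_zero g hy]
  have hsob := hS.isTest hg hB hh
  rw [setIntegral_eq_integral_of_forall_compl_eq_zero (f := gradNormSq g fun y =>
    φ y * f y ^ (q / 2)) fun y hy => gradNormSq_eq_zero g fun h => hy (hh.subset h)] at hsob
  have hh0 : ∀ᵐ y ∂((vol g).restrict B), 0 ≤ φ y * f y ^ (q / 2) := by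
    filter_upwards [ae_restrict_mem hB.measurableSet] with y hy
    exact mul_nonneg (hφ0 y) (Real.rpow_nonneg (hf0 y hy) _)
  have hhc := hh.smooth.continuous
  have hpowc : ∀ k : ℕ, k ≠ 0 → HasCompactSupport fun y => (φ y * f y ^ (q / 2)) ^ k := fun k hk =>
    hh.compact.of_isClosed_subset (isClosed_tsupport _) (tsupport_subset_of_forall_notMem
      fun y hy => by
        have := image_eq_zero_of_notMem_tsupport hy
        simp only [this, ne_eq, hk, not_false_eq_true, zero_pow])
  have hJ := integral_cube_le hh0 ((hhc.memLp_of_hasCompactSupport hh.compact).restrict B)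
    (((hhc.pow 2).memLp_of_hasCompactSupport (hpowc 2 two_ne_zero)).restrict B)
  obtain ⟨hint, hhol⟩ := integrable_mul_sq_and_le hu
    ((ae_restrict_mem hB.measurableSet).mono hu0) hh0 hhc.aestronglyMeasurable
    ((hhc.pow 3).integrable_of_hasCompactSupport (hpowc 3 three_ne_zero)).restrict hm0 hJ hm
  have hE : 0 ≤ ∫ y in B, (φ y * f y ^ (q / 2)) ^ 2 ∂(vol g) := integral_nonneg fun y => sq_nonneg _
  have hN : 0 ≤ ∫ y in B, (φ y * f y ^ (q / 2)) ^ 4 ∂(vol g) := integral_nonneg fun y =>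
    (even_two_mul 2).pow_nonneg _
  refine ⟨hint, ?_⟩
  rw [Real.mul_rpow (Real.rpow_nonneg hE _) (Real.rpow_nonneg hN _), ← Real.rpow_mul hE,
    ← Real.rpow_mul hN, show (1 / 2 * (2 / 3) : ℝ) = 1 / 3 by norm_num] at hhol
  have hyoung := mul_le_add_of_le_rpow hm0 hE hN hA hP hhol
  -- Two copies of the gradient integral are available: one cancels the term N^{1/2}/A of Young's
  -- inequality, the other yields the term kept on the left.
  have hD : (∫ y in B, (φ y * f y ^ (q / 2)) ^ 4 ∂(vol g)) ^ (1 / 2 : ℝ) / A ≤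
      ∫ y, gradNormSq g (fun y => φ y * f y ^ (q / 2)) y ∂(vol g) := by
    rw [div_le_iff₀ hA, mul_comm]; exact hsob
  have hq2 : q * ∫ y, φ y * φ y * f y ^ (q - 1) * laplacian g f y ∂(vol g) =
      -(q * ∫ y, gradInner g (fun y => φ y * φ y * f y ^ (q - 1)) f y ∂(vol g)) := by
    rw [hgreen]; ring
  rw [hq2]
  linarith

end EnergyInequality

/-! ### Subsolutions and the differential energy inequality. -/

section Subsolution

variable {n : ℕ} {M : Type*} [TopologicalSpace M] [ChartedSpace (EuclideanSpace ℝ (Fin n)) M]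
  [IsManifold (𝓡 n) ∞ M] [MeasurableSpace M] [BorelSpace M] [T2Space M] [SigmaCompactSpace M]

/-- Nonnegative subsolutions of `∂_t f = Δ f + u f` on `B × (0, T)`, for an evolving metric with
a uniform Sobolev inequality, volume growth at most `c u`, and `u` bounded in `L³`. -/
structure IsSubsolution (g : ℝ → Metric n M) (B : Set M) (T c A μ : ℝ) (f u : ℝ → M → ℝ) :
    Prop where
  isOpen : IsOpen B
  smooth : SmoothFamilyOn g (Ico 0 T)
  A_pos : 0 < A
  μ_nonneg : 0 ≤ μ
  sobolev : ∀ t ∈ Ico 0 T, SobolevOn (g t) B A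
  nonneg : ∀ t ∈ Ioo 0 T, ∀ y ∈ B, 0 ≤ f t y ∧ 0 ≤ u t y
  regular : ClassC21On (n := n) f (Ioo 0 T) B
  measurable : ∀ t ∈ Ioo 0 T, AEMeasurable (u t) ((vol (g t)).restrict B)
  deriv_le : ∀ t ∈ Ioo 0 T, ∀ y ∈ B,
    deriv (fun s => f s y) t ≤ laplacian (g t) (f t) y + u t y * f t y
  deriv_vol_le : ∀ t ∈ Ioo 0 T, ∀ y ∈ B,
    deriv (fun s => volDensity (g s) y (extChartAt (𝓡 n) y y)) t ≤
      c * u t y * volDensity (g t) y (extChartAt (𝓡 n) y y)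
  norm_le : ∀ t ∈ Ioo 0 T, (∫⁻ y in B, ENNReal.ofReal (u t y) ^ 3 ∂(vol (g t))) ^ (1 / 3 : ℝ) ≤
    ENNReal.ofReal (μ * t ^ (-1 / 3 : ℝ))

variable {g : ℝ → Metric n M} {B : Set M} {T c A μ : ℝ} {f u : ℝ → M → ℝ}

theorem IsSubsolution.isRegular (h : IsSubsolution g B T c A μ f u) {t : ℝ} (ht : t ∈ Ioo 0 T) :
    IsRegular (g t) := h.smooth.isRegular ⟨ht.1.le, ht.2⟩

/-- The definition uses the chart at each point, so continuity is read off from the chart-free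
quotient of `relDensityDeriv` by `relDensity`. -/
theorem SmoothFamilyOn.continuous_logDensityDeriv (hg : SmoothFamilyOn g (Ico 0 T)) {t : ℝ}
    (ht : t ∈ Ioo 0 T) : Continuous (logDensityDeriv g t) := by
  have hT := ht.1.trans ht.2
  have h1 : ∀ {H : ℝ → M → ℝ}, ContinuousOn (fun q : ℝ × M => H q.1 q.2) (Ioo 0 T ×ˢ univ) →
      Continuous (H t) := fun hH =>
    hH.comp_continuous (continuous_const.prodMk continuous_id) fun y => ⟨ht, mem_univ y⟩
  refine ((h1 (hg.continuousOn_relDensity hT).2).div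
    (h1 (H := fun s y => relDensity (g 0) (g s) y) (hg.continuousOn_relDensity hT).1)
    fun y => (relDensity_pos _ _ y).ne').congr fun y => ?_
  rw [Pi.div_apply, relDensityDeriv_eq_mul, mul_div_cancel_right₀ _ (relDensity_pos _ _ y).ne']

theorem IsSubsolution.integrable_mul_rpow (h : IsSubsolution g B T c A μ f u) {ψ : M → ℝ}
    (hψ : Continuous ψ) (hψc : HasCompactSupport ψ) (hψB : tsupport ψ ⊆ B) {q : ℝ} (hq : 0 ≤ q)
    {t : ℝ} (ht : t ∈ Ioo 0 T) :
    Integrable (fun y => ψ y * f t y ^ q) (vol (g t)) := by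
  refine (integrable_of_tsupport_subset (h.isRegular ht) h.isOpen ?_ hψc hψB fun y hy => by
    rw [image_eq_zero_of_notMem_tsupport hy, zero_mul]).2.2
  exact hψ.continuousOn.mul ((h.regular.contMDiffOn h.isOpen ht).continuousOn.rpow_const
    fun _ _ => Or.inr hq)

/-- The energy inequality. -/
theorem IsSubsolution.exists_hasDerivAt (h : IsSubsolution g B T c A μ f u) {φ : M → ℝ}
    (hφ : IsTest n ⊤ B φ) (hφ0 : ∀ y, 0 ≤ φ y) {q : ℝ} (hq : 2 < q) {t : ℝ} (ht : t ∈ Ioo 0 T) :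
    ∃ e', HasDerivAt (fun s => ∫ y, φ y * φ y * f s y ^ q ∂(vol (g s))) e' t ∧
      e' + (∫ y, φ y ^ 4 * f t y ^ (2 * q) ∂(vol (g t))) ^ (1 / 2 : ℝ) / A ≤
        2 * ∫ y, f t y ^ q * gradNormSq (g t) φ y ∂(vol (g t)) +
        (q + max c 0) ^ 3 * (μ ^ 3 / t) * A ^ 2 * ∫ y, φ y * φ y * f t y ^ q ∂(vol (g t)) := by
  have hφ1 : IsTest n 1 B φ := hφ.mono le_top subset_rfl
  have hφφ : IsTest n 1 B fun y => φ y * φ y := hφ1.mul h.isOpen hφ1.smooth.contMDiffOn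
  have hf := h.regular.contMDiffOn h.isOpen ht
  have hf0 := fun y hy => (h.nonneg t ht y hy).1
  have hu0 := fun y hy => (h.nonneg t ht y hy).2
  -- The decay t^{-1/3} is the one whose cube is the scale-invariant weight 1/t.
  have ht3 : (μ * t ^ (-1 / 3 : ℝ)) ^ 3 = μ ^ 3 / t := by
    rw [mul_pow, ← Real.rpow_natCast (t ^ _), ← Real.rpow_mul ht.1.le]
    norm_num [Real.rpow_neg_one, div_eq_mul_inv]
  have hd := hasDerivAt_integral_mul_rpow h.smooth h.isOpen h.regular hφφ.smooth.continuous
    hφφ.compact hφφ.subset (q := q) (by linarith) ht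
  refine ⟨_, hd, ?_⟩
  -- In P, the summand q comes from the reaction term u f and max c 0 from the change of volume; the
  -- maximum keeps P nonnegative when c < 0.
  obtain ⟨hint, hstat⟩ := integral_laplacian_add_le (h.isRegular ht) h.isOpen h.A_pos
    (h.sobolev t ⟨ht.1.le, ht.2⟩) hf hf0 hu0 (h.measurable t ht)
    (mul_nonneg h.μ_nonneg (Real.rpow_nonneg ht.1.le _)) (h.norm_le t ht) hφ hφ0 hq
    (P := q + max c 0) (by linarith [le_max_right c 0])
  have hset : ∀ {F : M → ℝ} {k : ℕ} {a : ℝ}, k ≠ 0 →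
      (∀ y, 0 ≤ f t y → F y = φ y ^ k * f t y ^ a) →
      (∀ y, φ y = 0 → F y = 0) → ∫ y in B, F y ∂(vol (g t)) =
        ∫ y, φ y ^ k * f t y ^ a ∂(vol (g t)) := fun {F k a} hk h1 h2 => by
    rw [setIntegral_congr_fun h.isOpen.measurableSet fun y hy => h1 y (hf0 y hy)]
    refine setIntegral_eq_integral_of_forall_compl_eq_zero fun y hy => ?_
    rw [image_eq_zero_of_notMem_tsupport fun h' => hy (hφ.subset h'), zero_pow hk, zero_mul]
  rw [hset (F := fun y => (φ y * f t y ^ (q / 2)) ^ 4) (k := 4) (a := 2 * q) (by norm_num) (fun y hy => (rpow_half_pow hy).2.2)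
      (fun y hy => by rw [hy]; simp),
    hset (F := fun y => (φ y * f t y ^ (q / 2)) ^ 2) (k := 2) (a := q) (by norm_num) (fun y hy => by rw [(rpow_half_pow hy).1, sq])
      (fun y hy => by rw [hy]; simp), ht3] at hstat
  simp only [sq (φ _)] at hstat
  have hle : ∫ y, φ y * φ y * (q * f t y ^ (q - 1) * deriv (fun s => f s y) t +
      f t y ^ q * logDensityDeriv g t y) ∂(vol (g t)) ≤
      q * ∫ y, φ y * φ y * f t y ^ (q - 1) * laplacian (g t) (f t) y ∂(vol (g t)) +
      (q + max c 0) * ∫ y in B, u t y * (φ y * f t y ^ (q / 2)) ^ 2 ∂(vol (g t)) := by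
    have hsupp : ∀ (a : ℝ) {y}, y ∉ tsupport (fun y => φ y * φ y) → φ y * φ y * a = 0 :=
      fun a {y} hy => by rw [image_eq_zero_of_notMem_tsupport (f := fun y => φ y * φ y) hy, zero_mul]
    have cq : ∀ r : ℝ, 0 ≤ r → ContinuousOn (fun y => f t y ^ r) B := fun r hr =>
      hf.continuousOn.rpow_const fun _ _ => Or.inr hr
    have cd : ContinuousOn (fun y => deriv (fun s => f s y) t) B :=
      (h.regular.continuousOn_deriv h.isOpen).comp
        (continuous_const.prodMk continuous_id).continuousOn fun y hy => ⟨ht, hy⟩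
    have i1 := (integrable_of_tsupport_subset (h.isRegular ht) h.isOpen (φ := fun y => φ y * φ y)
      (F := fun y => φ y * φ y * (q * f t y ^ (q - 1) * deriv (fun s => f s y) t +
        f t y ^ q * logDensityDeriv g t y))
      (hφφ.smooth.continuous.continuousOn.mul (((continuousOn_const.mul
        (cq (q - 1) (by linarith))).mul cd).add ((cq q (by linarith)).mul
        (h.smooth.continuous_logDensityDeriv ht).continuousOn)))
      hφφ.compact hφφ.subset fun y hy => hsupp _ hy).2.2
    have i2 := (integrable_of_tsupport_subset (h.isRegular ht) h.isOpen (φ := fun y => φ y * φ y)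
      (F := fun y => φ y * φ y * f t y ^ (q - 1) * laplacian (g t) (f t) y)
      ((hφφ.smooth.continuous.continuousOn.mul (cq (q - 1) (by linarith))).mul
        (continuousOn_laplacian (h.isRegular ht) h.isOpen hf))
      hφφ.compact hφφ.subset fun y hy => by rw [mul_assoc, hsupp _ hy]).2.2
    have e1 : ∀ {F : M → ℝ}, (∀ y, φ y = 0 → F y = 0) → ∫ y, F y ∂(vol (g t)) =
        ∫ y in B, F y ∂(vol (g t)) := fun hF =>
      (setIntegral_eq_integral_of_forall_compl_eq_zero fun y hy => hF y
        (image_eq_zero_of_notMem_tsupport fun h' => hy (hφ.subset h'))).symm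
    rw [e1 fun y hy => by simp [hy], e1 (F := fun y => φ y * φ y * f t y ^ (q - 1) *
      laplacian (g t) (f t) y) fun y hy => by simp [hy], ← integral_const_mul,
      ← integral_const_mul, ← integral_add (i2.restrict.const_mul q)
        (hint.const_mul _)]
    refine integral_mono_ae i1.restrict ((i2.restrict.const_mul q).add (hint.const_mul _)) ?_
    filter_upwards [ae_restrict_mem h.isOpen.measurableSet] with y hy
    have hfy := hf0 y hy
    have huy := hu0 y hy
    have hfq : f t y ^ (q - 1) * f t y = f t y ^ q := by
      nth_rewrite 2 [← Real.rpow_one (f t y)]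
      rw [← Real.rpow_add_of_nonneg hfy (by linarith) zero_le_one]; ring_nf
    have hl : logDensityDeriv g t y ≤ max c 0 * u t y := by
      have hv := volDensity_pos (g t) (mem_extChartAt_target (I := 𝓡 n) y)
      rw [logDensityDeriv, div_le_iff₀ hv]
      refine (h.deriv_vol_le t ht y hy).trans (mul_le_mul_of_nonneg_right ?_ hv.le)
      exact mul_le_mul_of_nonneg_right (le_max_left _ _) huy
    have hq1 : 0 ≤ q * f t y ^ (q - 1) := mul_nonneg (by linarith) (Real.rpow_nonneg hfy _)
    have hq2 := Real.rpow_nonneg hfy q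
    show φ y * φ y * _ ≤ q * (φ y * φ y * f t y ^ (q - 1) * laplacian (g t) (f t) y) +
      (q + max c 0) * (u t y * (φ y * f t y ^ (q / 2)) ^ 2)
    rw [(rpow_half_pow hfy).1]
    calc φ y * φ y * (q * f t y ^ (q - 1) * deriv (fun s => f s y) t +
          f t y ^ q * logDensityDeriv g t y)
        ≤ φ y * φ y * (q * f t y ^ (q - 1) * (laplacian (g t) (f t) y + u t y * f t y) +
          f t y ^ q * (max c 0 * u t y)) := by
          refine mul_le_mul_of_nonneg_left (add_le_add ?_ ?_) (mul_self_nonneg _)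
          · exact mul_le_mul_of_nonneg_left (h.deriv_le t ht y hy) hq1
          · exact mul_le_mul_of_nonneg_left hl hq2
      _ = _ := by rw [← hfq]; ring
  linarith

end Subsolution

/-! ### The Moser iteration for functions of time and sequences. -/

section MoserIteration

/-- One step of the Moser iteration. -/
theorem moser_step {τ τ' t A Λ : ℝ} (hτ : τ < τ') (hτ' : τ' ≤ t) (hA : 0 < A) (hΛ : 0 ≤ Λ)
    {e y ν z : ℝ → ℝ} (hy : ContinuousOn y (Icc τ t)) (hν : ContinuousOn ν (Icc τ t))
    (hz : ContinuousOn z (Icc τ t)) (he0 : ∀ s ∈ Icc τ t, 0 ≤ e s)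
    (hey : ∀ s ∈ Icc τ t, e s ≤ y s) (hν0 : ∀ s ∈ Icc τ t, 0 ≤ ν s)
    (hd : ∀ s ∈ Icc τ t, ∃ e', HasDerivAt e e' s ∧ e' + ν s / A ≤ Λ * y s)
    (hze : ∀ s ∈ Icc τ t, z s ≤ e s ^ (1 / 2 : ℝ) * ν s) :
    ∫ s in τ'..t, z s ≤ A * ((1 / (τ' - τ) + Λ) * ∫ s in τ..t, y s) ^ (3 / 2 : ℝ) := by
  have hy0 : ∀ s ∈ Icc τ t, 0 ≤ y s := fun s hs => (he0 s hs).trans (hey s hs)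
  have hii : ∀ {F : ℝ → ℝ}, ContinuousOn F (Icc τ t) → ∀ {a b}, τ ≤ a → a ≤ b → b ≤ t →
      IntervalIntegrable F volume a b := fun hF a b h1 h2 h3 =>
    (hF.mono (by rw [uIcc_of_le h2]; exact Icc_subset_Icc h1 h3)).intervalIntegrable
  have hmono : ∀ {F : ℝ → ℝ}, ContinuousOn F (Icc τ t) → (∀ s ∈ Icc τ t, 0 ≤ F s) →
      ∀ {a b a' b'}, τ ≤ a → a ≤ a' → a' ≤ b' → b' ≤ b → b ≤ t →
      ∫ s in a'..b', F s ≤ ∫ s in a..b, F s := fun {F} hF h0 {a b a' b'} h1 h2 h3 h4 h5 => by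
    refine intervalIntegral.integral_mono_interval h2 h3 h4 ?_
      (hii hF h1 (h2.trans (h3.trans h4)) h5)
    filter_upwards [ae_restrict_mem measurableSet_Ioc] with s hs
    exact h0 s ⟨h1.trans hs.1.le, hs.2.trans h5⟩
  obtain ⟨e', he'⟩ : ∃ e' : ℝ → ℝ, ∀ s ∈ Icc τ t, HasDerivAt e (e' s) s ∧
      e' s + ν s / A ≤ Λ * y s := by
    choose! e' he' using hd
    exact ⟨e', he'⟩
  set Y := ∫ s in τ..t, y s with hY
  set Q := (1 / (τ' - τ) + Λ) * Y with hQ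
  have hττ : 0 < τ' - τ := sub_pos.2 hτ
  -- Instead of a cutoff in time, a good starting time σ in [τ, τ'] is used: the minimum of y there
  -- is at most its mean, which gives the term 1/(τ' - τ).
  obtain ⟨σ, hσ, hσmin⟩ := isCompact_Icc.exists_isMinOn (nonempty_Icc.2 hτ.le)
    (hy.mono (Icc_subset_Icc_right hτ'))
  have hyσ : y σ ≤ 1 / (τ' - τ) * Y := by
    have h1 : (τ' - τ) * y σ ≤ ∫ s in τ..τ', y s := by
      have := intervalIntegral.integral_mono_on hτ.le (intervalIntegrable_const (c := y σ))
        (hii hy le_rfl hτ.le hτ') fun s hs => hσmin hs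
      simpa using this
    have h2 := hmono hy hy0 le_rfl le_rfl hτ.le hτ' le_rfl
    rw [one_div, ← div_eq_inv_mul, le_div_iff₀ hττ, mul_comm]
    exact h1.trans h2
  have hσt : σ ≤ t := hσ.2.trans hτ'
  -- Integration of the differential inequality from σ to s bounds e(s) and the integral of ν by the
  -- same quantity Q. One then enters as Q^{1/2}, the other as AQ, and the product is A Q^{3/2}.
  have hbound : ∀ s ∈ Icc σ t, e s + (∫ r in σ..s, ν r) / A ≤ Q := fun s hs => by
    have hsub : Icc σ s ⊆ Icc τ t := Icc_subset_Icc hσ.1 hs.2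
    have hc : ContinuousOn (fun r => Λ * y r - ν r / A) (Icc τ t) :=
      (continuousOn_const.mul hy).sub (hν.div_const A)
    have h1 := intervalIntegral.sub_le_integral_of_hasDeriv_right_of_le hs.1
      (fun r hr => (he' r (hsub hr)).1.continuousAt.continuousWithinAt)
      (fun r hr => (he' r (hsub (Ioo_subset_Icc_self hr))).1.hasDerivWithinAt)
      ((hc.mono hsub).integrableOn_compact isCompact_Icc)
      (fun r hr => by linarith [(he' r (hsub (Ioo_subset_Icc_self hr))).2])
    rw [intervalIntegral.integral_sub ((hii hy hσ.1 hs.1 hs.2).const_mul Λ)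
      ((hii hν hσ.1 hs.1 hs.2).div_const A), intervalIntegral.integral_const_mul,
      intervalIntegral.integral_div] at h1
    have h2 := mul_le_mul_of_nonneg_left
      (hmono hy hy0 (a := τ) (b := t) le_rfl hσ.1 hs.1 hs.2 le_rfl) hΛ
    have h3 := (hey σ ⟨hσ.1, hσt⟩).trans hyσ
    rw [hQ, add_mul]
    linarith
  have hI0 : ∀ s ∈ Icc σ t, 0 ≤ ∫ r in σ..s, ν r := fun s hs =>
    intervalIntegral.integral_nonneg hs.1 fun r hr => hν0 r ⟨hσ.1.trans hr.1, hr.2.trans hs.2⟩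
  have hQ0 : 0 ≤ Q := (add_nonneg (he0 t ⟨hτ.le.trans hτ', le_rfl⟩)
    (div_nonneg (hI0 t ⟨hσt, le_rfl⟩) hA.le)).trans (hbound t ⟨hσt, le_rfl⟩)
  have hνt : ∫ r in σ..t, ν r ≤ Q * A := by
    rw [← div_le_iff₀ hA]
    linarith [hbound t ⟨hσt, le_rfl⟩, he0 t ⟨hτ.le.trans hτ', le_rfl⟩]
  calc ∫ s in τ'..t, z s ≤ ∫ s in τ'..t, Q ^ (1 / 2 : ℝ) * ν s := by
        refine intervalIntegral.integral_mono_on hτ' (hii hz hτ.le hτ' le_rfl)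
          ((hii hν hτ.le hτ' le_rfl).const_mul _) fun s hs => ?_
        have hs' : s ∈ Icc τ t := ⟨hτ.le.trans hs.1, hs.2⟩
        have hsσ : s ∈ Icc σ t := ⟨hσ.2.trans hs.1, hs.2⟩
        refine (hze s hs').trans (mul_le_mul_of_nonneg_right ?_ (hν0 s hs'))
        refine Real.rpow_le_rpow (he0 s hs') ?_ (by norm_num)
        linarith [hbound s hsσ, div_nonneg (hI0 s hsσ) hA.le]
    _ = Q ^ (1 / 2 : ℝ) * ∫ s in τ'..t, ν s := intervalIntegral.integral_const_mul _ _
    _ ≤ Q ^ (1 / 2 : ℝ) * (Q * A) := by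
        refine mul_le_mul_of_nonneg_left ((hmono hν hν0 hσ.1 hσ.2 hτ' le_rfl le_rfl).trans hνt)
          (Real.rpow_nonneg hQ0 _)
    _ = A * Q ^ (3 / 2 : ℝ) := by
        rw [show (3 / 2 : ℝ) = 1 / 2 + 1 by norm_num,
          Real.rpow_add_of_nonneg hQ0 (by norm_num) zero_le_one, Real.rpow_one]
        ring

/-- The iteration of a superlinear recursive inequality. -/
theorem moser_iterate {A D : ℝ} (hA : 0 < A) (hD : 0 < D) {Y : ℕ → ℝ} (hY : ∀ k, 0 ≤ Y k)
    (h : ∀ k, Y (k + 1) ≤ A * (D * 4 ^ k * Y k) ^ (3 / 2 : ℝ)) (k : ℕ) :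
    64 ^ 2 * A ^ 2 * D ^ 3 * 64 ^ k * Y k ≤
      (64 ^ 2 * A ^ 2 * D ^ 3 * Y 0) ^ ((3 / 2 : ℝ) ^ k) := by
  -- The normalization is chosen so that X_k, the left side, satisfies X_{k+1} ≤ X_k^{3/2} without
  -- further constants: 64 = 8² offsets (4^k)^{3/2} = 8^k, and the prefactor must have square root
  -- 64 A D^{3/2}.
  induction k with
  | zero => simp
  | succ k ih =>
    set Z := 64 ^ 2 * A ^ 2 * D ^ 3 * Y 0
    have hZ : 0 ≤ Z := mul_nonneg (by positivity) (hY 0)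
    have hw : 0 ≤ D * 4 ^ k * Y k := mul_nonneg (by positivity) (hY k)
    have e1 : 64 ^ 2 * A ^ 2 * D ^ 3 * 64 ^ k * Y k =
        (64 * A * D * 4 ^ k) ^ 2 * (D * 4 ^ k * Y k) := by
      rw [show (64 : ℝ) ^ k = (4 ^ k) ^ 3 by rw [← pow_mul, mul_comm, pow_mul]; norm_num]
      ring
    have e2 : ((64 * A * D * 4 ^ k) ^ 2 : ℝ) ^ (3 / 2 : ℝ) = (64 * A * D * 4 ^ k) ^ 3 := by
      rw [← Real.rpow_natCast, ← Real.rpow_mul (by positivity), ← Real.rpow_natCast]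
      norm_num
    have h1 := Real.rpow_le_rpow (mul_nonneg (by positivity) (hY k)) ih
      (show (0 : ℝ) ≤ 3 / 2 by norm_num)
    rw [← Real.rpow_mul hZ, ← pow_succ, e1, Real.mul_rpow (by positivity) hw, e2] at h1
    refine le_trans ?_ h1
    calc 64 ^ 2 * A ^ 2 * D ^ 3 * 64 ^ (k + 1) * Y (k + 1)
        ≤ 64 ^ 2 * A ^ 2 * D ^ 3 * 64 ^ (k + 1) * (A * (D * 4 ^ k * Y k) ^ (3 / 2 : ℝ)) :=
          mul_le_mul_of_nonneg_left (h k) (by positivity)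
      _ = _ := by
          rw [pow_succ (64 : ℝ) k, show (64 : ℝ) ^ k = (4 ^ k) ^ 3 by
            rw [← pow_mul, mul_comm, pow_mul]; norm_num]
          ring

/-- The conclusion of the Moser iteration. -/
theorem rpow_le_of_moser {A D p₀ L m : ℝ} (hA : 0 < A) (hD : 0 < D) (hL : 0 < L) (hm : 0 < m)
    {Y : ℕ → ℝ} (hY : ∀ k, 0 ≤ Y k)
    (h : ∀ k, Y (k + 1) ≤ A * (D * 4 ^ k * Y k) ^ (3 / 2 : ℝ))
    (hlow : ∀ k : ℕ, m * L ^ (p₀ * (3 / 2 : ℝ) ^ k) ≤ Y k) :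
    L ^ p₀ ≤ 64 ^ 2 * A ^ 2 * D ^ 3 * Y 0 := by
  set β := 64 ^ 2 * A ^ 2 * D ^ 3 with hβ
  have hβ0 : 0 < β := by positivity
  set Z := β * Y 0 with hZ
  have hit : ∀ k : ℕ, β * m * (L ^ p₀) ^ ((3 / 2 : ℝ) ^ k) ≤ Z ^ ((3 / 2 : ℝ) ^ k) := fun k => by
    refine le_trans ?_ (moser_iterate hA hD hY h k)
    rw [← Real.rpow_mul hL.le, ← hβ, mul_assoc]
    calc β * (m * L ^ (p₀ * (3 / 2 : ℝ) ^ k)) ≤ β * Y k :=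
          mul_le_mul_of_nonneg_left (hlow k) hβ0.le
      _ ≤ β * 64 ^ k * Y k := by
          refine mul_le_mul_of_nonneg_right ?_ (hY k)
          exact le_mul_of_one_le_right hβ0.le (one_le_pow₀ (by norm_num))
  -- Otherwise (L^{p₀}/Z)^{(3/2)^k} tends to infinity, while it is bounded by 1/(β m), which does
  -- not depend on k.
  by_contra! hlt
  have hL0 : 0 < L ^ p₀ := Real.rpow_pos_of_pos hL _
  have hZpos : 0 < Z := by
    have h0 := hit 0
    simp only [pow_zero, Real.rpow_one] at h0
    exact lt_of_lt_of_le (by positivity) h0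
  have hR : 1 < L ^ p₀ / Z := (one_lt_div hZpos).2 hlt
  have ht := (tendsto_rpow_atTop_of_base_gt_one _ hR).comp
    (tendsto_pow_atTop_atTop_of_one_lt (show (1 : ℝ) < 3 / 2 by norm_num))
  obtain ⟨k, hk⟩ := (ht.eventually_gt_atTop (1 / (β * m))).exists
  rw [Function.comp_apply, Real.div_rpow hL0.le hZpos.le,
    div_lt_div_iff₀ (by positivity) (by positivity)] at hk
  linarith [hit k]

end MoserIteration

/-! ### The iteration step for subsolutions, and lower bounds. -/

section MeanValue

variable {n : ℕ} {M : Type*} [TopologicalSpace M] [ChartedSpace (EuclideanSpace ℝ (Fin n)) M]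
  [IsManifold (𝓡 n) ∞ M] [MeasurableSpace M] [BorelSpace M] [T2Space M] [SigmaCompactSpace M]
  {g : ℝ → Metric n M} {B : Set M} {T c A μ : ℝ} {f u : ℝ → M → ℝ}

theorem IsTest.pow_support {k : ℕ∞} {φ : M → ℝ} (hφ : IsTest n k B φ) {m : ℕ} (hm : m ≠ 0) :
    Continuous (fun y => φ y ^ m) ∧ HasCompactSupport (fun y => φ y ^ m) ∧
      tsupport (fun y => φ y ^ m) ⊆ B := by
  have hs : tsupport (fun y => φ y ^ m) ⊆ tsupport φ :=
    tsupport_subset_of_forall_notMem fun y hy => by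
      rw [image_eq_zero_of_notMem_tsupport hy, zero_pow hm]
  exact ⟨hφ.smooth.continuous.pow m, hφ.compact.of_isClosed_subset (isClosed_tsupport _) hs,
    hs.trans hφ.subset⟩

theorem IsSubsolution.continuousOn_integral (h : IsSubsolution g B T c A μ f u) {φ : M → ℝ}
    (hφ : IsTest n ⊤ B φ) {m : ℕ} (hm : m ≠ 0) {q : ℝ} (hq : 1 ≤ q) :
    ContinuousOn (fun s => ∫ y, φ y ^ m * f s y ^ q ∂(vol (g s))) (Ioo 0 T) := fun _ ht => by
  obtain ⟨h1, h2, h3⟩ := hφ.pow_support hm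
  exact (hasDerivAt_integral_mul_rpow h.smooth h.isOpen h.regular h1 h2 h3 hq
    ht).continuousAt.continuousWithinAt

theorem IsSubsolution.integrable_pow_mul_rpow (h : IsSubsolution g B T c A μ f u) {φ : M → ℝ}
    (hφ : IsTest n ⊤ B φ) {m : ℕ} (hm : m ≠ 0) {q : ℝ} (hq : 0 ≤ q) {t : ℝ} (ht : t ∈ Ioo 0 T) :
    Integrable (fun y => φ y ^ m * f t y ^ q) (vol (g t)) := by
  obtain ⟨h1, h2, h3⟩ := hφ.pow_support hm
  exact h.integrable_mul_rpow h1 h2 h3 hq ht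

theorem IsSubsolution.pow_mul_rpow_nonneg (h : IsSubsolution g B T c A μ f u) {φ : M → ℝ}
    (hφ : IsTest n ⊤ B φ) (hφ0 : ∀ y, 0 ≤ φ y) {m : ℕ} (hm : m ≠ 0) (q : ℝ) {t : ℝ}
    (ht : t ∈ Ioo 0 T) (y : M) : 0 ≤ φ y ^ m * f t y ^ q := by
  by_cases hy : y ∈ B
  · exact mul_nonneg (pow_nonneg (hφ0 y) m) (Real.rpow_nonneg (h.nonneg t ht y hy).1 q)
  · rw [image_eq_zero_of_notMem_tsupport fun h' => hy (hφ.subset h'), zero_pow hm, zero_mul]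

/-- One step of the Moser iteration for subsolutions, with cutoff functions `ψ ≤ φ`. -/
theorem IsSubsolution.moser_step (h : IsSubsolution g B T c A μ f u) {φ ψ : M → ℝ}
    (hφ : IsTest n ⊤ B φ) (hψ : IsTest n ⊤ B ψ) (hφ0 : ∀ y, 0 ≤ φ y)
    (hψ0 : ∀ y, 0 ≤ ψ y ∧ ψ y ≤ 1) (hφψ : ∀ y ∈ tsupport ψ, φ y = 1) {q G Λ τ τ' t : ℝ}
    (hq : 2 < q) (hG0 : 0 ≤ G) (hG : ∀ s ∈ Ioo 0 T, ∀ y, gradNormSq (g s) ψ y ≤ G)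
    (hτ0 : 0 < τ) (hτ : τ < τ') (hτ' : τ' ≤ t) (ht : t < T)
    (hΛ : ∀ s ∈ Icc τ t, 2 * G + (q + max c 0) ^ 3 * (μ ^ 3 / s) * A ^ 2 ≤ Λ) :
    ∫ s in τ'..t, ∫ y, ψ y ^ 3 * f s y ^ (3 / 2 * q) ∂(vol (g s)) ≤
      A * ((1 / (τ' - τ) + Λ) * ∫ s in τ..t, ∫ y, φ y ^ 3 * f s y ^ q ∂(vol (g s))) ^
        (3 / 2 : ℝ) := by
  have hsub : Icc τ t ⊆ Ioo 0 T := Icc_subset_Ioo hτ0 ht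
  have hP : 0 ≤ q + max c 0 := by linarith [le_max_right c 0]
  have hco : ∀ s ∈ Icc τ t, 0 ≤ (q + max c 0) ^ 3 * (μ ^ 3 / s) * A ^ 2 := fun s hs =>
    mul_nonneg (mul_nonneg (pow_nonneg hP 3) (div_nonneg (pow_nonneg h.μ_nonneg 3)
      (hsub hs).1.le)) (sq_nonneg A)
  have hτmem : τ ∈ Icc τ t := ⟨le_rfl, hτ.le.trans hτ'⟩
  have hint : ∀ {s}, s ∈ Icc τ t → ∀ {m : ℕ}, m ≠ 0 → ∀ {p : ℝ}, 0 ≤ p →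
      Integrable (fun y => ψ y ^ m * f s y ^ p) (vol (g s)) := fun hs _ hm _ hp =>
    h.integrable_pow_mul_rpow hψ hm hp (hsub hs)
  have hφi : ∀ {s}, s ∈ Icc τ t → Integrable (fun y => φ y ^ 3 * f s y ^ q) (vol (g s)) :=
    fun hs => h.integrable_pow_mul_rpow hφ (by norm_num) (by linarith) (hsub hs)
  have hφn : ∀ {s}, s ∈ Icc τ t → ∀ y, 0 ≤ φ y ^ 3 * f s y ^ q := fun hs y =>
    h.pow_mul_rpow_nonneg hφ hφ0 (by norm_num) q (hsub hs) y
  -- Because φ = 1 on the support of ψ, both ψ² f^q and |∇ψ|² f^q are dominated by multiples of φ³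
  -- f^q. Thus all terms on the right of the energy inequality are controlled by the previous
  -- integral.
  have hle : ∀ {s}, s ∈ Icc τ t → ∀ {w : ℝ} {y}, 0 ≤ w → (y ∉ tsupport ψ → w = 0) →
      ∀ {b}, w ≤ b → f s y ^ q * w ≤ b * (φ y ^ 3 * f s y ^ q) := fun {s} hs {w y} hw0 hw {b} hb => by
    by_cases hy : y ∈ tsupport ψ
    · rw [hφψ y hy, one_pow, one_mul, mul_comm]
      exact mul_le_mul_of_nonneg_right hb
        (Real.rpow_nonneg (h.nonneg s (hsub hs) y (hψ.subset hy)).1 q)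
    · rw [hw hy, mul_zero]
      exact mul_nonneg (hw0.trans hb) (hφn hs y)
  have hey : ∀ s ∈ Icc τ t, ∫ y, ψ y ^ 2 * f s y ^ q ∂(vol (g s)) ≤
      ∫ y, φ y ^ 3 * f s y ^ q ∂(vol (g s)) := fun s hs =>
    integral_mono (hint hs (by norm_num) (by linarith)) (hφi hs) fun y => by
      have := hle hs (w := ψ y ^ 2) (y := y) (sq_nonneg _) (fun hy => by
        rw [image_eq_zero_of_notMem_tsupport hy, zero_pow (by norm_num)])
        (pow_le_one₀ (hψ0 y).1 (hψ0 y).2)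
      show ψ y ^ 2 * f s y ^ q ≤ φ y ^ 3 * f s y ^ q
      linarith
  -- The cubic weight is natural: with h = ψ f^{q/2}, the output ∫ h³ = ∫ ψ³ f^{3q/2} has the same
  -- form as the input ∫ φ³ f^q, so the step can be repeated.
  refine RiemannianHeat.moser_step (e := fun s => ∫ y, ψ y ^ 2 * f s y ^ q ∂(vol (g s)))
    (ν := fun s => (∫ y, ψ y ^ 4 * f s y ^ (2 * q) ∂(vol (g s))) ^ (1 / 2 : ℝ)) hτ hτ' h.A_pos
    ?_ ((h.continuousOn_integral hφ (by norm_num) (by linarith)).mono hsub)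
    (((h.continuousOn_integral hψ (by norm_num) (by linarith)).mono hsub).rpow_const
      fun _ _ => Or.inr (by norm_num))
    ((h.continuousOn_integral hψ (by norm_num) (by linarith)).mono hsub)
    (fun s hs => integral_nonneg fun y =>
      h.pow_mul_rpow_nonneg hψ (fun y => (hψ0 y).1) (by norm_num) q (hsub hs) y) hey
    (fun s hs => Real.rpow_nonneg (integral_nonneg fun y =>
      h.pow_mul_rpow_nonneg hψ (fun y => (hψ0 y).1) (by norm_num) (2 * q) (hsub hs) y) _)
    (fun s hs => ?_) fun s hs => ?_
  · have := (hco τ hτmem).trans ((le_add_of_nonneg_left (by linarith)).trans (hΛ τ hτmem))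
    exact this
  · obtain ⟨e', h1, h2⟩ := h.exists_hasDerivAt hψ (fun y => (hψ0 y).1) hq (hsub hs)
    simp only [← sq] at h1 h2
    refine ⟨e', h1, h2.trans ?_⟩
    have hgr : ∫ y, f s y ^ q * gradNormSq (g s) ψ y ∂(vol (g s)) ≤
        G * ∫ y, φ y ^ 3 * f s y ^ q ∂(vol (g s)) := by
      rw [← integral_const_mul]
      refine integral_mono_of_nonneg (ae_of_all _ fun y => ?_) ((hφi hs).const_mul G)
        (ae_of_all _ fun y => hle hs (gradNormSq_nonneg _ _ _)
          (fun hy => gradNormSq_eq_zero _ hy) (hG s (hsub hs) y))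
      by_cases hy : y ∈ tsupport ψ
      · exact mul_nonneg (Real.rpow_nonneg (h.nonneg s (hsub hs) y (hψ.subset hy)).1 q)
          (gradNormSq_nonneg _ _ _)
      · show 0 ≤ f s y ^ q * gradNormSq (g s) ψ y
        rw [gradNormSq_eq_zero _ hy, mul_zero]
    have h3 := mul_le_mul_of_nonneg_left (hey s hs) (hco s hs)
    have h4 := mul_le_mul_of_nonneg_right (hΛ s hs) (integral_nonneg (μ := vol (g s)) (hφn hs))
    rw [add_mul] at h4
    linarith
  · have hf0 : ∀ y, 0 ≤ f s y ∨ ψ y = 0 := fun y => by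
      by_cases hy : y ∈ B
      · exact Or.inl (h.nonneg s (hsub hs) y hy).1
      · exact Or.inr (image_eq_zero_of_notMem_tsupport fun h' => hy (hψ.subset h'))
    have e2 : ∀ y, (ψ y * f s y ^ (q / 2)) ^ 2 = ψ y ^ 2 * f s y ^ q := fun y => by
      rcases hf0 y with hy | hy
      · rw [(rpow_half_pow hy).1, sq (ψ y)]
      · simp [hy]
    have e3 : ∀ y, (ψ y * f s y ^ (q / 2)) ^ 3 = ψ y ^ 3 * f s y ^ (3 / 2 * q) := fun y => by
      rcases hf0 y with hy | hy
      · rw [(rpow_half_pow hy).2.1]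
      · simp [hy]
    have e4 : ∀ y, (ψ y * f s y ^ (q / 2)) ^ 4 = ψ y ^ 4 * f s y ^ (2 * q) := fun y => by
      rcases hf0 y with hy | hy
      · rw [(rpow_half_pow hy).2.2]
      · simp [hy]
    have i1 := hint hs (m := 1) one_ne_zero (p := q / 2) (by linarith)
    simp only [pow_one] at i1
    have i2 := hint hs (m := 2) two_ne_zero (p := q) (by linarith)
    have i4 := hint hs (m := 4) four_ne_zero (p := 2 * q) (by linarith)
    have key := integral_cube_le (μ := vol (g s)) (h := fun y => ψ y * f s y ^ (q / 2))
      (ae_of_all _ fun y => ?_) ((memLp_two_iff_integrable_sq i1.1).2 (by simpa only [e2] using i2))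
      ((memLp_two_iff_integrable_sq (by simpa only [e2] using i2.1)).2
        (by simpa only [← pow_mul, Nat.reduceMul, e4] using i4))
    · simpa only [e2, e3, e4] using key
    · have := h.pow_mul_rpow_nonneg hψ (fun y => (hψ0 y).1) one_ne_zero (q / 2) (hsub hs) y
      simpa only [pow_one] using this

/-- The relative density has a positive minimum on the compact set of times and points, and K has
positive volume for g(0). -/
theorem exists_pos_le_vol (hg : SmoothFamilyOn g (Ico 0 T)) {K : Set M} (hK : IsCompact K) {x : M}
    (hx : K ∈ 𝓝 x) {a b : ℝ} (ha : 0 < a) (hab : a ≤ b) (hb : b < T) :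
    ∃ m > 0, ∀ s ∈ Icc a b, m ≤ (vol (g s)).real K := by
  have hT : 0 < T := ha.trans_le (hab.trans hb.le)
  have h0 := hg.isRegular ⟨le_rfl, hT⟩
  have := isLocallyFinite_vol h0
  have := isOpenPosMeasure_vol h0
  have hc := (hg.continuousOn_relDensity hT).1.mono
    (prod_mono (Icc_subset_Ioo ha hb) (subset_univ K))
  obtain ⟨q, -, hmin⟩ := (isCompact_Icc.prod hK).exists_isMinOn
    ⟨(a, x), ⟨le_rfl, hab⟩, mem_of_mem_nhds hx⟩ hc
  have hpos : 0 < (vol (g 0)).real K :=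
    ENNReal.toReal_pos (Measure.measure_pos_of_mem_nhds (vol (g 0)) hx).ne' hK.measure_lt_top.ne
  refine ⟨_, mul_pos (relDensity_pos (g 0) (g q.1) q.2) hpos, fun s hs => ?_⟩
  have hs' : s ∈ Ico 0 T := ⟨ha.le.trans hs.1, hs.2.trans_lt hb⟩
  rw [← integral_indicator_one hK.measurableSet, ← integral_indicator_one hK.measurableSet,
    integral_vol_eq_relDensity h0 (hg.isRegular hs'), ← integral_const_mul]
  have hci : IntegrableOn (relDensity (g 0) (g s)) K (vol (g 0)) :=
    (continuous_relDensity h0 (hg.isRegular hs')).continuousOn.integrableOn_compact hK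
  refine integral_mono (((integrable_indicator_iff hK.measurableSet).2
    (integrableOn_const hK.measure_lt_top.ne)).const_mul _)
    (((integrable_indicator_iff hK.measurableSet).2 hci).congr (ae_of_all _ fun y => ?_))
    fun y => ?_
  · by_cases hy : y ∈ K <;> simp [hy]
  · by_cases hy : y ∈ K
    · simpa [hy] using hmin (show (s, y) ∈ Icc a b ×ˢ K from ⟨hs, hy⟩)
    · simp [hy]

/-- A lower bound for space-time integrals of powers of `f`. -/
theorem IsSubsolution.exists_lower_bound (h : IsSubsolution g B T c A μ f u) {x : M} (hx : x ∈ B)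
    {φ : ℕ → M → ℝ} (hφ : ∀ k, IsTest n ⊤ B (φ k)) (hφ0 : ∀ k y, 0 ≤ φ k y)
    (hφx : ∀ᶠ y in 𝓝 x, ∀ k, φ k y = 1) {t L a : ℝ} (ht : t ∈ Ioo 0 T) (ha : 0 < a) (hat : a < t)
    (hL0 : 0 < L) (hL : L < f t x) :
    ∃ m > 0, ∀ (k : ℕ) (q : ℝ), 1 ≤ q → ∀ τ ∈ Ioc 0 a,
      m * L ^ q ≤ ∫ s in τ..t, ∫ y, φ k y ^ 3 * f s y ^ q ∂(vol (g s)) := by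
  have : LocallyCompactSpace M := Manifold.locallyCompact_of_finiteDimensional (𝓡 n)
  have hcont : ContinuousAt (fun q : ℝ × M => f q.1 q.2) (t, x) :=
    (h.regular.continuousOn h.isOpen).continuousAt
      ((isOpen_Ioo.prod h.isOpen).mem_nhds ⟨ht, hx⟩)
  -- By continuity f > L on a small space-time neighbourhood of (t, x), shrunk so that every cutoff
  -- φ k equals 1 there. Its measure gives m, independent of k, q and τ.
  obtain ⟨U, hU, V, hV, hUV⟩ := mem_nhds_prod_iff.1 (hcont.eventually_const_lt hL)
  obtain ⟨δ, hδ, hδU⟩ := Metric.nhds_basis_closedBall.mem_iff.1 hU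
  obtain ⟨K, hKx, hKV, hK⟩ := local_compact_nhds
    (inter_mem (inter_mem hV (h.isOpen.mem_nhds hx)) hφx)
  -- Taking b at least a ensures that [b, t] is contained in [τ, t] for every admissible τ.
  set b := max a (t - δ) with hb
  have hbt : b < t := max_lt hat (by linarith)
  have hb0 : 0 < b := ha.trans_le (le_max_left _ _)
  obtain ⟨m, hm, hmK⟩ := exists_pos_le_vol h.smooth hK hKx hb0 hbt.le ht.2
  refine ⟨(t - b) * m, mul_pos (sub_pos.2 hbt) hm, fun k q hq τ hτ => ?_⟩
  have hτb : τ ≤ b := hτ.2.trans (le_max_left _ _)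
  have hsub : Icc τ t ⊆ Ioo 0 T := Icc_subset_Ioo hτ.1 ht.2
  have hc := (h.continuousOn_integral (hφ k) (m := 3) (by norm_num) hq).mono hsub
  have hn : ∀ s ∈ Icc τ t, 0 ≤ ∫ y, φ k y ^ 3 * f s y ^ q ∂(vol (g s)) := fun s hs =>
    integral_nonneg fun y => h.pow_mul_rpow_nonneg (hφ k) (hφ0 k) (by norm_num) q (hsub hs) y
  have hi := hc.intervalIntegrable_of_Icc (μ := volume) (hτb.trans hbt.le)
  have hi' := (hc.mono (Icc_subset_Icc_left hτb)).intervalIntegrable_of_Icc hbt.le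
    (μ := volume)
  refine le_trans ?_ (intervalIntegral.integral_mono_interval hτb hbt.le le_rfl ?_ hi)
  · have key := intervalIntegral.integral_mono_on hbt.le
      (intervalIntegrable_const (c := L ^ q * m)) hi' fun s hs => ?_
    · rw [intervalIntegral.integral_const, smul_eq_mul] at key
      linarith
    have hs' : s ∈ Ioo 0 T := hsub ⟨hτb.trans hs.1, hs.2⟩
    have := isLocallyFinite_vol (h.isRegular hs')
    have hint := h.integrable_pow_mul_rpow (hφ k) (m := 3) (by norm_num) (by linarith : 0 ≤ q) hs'
    calc L ^ q * m ≤ L ^ q * (vol (g s)).real K :=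
          mul_le_mul_of_nonneg_left (hmK s hs) (Real.rpow_nonneg hL0.le q)
      _ = ∫ y in K, L ^ q ∂(vol (g s)) := by
          rw [setIntegral_const, smul_eq_mul, mul_comm]
      _ ≤ ∫ y in K, φ k y ^ 3 * f s y ^ q ∂(vol (g s)) := by
          refine setIntegral_mono_on (integrableOn_const hK.measure_lt_top.ne)
            hint.integrableOn hK.measurableSet fun y hy => ?_
          have hφy : φ k y = 1 := (hKV hy).2 k
          rw [hφy, one_pow, one_mul]
          refine Real.rpow_le_rpow hL0.le (le_of_lt ?_) (by linarith)
          refine hUV (⟨hδU ?_, (hKV hy).1.1⟩ : (s, y) ∈ U ×ˢ V)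
          rw [Metric.mem_closedBall, Real.dist_eq, abs_le]
          constructor <;> linarith [hs.1, hs.2, le_max_right a (t - δ)]
      _ ≤ _ := setIntegral_le_integral hint (ae_of_all _ fun y =>
          h.pow_mul_rpow_nonneg (hφ k) (hφ0 k) (by norm_num) q hs' y)
  · filter_upwards [ae_restrict_mem measurableSet_Ioc] with s hs
    exact hn s ⟨hs.1.le, hs.2⟩

end MeanValue

/-! ### The choice of parameters and the pointwise bound. -/

section PointwiseBound

variable {n : ℕ} {M : Type*} [TopologicalSpace M] [ChartedSpace (EuclideanSpace ℝ (Fin n)) M]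
  [IsManifold (𝓡 n) ∞ M] [MeasurableSpace M] [BorelSpace M] [T2Space M] [SigmaCompactSpace M]
  {g : ℝ → Metric n M} {B : Set M} {T c A μ : ℝ} {f u : ℝ → M → ℝ}

/-- The bound for the constants in the `k`-th step of the iteration. -/
theorem moser_constant_le {a b c t r w p : ℝ} (hb : 0 ≤ b) (ht : 0 < t)
    (hr : 0 < r) (hw : 0 ≤ w) (hp : 0 ≤ p) (hc : 0 ≤ c) (k : ℕ)
    (hab : a = t * (1 / 2) ^ k / 8) :
    1 / a + (2 * (2 * (b * 4 ^ (k + 1) / r ^ 2)) + (p * (3 / 2) ^ k + c) ^ 3 * (w / (t / 2))) ≤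
      (8 + 16 * b + 2 * (p + c) ^ 3) * ((1 + w) * t⁻¹ + 1 / r ^ 2) * 4 ^ k := by
  have h2 : (2 : ℝ) ^ k ≤ 4 ^ k := by gcongr; norm_num
  have e1 : 1 / a = 8 * 2 ^ k * t⁻¹ := by
    rw [hab, one_div_pow]; field_simp
  -- The cubes of the exponents grow like (27/8)^k ≤ 4^k, no faster than the squared gradients of
  -- the cutoffs.
  have h3 : (p * (3 / 2) ^ k + c) ^ 3 ≤ (p + c) ^ 3 * 4 ^ k := by
    have h31 : (1 : ℝ) ≤ (3 / 2) ^ k := one_le_pow₀ (by norm_num)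
    calc (p * (3 / 2) ^ k + c) ^ 3 ≤ ((p + c) * (3 / 2) ^ k) ^ 3 := by
          refine pow_le_pow_left₀ (by positivity) ?_ 3
          nlinarith
      _ = (p + c) ^ 3 * ((3 / 2) ^ 3) ^ k := by rw [mul_pow, ← pow_mul, ← pow_mul, mul_comm k]
      _ ≤ (p + c) ^ 3 * 4 ^ k := by gcongr; norm_num
  have e2 : w / (t / 2) = 2 * w * t⁻¹ := by field_simp
  have e3 : 2 * (2 * (b * 4 ^ (k + 1) / r ^ 2)) = 16 * b * 4 ^ k * (1 / r ^ 2) := by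
    rw [pow_succ]; ring
  rw [e1, e2, e3]
  have hti : 0 < t⁻¹ := inv_pos.2 ht
  have hri : 0 < 1 / r ^ 2 := by positivity
  have hpc : 0 ≤ (p + c) ^ 3 := by positivity
  have h4 : (0 : ℝ) < 4 ^ k := by positivity
  have m1 : 8 * 2 ^ k * t⁻¹ ≤ 8 * t⁻¹ * 4 ^ k := by
    nlinarith [mul_le_mul_of_nonneg_right h2 hti.le]
  have m2 : (p * (3 / 2) ^ k + c) ^ 3 * (2 * w * t⁻¹) ≤
      2 * (p + c) ^ 3 * (w * t⁻¹) * 4 ^ k := by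
    nlinarith [mul_le_mul_of_nonneg_right h3 (by positivity : 0 ≤ 2 * w * t⁻¹)]
  -- These are the products on the right side that are not needed to dominate the left side.
  have m3 : 0 ≤ (8 * (w * t⁻¹ + 1 / r ^ 2) + 16 * b * ((1 + w) * t⁻¹) +
      2 * (p + c) ^ 3 * (t⁻¹ + 1 / r ^ 2)) * 4 ^ k := by positivity
  calc _ ≤ 8 * t⁻¹ * 4 ^ k + (16 * b * 4 ^ k * (1 / r ^ 2) +
        2 * (p + c) ^ 3 * (w * t⁻¹) * 4 ^ k) := add_le_add m1 (add_le_add le_rfl m2)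
    _ ≤ _ := by linarith

/-- The pointwise bound of a subsolution by its space-time `L^{p₀}` norm. -/
theorem IsSubsolution.exists_le_rpow {x : M} {r : ℝ}
    (h : IsSubsolution g (geodesicBall (g 0) x r) T c A μ f u) (hr : 0 < r)
    (hcomp : CompleteInside (g 0) x r)
    (hg : ∀ t ∈ Ico 0 T, ∀ y ∈ geodesicBall (g 0) x r, ∀ v : TangentSpace (𝓡 n) y,
      1 / 2 * (g 0).inner y v v ≤ (g t).inner y v v)
    {ℓ : ℝ} (hℓ : ∀ t, |deriv Real.smoothTransition t| ≤ ℓ) {p₀ : ℝ} (hp₀ : 2 < p₀) {t : ℝ}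
    (ht : t ∈ Ioo 0 T) :
    ∃ φ : M → ℝ, IsTest n ⊤ (geodesicBall (g 0) x r) φ ∧ (∀ y, 0 ≤ φ y ∧ φ y ≤ 1) ∧
      f t x ≤ (64 ^ 2 * A ^ 2 * ((8 + 16 * (9 * (16 * ℓ) ^ 2) + 2 * (p₀ + max c 0) ^ 3) *
        ((1 + A ^ 2 * μ ^ 3) * t⁻¹ + 1 / r ^ 2)) ^ 3 *
        ∫ s in (t / 2)..t, ∫ y, φ y ^ 3 * f s y ^ p₀ ∂(vol (g s))) ^ (1 / p₀) := by
  have ht0 := ht.1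
  have hT : 0 < T := ht.1.trans ht.2
  have h0 := h.smooth.isRegular ⟨le_rfl, hT⟩
  obtain ⟨φ, hφ, hφ01, hφφ, hφg, hφx⟩ := exists_cutoffs hℓ h0 hr hcomp
  have hx : x ∈ geodesicBall (g 0) x r := by
    show riemDist (g 0) x x < _
    rw [riemDist_self]
    exact ENNReal.ofReal_pos.2 hr
  set D := (8 + 16 * (9 * (16 * ℓ) ^ 2) + 2 * (p₀ + max c 0) ^ 3) *
    ((1 + A ^ 2 * μ ^ 3) * t⁻¹ + 1 / r ^ 2) with hD
  have hc0 := le_max_right c 0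
  have hμ := h.μ_nonneg
  have hw : 0 ≤ A ^ 2 * μ ^ 3 := mul_nonneg (sq_nonneg A) (pow_nonneg hμ 3)
  have hD0 : 0 < D := by
    have := pow_nonneg (by linarith : 0 ≤ p₀ + max c 0) 3
    have : 0 < t⁻¹ := inv_pos.2 ht0
    exact mul_pos (by positivity) (by positivity)
  -- The starting times increase from t/2 towards 3t/4 with gaps t 2^{-k}/8. They stay at least t/2,
  -- where the weight 1/s is at most 2/t, and a final interval of length t/4 remains.
  let τ : ℕ → ℝ := fun k => t * (3 / 4 - (1 / 2) ^ k / 4)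
  have hτ0 : τ 0 = t / 2 := by simp only [τ]; ring
  have hhalf : ∀ k : ℕ, (0 : ℝ) < (1 / 2) ^ k ∧ ((1 : ℝ) / 2) ^ k ≤ 1 := fun k =>
    ⟨by positivity, pow_le_one₀ (by norm_num) (by norm_num)⟩
  have hτle : ∀ k, τ k ∈ Icc (t / 2) (3 / 4 * t) := fun k => by
    obtain ⟨h1, h2⟩ := hhalf k
    constructor <;> simp only [τ] <;> nlinarith
  have hτd : ∀ k, τ (k + 1) - τ k = t * (1 / 2) ^ k / 8 := fun k => by
    simp only [τ, pow_succ]; ring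
  let p : ℕ → ℝ := fun k => p₀ * (3 / 2) ^ k
  have hp : ∀ k, 2 < p k := fun k => by
    have : (1 : ℝ) ≤ (3 / 2) ^ k := one_le_pow₀ (by norm_num)
    simp only [p]; nlinarith
  let Y : ℕ → ℝ := fun k => ∫ s in τ k..t, ∫ y, φ k y ^ 3 * f s y ^ p k ∂(vol (g s))
  have hY : ∀ k, 0 ≤ Y k := fun k => by
    refine intervalIntegral.integral_nonneg (by linarith [(hτle k).2]) fun s hs =>
      integral_nonneg fun y => h.pow_mul_rpow_nonneg (hφ k) (fun y => (hφ01 k y).1) (by norm_num) _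
        ⟨?_, hs.2.trans_lt ht.2⟩ y
    linarith [(hτle k).1, hs.1]
  have hstep : ∀ k, Y (k + 1) ≤ A * (D * 4 ^ k * Y k) ^ (3 / 2 : ℝ) := fun k => by
    -- The cutoffs are built for g(0); the bound g(0) ≤ 2g(s) costs a factor 2 in their squared
    -- gradients.
    have hG : ∀ s ∈ Ioo 0 T, ∀ y, gradNormSq (g s) (φ (k + 1)) y ≤
        2 * (9 * (16 * ℓ) ^ 2 * 4 ^ (k + 1) / r ^ 2) := fun s hs y => by
      by_cases hy : y ∈ tsupport (φ (k + 1))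
      · refine (gradNormSq_le_of_form_le (g s) (g 0) zero_le_two (φ (k + 1)) fun v => ?_).trans
          (mul_le_mul_of_nonneg_left (hφg (k + 1) y) zero_le_two)
        linarith [hg s ⟨hs.1.le, hs.2⟩ y ((hφ (k + 1)).subset hy) v]
      · rw [gradNormSq_eq_zero _ hy]; positivity
    have hlt : τ k < τ (k + 1) := by
      have := hτd k
      have : 0 < t * (1 / 2) ^ k / 8 := by positivity
      linarith
    have hτk := hτle k
    have key := h.moser_step (hφ k) (hφ (k + 1)) (fun y => (hφ01 k y).1) (hφ01 (k + 1)) (hφφ k)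
      (hp k) (by positivity) hG (by linarith [hτk.1]) hlt (by linarith [(hτle (k + 1)).2]) ht.2
      (Λ := 2 * (2 * (9 * (16 * ℓ) ^ 2 * 4 ^ (k + 1) / r ^ 2)) +
        (p k + max c 0) ^ 3 * (A ^ 2 * μ ^ 3 / (t / 2))) fun s hs => by
          have h1 : μ ^ 3 / s * A ^ 2 ≤ A ^ 2 * μ ^ 3 / (t / 2) := by
            rw [div_mul_eq_mul_div, mul_comm (μ ^ 3)]
            exact div_le_div_of_nonneg_left hw (by linarith) (hτk.1.trans hs.1)
          have h2 := mul_le_mul_of_nonneg_left h1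
            (pow_nonneg (by linarith [hp k] : 0 ≤ p k + max c 0) 3)
          linarith
    rw [show 3 / 2 * p k = p (k + 1) by simp only [p, pow_succ]; ring] at key
    have hpos : 0 < t * (1 / 2) ^ k / 8 := by positivity
    refine key.trans (mul_le_mul_of_nonneg_left (Real.rpow_le_rpow (mul_nonneg ?_ (hY k))
      (mul_le_mul_of_nonneg_right ?_ (hY k)) (by norm_num)) h.A_pos.le)
    · have h3 := pow_nonneg (by linarith [hp k] : 0 ≤ p k + max c 0) 3
      have h4 : 0 ≤ 1 / (τ (k + 1) - τ k) := by rw [hτd]; positivity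
      positivity
    · exact moser_constant_le (by positivity) ht0 hr hw
        (by linarith) hc0 k (hτd k)
  refine ⟨φ 0, hφ 0, hφ01 0, ?_⟩
  have hY0 : Y 0 = ∫ s in (t / 2)..t, ∫ y, φ 0 y ^ 3 * f s y ^ p₀ ∂(vol (g s)) := by
    simp only [Y, p, hτ0, pow_zero, mul_one]
  rw [← hY0]
  have hR : 0 ≤ 64 ^ 2 * A ^ 2 * D ^ 3 * Y 0 := mul_nonneg (by positivity) (hY 0)
  -- It suffices to bound every L < f(t, x); the strict inequality is what provides the
  -- neighbourhood behind the lower bound on Y k.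
  refine le_of_forall_lt_imp_le_of_dense fun L hL => ?_
  rcases le_or_gt L 0 with hL0 | hL0
  · exact hL0.trans (Real.rpow_nonneg hR _)
  obtain ⟨m, hm, hmY⟩ := h.exists_lower_bound hx hφ (fun k y => (hφ01 k y).1) hφx ht
    (a := 3 / 4 * t) (by linarith) (by linarith) hL0 hL
  have key := rpow_le_of_moser h.A_pos hD0 hL0 hm hY hstep fun k =>
    hmY k (p k) (by linarith [hp k]) (τ k) ⟨by linarith [(hτle k).1], (hτle k).2⟩
  rw [one_div]
  exact (Real.le_rpow_inv_iff_of_pos hL0.le hR (by linarith)).2 key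

/-- Passes from the finite integrals with cutoff, used in the iteration, to the integral over all of
B × (0, T), which may be infinite. -/
theorem IsSubsolution.ofReal_integral_le (h : IsSubsolution g B T c A μ f u) {φ : M → ℝ}
    (hφ : IsTest n ⊤ B φ) (hφ01 : ∀ y, 0 ≤ φ y ∧ φ y ≤ 1) {p : ℝ} (hp : 1 ≤ p) {a t : ℝ}
    (ha : 0 < a) (hat : a ≤ t) (ht : t < T) :
    ENNReal.ofReal (∫ s in a..t, ∫ y, φ y ^ 3 * f s y ^ p ∂(vol (g s))) ≤
      ∫⁻ s in Ioo 0 T, ∫⁻ y in B, ENNReal.ofReal (f s y) ^ p ∂(vol (g s)) := by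
  have hsub : Icc a t ⊆ Ioo 0 T := Icc_subset_Ioo ha ht
  have hn : ∀ s ∈ Ioo 0 T, ∀ y, 0 ≤ φ y ^ 3 * f s y ^ p := fun s hs y =>
    h.pow_mul_rpow_nonneg hφ (fun y => (hφ01 y).1) (by norm_num) p hs y
  have hc := (h.continuousOn_integral hφ (m := 3) (by norm_num) hp).mono hsub
  rw [intervalIntegral.integral_of_le hat, ofReal_integral_eq_lintegral_ofReal
    ((hc.integrableOn_compact isCompact_Icc).mono_set Ioc_subset_Icc_self)]
  · refine (lintegral_mono_set (Ioc_subset_Icc_self.trans hsub)).trans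
      (setLIntegral_mono' measurableSet_Ioo fun s hs => ?_)
    rw [ofReal_integral_eq_lintegral_ofReal
      (h.integrable_pow_mul_rpow hφ (by norm_num) (by linarith) hs) (ae_of_all _ (hn s hs)),
      ← lintegral_indicator h.isOpen.measurableSet]
    refine lintegral_mono fun y => ?_
    by_cases hy : y ∈ B
    · have hf := (h.nonneg s hs y hy).1
      rw [indicator_of_mem hy, ENNReal.ofReal_rpow_of_nonneg hf (by linarith)]
      refine ENNReal.ofReal_le_ofReal ?_
      exact mul_le_of_le_one_left (Real.rpow_nonneg hf p) (pow_le_one₀ (hφ01 y).1 (hφ01 y).2)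
    · rw [image_eq_zero_of_notMem_tsupport fun h' => hy (hφ.subset h')]
      simp
  · filter_upwards [ae_restrict_mem measurableSet_Ioc] with s hs
    exact integral_nonneg (hn s (hsub (Ioc_subset_Icc_self hs)))

end PointwiseBound

end RiemannianHeat

end

/-! ### The mean value inequality. -/

theorem mainTheorem5 (p₀ : ℝ) (hp₀ : 2 < p₀) (c : ℝ) :
    ∃ C : ℝ, 0 < C ∧
      ∀ (M : Type*) [TopologicalSpace M] [ChartedSpace (EuclideanSpace ℝ (Fin 4)) M]
        [IsManifold (𝓡 4) ∞ M] [T2Space M] [SigmaCompactSpace M]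
        [MeasurableSpace M] [BorelSpace M]
        (T : ℝ) (g : ℝ → RiemannianHeat.Metric 4 M) (x : M) (r A μ : ℝ) (B : Set M)
        (f u : ℝ → M → ℝ),
        0 < T → 0 < r → 0 < A → 0 ≤ μ →
        -- the ball is taken with respect to the initial metric
        B = RiemannianHeat.geodesicBall (g 0) x r →
        RiemannianHeat.CompleteInside (g 0) x r →
        RiemannianHeat.SmoothFamilyOn (n := 4) g (Ico 0 T) →
        (∀ t ∈ Ico 0 T, ∀ y ∈ B, ∀ v : TangentSpace (𝓡 4) y,
          1 / 2 * (g 0).inner y v v ≤ (g t).inner y v v ∧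
            (g t).inner y v v ≤ 2 * (g 0).inner y v v) →
        (∀ t ∈ Ico 0 T, RiemannianHeat.SobolevOn (g t) B A) →
        (∀ t ∈ Ioo 0 T, ∀ y ∈ B, 0 ≤ f t y ∧ 0 ≤ u t y) →
        RiemannianHeat.ClassC21On (n := 4) f (Ioo 0 T) B →
        (∀ t ∈ Ioo 0 T, AEMeasurable (u t) ((RiemannianHeat.vol (g t)).restrict B)) →
        -- `∂_t f ≤ Δ f + u f`
        (∀ t ∈ Ioo 0 T, ∀ y ∈ B, deriv (fun s => f s y) t ≤
          RiemannianHeat.laplacian (g t) (f t) y + u t y * f t y) →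
        -- `∂_t dV ≤ c u dV`
        (∀ t ∈ Ioo 0 T, ∀ y ∈ B,
          deriv (fun s => RiemannianHeat.volDensity (g s) y (extChartAt (𝓡 4) y y)) t ≤
            c * u t y * RiemannianHeat.volDensity (g t) y (extChartAt (𝓡 4) y y)) →
        -- `‖u(t)‖_{L³(B)} ≤ μ t^{-1/3}`
        (∀ t ∈ Ioo 0 T,
          (∫⁻ y in B, ENNReal.ofReal (u t y) ^ 3 ∂(RiemannianHeat.vol (g t))) ^ (1 / 3 : ℝ) ≤
            ENNReal.ofReal (μ * t ^ (-1 / 3 : ℝ))) →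
        ∀ t ∈ Ioo 0 T, ENNReal.ofReal |f t x| ≤
          ENNReal.ofReal (C * A ^ (2 / p₀) *
            ((1 + A ^ 2 * μ ^ 3) * t⁻¹ + 1 / r ^ 2) ^ (3 / p₀)) *
          (∫⁻ s in Ioo 0 T, ∫⁻ y in B, ENNReal.ofReal (f s y) ^ p₀
            ∂(RiemannianHeat.vol (g s))) ^ (1 / p₀) := by
  obtain ⟨ℓ, hℓ0, hℓ⟩ := RiemannianHeat.exists_bound_deriv_smoothTransition
  set C₁ := 8 + 16 * (9 * (16 * ℓ) ^ 2) + 2 * (p₀ + max c 0) ^ 3 with hC₁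
  have hC₁0 : 0 < C₁ := by
    have := pow_nonneg (by linarith [le_max_right c 0] : 0 ≤ p₀ + max c 0) 3
    positivity
  -- The constant collects what is left of (64² A² D³)^{1/p₀} after A^{2/p₀} and the power 3/p₀ of
  -- the bracket are split off; C₁ involves only p₀, c and the absolute bound ℓ.
  refine ⟨(64 ^ 2 * C₁ ^ 3) ^ (1 / p₀), by positivity, ?_⟩
  intro M _ _ _ _ _ _ _ T g x r A μ B f u hT hr hA hμ hB hcomp hg hcmp hS h0 hf hu hfd hvd hun t ht
  subst hB
  have h : RiemannianHeat.IsSubsolution g (RiemannianHeat.geodesicBall (g 0) x r) T c A μ f u :=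
    ⟨RiemannianHeat.isOpen_geodesicBall _ _ _, hg, hA, hμ, hS, h0, hf, hu, hfd, hvd, hun⟩
  have hx : x ∈ RiemannianHeat.geodesicBall (g 0) x r := by
    show RiemannianHeat.riemDist (g 0) x x < _
    rw [RiemannianHeat.riemDist_self]
    exact ENNReal.ofReal_pos.2 hr
  obtain ⟨φ, hφ, hφ01, hle⟩ := h.exists_le_rpow hr hcomp (fun t ht y hy v => (hcmp t ht y hy v).1)
    hℓ hp₀ ht
  have hI := h.ofReal_integral_le hφ hφ01 (p := p₀) (by linarith) (half_pos ht.1)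
    (half_le_self ht.1.le) ht.2
  have hti : 0 < t⁻¹ := inv_pos.2 ht.1
  have hK : 0 < (1 + A ^ 2 * μ ^ 3) * t⁻¹ + 1 / r ^ 2 := by positivity
  have hp : 0 ≤ 1 / p₀ := by positivity
  have e : (64 ^ 2 * A ^ 2 * (C₁ * ((1 + A ^ 2 * μ ^ 3) * t⁻¹ + 1 / r ^ 2)) ^ 3) ^ (1 / p₀) =
      (64 ^ 2 * C₁ ^ 3) ^ (1 / p₀) * A ^ (2 / p₀) *
        ((1 + A ^ 2 * μ ^ 3) * t⁻¹ + 1 / r ^ 2) ^ (3 / p₀) := by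
    have hpow : ∀ (a : ℝ) (m : ℕ), 0 < a → (a ^ m) ^ (1 / p₀) = a ^ (m / p₀) := fun a m ha => by
      rw [← Real.rpow_natCast, ← Real.rpow_mul ha.le, mul_one_div]
    rw [show 64 ^ 2 * A ^ 2 * (C₁ * ((1 + A ^ 2 * μ ^ 3) * t⁻¹ + 1 / r ^ 2)) ^ 3 =
      64 ^ 2 * C₁ ^ 3 * A ^ 2 * ((1 + A ^ 2 * μ ^ 3) * t⁻¹ + 1 / r ^ 2) ^ 3 by ring,
      Real.mul_rpow (by positivity) (by positivity), Real.mul_rpow (by positivity) (by positivity),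
      hpow A 2 hA, hpow _ 3 hK]
    norm_num
  rw [abs_of_nonneg (h0 t ht x hx).1, ← e, ← ENNReal.ofReal_rpow_of_nonneg (by positivity) hp,
    ← ENNReal.mul_rpow_of_nonneg _ _ hp]
  refine (ENNReal.ofReal_le_ofReal hle).trans ?_
  have hint : 0 ≤ ∫ s in (t / 2)..t, ∫ y, φ y ^ 3 * f s y ^ p₀ ∂(RiemannianHeat.vol (g s)) :=
    intervalIntegral.integral_nonneg (half_le_self ht.1.le) fun s hs =>
      MeasureTheory.integral_nonneg fun y =>
        h.pow_mul_rpow_nonneg hφ (fun y => (hφ01 y).1) (by norm_num) p₀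
          ⟨(half_pos ht.1).trans_le hs.1, hs.2.trans_lt ht.2⟩ y
  rw [← ENNReal.ofReal_rpow_of_nonneg (mul_nonneg (by positivity) hint) hp,
    ENNReal.ofReal_mul (by positivity)]
  gcongr
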